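/- \textbf{Setting.} Let $P$ be a finite set of points in the plane, no three of them collinear, and fix a grid of axis-parallel half-open square cells of side length $\ell>0$ (in the application $\ell=\gamma 3^{i-1}$). For a point $v$ let $N(v)$ be the union of the cell containing $v$ and its eight neighbouring cells. The adjacency graph joins $p,q\in P$ whenever $q\in N(p)$. Let $\mathcal A$ be a maximal planar straight-line graph on $P$ all of whose edges belong to the adjacency graph. Let $\sigma=\langle v_0,\dots,v_{m-1}\rangle$ (indices read cyclically) be the vertex sequence of the boundary of a face $f$ of $\mathcal A$ (or of one component of that boundary), traversed with $f$ on the right. An entry $v_i$ is \emph{convex} if the angle of $f$ at this entry is less than $\pi$ and \emph{reflex} otherwise (this angle is $2\pi$ if $v_{i-1}=v_{i+1}$ and $v_i$ has degree one). Two entries are \emph{visible} to each other if the open segment between them lies in $f$, contains no point of $P$, and at each of its two ends runs inside the sector of $f$ belonging to the entry concerned. The \emph{forward convex vertex} of an entry is the first convex entry after it, and its \emph{forward support vertex} is the entry after that; the \emph{backward convex vertex} is the last convex entry before it, and the \emph{backward support vertex} is the entry before that. For entries $u,y$, $\mathbb C(u,y)$ is the chain of consecutive entries from $u$ to $y$.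 It is a \emph{$1$-chain} if it has exactly one convex interior entry $c$, all its vertices lie in $N(c)$, and $u,y$ are visible to each other. It is a \emph{$2$-chain} if it has exactly two convex interior entries $v,x$, these are consecutive ($v$ before $x$), and $\mathbb C(u,x)$ and $\mathbb C(v,y)$ are $1$-chains. \textbf{Phase 1 on $\sigma$.} The start vertex $v_j$ is a backward support vertex of some reflex entry, or $v_0$ if there is none. Starting with $v_j$, each processed entry $p$ generates one chain beginning at $p$; the next processed entry is the last one of that chain, until the walk has returned to $v_j$. Let $v_{l-1}$ and $v_l$ be the forward convex and the forward support vertex of $p$. \begin{itemize} \item \emph{Step 1} applies if $v_{l-1}\in N(p)$ and $v_l$ is visible to $p$. (a) If $v_{l+1}$ is reflex and, for its backward convex vertex $v_{q+1}$ and backward support vertex $v_q$, $v_{q+1}\in N(v_{l+1})$ and $v_q$ is visible to $v_{l+1}$, then the chain is $\mathbb C(p,v_s)$, where $v_s$ is the last entry of the run of consecutive reflex entries beginning with $v_{l+1}$ such that $v_{q+1}\in N(v_s)$ and $v_q$ is visible to $v_s$. (b) Otherwise the chain is $\mathbb C(p,v_l)$. (c) However, if $v_{l-1}$ has already been visited (the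 search for it has come round to $v_j$ or beyond), then the chain is instead $\mathbb C(p,v_{j'})$, where $v_{j'}$ is the last entry of the chain generated at $v_j$. \item \emph{Step 2}: if Step 1 does not apply (in particular if there is no convex entry), the chain is the trivial one from $p$ to the next entry. \end{itemize} \textbf{Lemma.} If the algorithm, while processing an entry $u$, generates a chain $\mathbb C(u,y)$ that is a $2$-chain, then the open region $E(u,y)$ bounded by $\mathbb C(u,y)$ and the segment $\overline{uy}$ (the bounded part of the complement of this closed polygon) contains no point of $P$. -/

import Mathlib

/-! The plane is identified with `ℂ`. A grid is given by an origin `o` and a side length `ℓ`. -/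

namespace GridMWT

/-- The (half-open) cell of the grid containing `z`, given by its column and row. -/
noncomputable def cell (o : ℂ) (ℓ : ℝ) (z : ℂ) : ℤ × ℤ :=
  (⌊(z.re - o.re) / ℓ⌋, ⌊(z.im - o.im) / ℓ⌋)

/-- `nbhd o ℓ v` is `N(v)`: the union of the cell of `v` and the eight cells around it. -/
def nbhd (o : ℂ) (ℓ : ℝ) (v : ℂ) : Set ℂ :=
  {w | |(cell o ℓ w).1 - (cell o ℓ v).1| ≤ 1 ∧ |(cell o ℓ w).2 - (cell o ℓ v).2| ≤ 1}

/-- No three distinct points of `P` are collinear. -/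
def GeneralPosition (P : Finset ℂ) : Prop :=
  ∀ p ∈ P, ∀ q ∈ P, ∀ r ∈ P, p ≠ q → q ≠ r → p ≠ r → ¬ Collinear ℝ {p, q, r}

/-- `A` is a planar straight-line graph on the vertex set `P`: an edge contains no point of `P`
besides its endpoints, and two distinct edges meet at most in a common endpoint. -/
structure IsPSLG (P : Finset ℂ) (A : SimpleGraph ℂ) : Prop where
  left_mem : ∀ p q, A.Adj p q → p ∈ P
  vertex_on_edge : ∀ p q, A.Adj p q → ∀ r ∈ P, r ∈ segment ℝ p q → r = p ∨ r = q
  noncrossing : ∀ p q r s, A.Adj p q → A.Adj r s → s(p, q) ≠ s(r, s) →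
    ∀ z, z ∈ segment ℝ p q → z ∈ segment ℝ r s → (z = p ∨ z = q) ∧ (z = r ∨ z = s)

/-- The edges of `A` join points that lie in the same cell or in neighbouring cells of the grid,
that is, `A` is a subgraph of the adjacency graph of the grid. -/
def InAdjacencyGraph (o : ℂ) (ℓ : ℝ) (A : SimpleGraph ℂ) : Prop :=
  ∀ p q, A.Adj p q → q ∈ nbhd o ℓ p

/-- `A` is a maximal planar straight-line graph with respect to the adjacency graph. -/
def IsMaximalPSLG (P : Finset ℂ) (o : ℂ) (ℓ : ℝ) (A : SimpleGraph ℂ) : Prop :=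
  Maximal (fun B : SimpleGraph ℂ => IsPSLG P B ∧ InAdjacencyGraph o ℓ B) A

/-- The angle in `(0, 2π]` by which the ray from `b` through `a` has to be rotated
counterclockwise to become the ray from `b` through `c`. For a walk `a, b, c` this is the angle
at `b` on the right-hand side of the walk (`2π` if `c = a`). -/
noncomputable def rightAngle (a b c : ℂ) : ℝ :=
  if 0 < ((c - b) / (a - b)).arg then ((c - b) / (a - b)).arg
  else ((c - b) / (a - b)).arg + 2 * Real.pi

/-- `σ` is the boundary vertex sequence of a face of `A` (of one boundary component, if the
boundary of the face is not connected), extended periodically to `ℤ`: the walk along the boundary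
that keeps the face on its right. After arriving at `σ i` from `σ (i - 1)` the walk leaves along
the first edge of `A` at `σ i` in the counterclockwise rotation that starts just after the edge
just used; the sector of angle `rightAngle` swept in between is where the face touches `σ i`. A
vertex may occur several times. The number of entries of the sequence, `m`, is the least period. -/
structure IsBoundarySequence (A : SimpleGraph ℂ) (m : ℕ) (σ : ℤ → ℂ) : Prop where
  pos : 0 < m
  periodic : ∀ i, σ (i + m) = σ i
  minimal : ∀ k : ℕ, 0 < k → (∀ i, σ (i + k) = σ i) → m ≤ k
  adj : ∀ i, A.Adj (σ i) (σ (i + 1))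
  next : ∀ i w, A.Adj (σ i) w →
    rightAngle (σ (i - 1)) (σ i) (σ (i + 1)) ≤ rightAngle (σ (i - 1)) (σ i) w

/-- The `i`-th entry of the boundary sequence is convex (the walk makes a right turn). -/
def IsConvex (σ : ℤ → ℂ) (i : ℤ) : Prop :=
  rightAngle (σ (i - 1)) (σ i) (σ (i + 1)) < Real.pi

/-- The `i`-th entry of the boundary sequence is reflex. -/
def IsReflex (σ : ℤ → ℂ) (i : ℤ) : Prop := ¬ IsConvex σ i

/-- The point set of the drawing: all input points and all points on edges. -/
def drawing (P : Finset ℂ) (A : SimpleGraph ℂ) : Set ℂ :=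
  {z | z ∈ P ∨ ∃ p q, A.Adj p q ∧ z ∈ segment ℝ p q}

/-- The ray from `σ i` through `w` starts inside the sector at the `i`-th entry of the walk. -/
def InSector (σ : ℤ → ℂ) (i : ℤ) (w : ℂ) : Prop :=
  rightAngle (σ (i - 1)) (σ i) w < rightAngle (σ (i - 1)) (σ i) (σ (i + 1))

/-- The entries `i` and `k` of the boundary sequence of a face see each other: the open segment
between them lies in the face, that is, it avoids the drawing, and at both ends it lies in the
sector of the face that belongs to the entry. -/
def Visible (P : Finset ℂ) (A : SimpleGraph ℂ) (σ : ℤ → ℂ) (i k : ℤ) : Prop :=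
  Disjoint (openSegment ℝ (σ i) (σ k)) (drawing P A) ∧ InSector σ i (σ k) ∧ InSector σ k (σ i)

/-- `c` is the forward convex vertex of `p`, the first convex entry after `p`; the forward support
vertex of `p` is `c + 1`. -/
def IsForwardConvex (σ : ℤ → ℂ) (p c : ℤ) : Prop :=
  p < c ∧ IsConvex σ c ∧ ∀ t, p < t → t < c → IsReflex σ t

/-- `b` is the backward convex vertex of `r`, the last convex entry before `r`; the backward
support vertex of `r` is `b - 1`. -/
def IsBackwardConvex (σ : ℤ → ℂ) (r b : ℤ) : Prop :=
  b < r ∧ IsConvex σ b ∧ ∀ t, b < t → t < r → IsReflex σ t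

/-- `j` is the backward support vertex of some reflex vertex. -/
def IsBackwardSupport (σ : ℤ → ℂ) (j : ℤ) : Prop :=
  ∃ r, IsReflex σ r ∧ IsBackwardConvex σ r (j + 1)

/-- `j` is a start vertex: a backward support vertex, or `0` if there is none. -/
def IsStart (σ : ℤ → ℂ) (j : ℤ) : Prop :=
  IsBackwardSupport σ j ∨ ((∀ k, ¬ IsBackwardSupport σ k) ∧ j = 0)

section Algorithm

/-- Precondition of Step 1 for `p` with forward convex vertex `c`: `c` lies in `N(p)` and the
forward support vertex `c + 1` is visible to `p`. -/
def StepOne (P : Finset ℂ) (o : ℂ) (ℓ : ℝ) (A : SimpleGraph ℂ) (σ : ℤ → ℂ) (p c : ℤ) : Prop :=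
  IsForwardConvex σ p c ∧ σ c ∈ nbhd o ℓ (σ p) ∧ Visible P A σ p (c + 1)

/-- `s` lies on the reflex chain that begins with `c + 2` (the vertex after the forward support
vertex), and, for the backward convex vertex `b` of `c + 2`, `b` lies in `N(s)` and the backward
support vertex `b - 1` is visible to `s`. -/
def Extends (P : Finset ℂ) (o : ℂ) (ℓ : ℝ) (A : SimpleGraph ℂ) (σ : ℤ → ℂ) (c s : ℤ) : Prop :=
  c + 2 ≤ s ∧ (∀ t, c + 2 ≤ t → t ≤ s → IsReflex σ t) ∧
    ∃ b, IsBackwardConvex σ (c + 2) b ∧ σ b ∈ nbhd o ℓ (σ s) ∧ Visible P A σ (b - 1) s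

/-- The last entry `e` of the chain generated at `p` by Steps 1(a), 1(b) and 2.
If Step 1 applies, with forward convex vertex `c`:
(a) if `c + 2` is reflex, its backward convex vertex lies in `N(c + 2)` and its backward support
vertex is visible to it, then `e` is the last vertex of the reflex chain of `c + 2` with the same
property; (b) otherwise `e = c + 1`, the forward support vertex.
If Step 1 does not apply, Step 2 generates the trivial chain from `p` to `p + 1`. -/
def BasicChain (P : Finset ℂ) (o : ℂ) (ℓ : ℝ) (A : SimpleGraph ℂ) (σ : ℤ → ℂ) (p e : ℤ) : Prop :=
  (∃ c, StepOne P o ℓ A σ p c ∧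
    ((Extends P o ℓ A σ c (c + 2) ∧ IsGreatest {s | Extends P o ℓ A σ c s} e) ∨
      (¬ Extends P o ℓ A σ c (c + 2) ∧ e = c + 1))) ∨
  ((¬ ∃ c, StepOne P o ℓ A σ p c) ∧ e = p + 1)

/-- Step 1(c) applies at `p`: Step 1 applies, and the forward convex vertex has already been
visited, that is, the search for it has come round to the start vertex `j`. -/
def StepOneC (P : Finset ℂ) (o : ℂ) (ℓ : ℝ) (A : SimpleGraph ℂ) (m : ℕ) (σ : ℤ → ℂ)
    (j p : ℤ) : Prop :=
  ∃ c, StepOne P o ℓ A σ p c ∧ j + m ≤ c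

/-- The chain generated when `p` is processed in the run with start vertex `j` ends at `e`. In
Step 1(c) the chain ends where the chain generated at the start vertex ends. -/
def ProcessingYields (P : Finset ℂ) (o : ℂ) (ℓ : ℝ) (A : SimpleGraph ℂ) (m : ℕ) (σ : ℤ → ℂ)
    (j p e : ℤ) : Prop :=
  (StepOneC P o ℓ A m σ j p ∧ ∃ j', BasicChain P o ℓ A σ j j' ∧ e = j' + m) ∨
  (¬ StepOneC P o ℓ A m σ j p ∧ BasicChain P o ℓ A σ p e)

/-- The entries processed in the run with start vertex `j`: first `j`, and after `p` the last
vertex of the chain generated at `p`, until the walk has returned to `j`. -/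
inductive Processed (P : Finset ℂ) (o : ℂ) (ℓ : ℝ) (A : SimpleGraph ℂ) (m : ℕ) (σ : ℤ → ℂ)
    (j : ℤ) : ℤ → Prop
  | start : Processed P o ℓ A m σ j j
  | step (p e : ℤ) : Processed P o ℓ A m σ j p → ProcessingYields P o ℓ A m σ j p e →
      e < j + m → Processed P o ℓ A m σ j e

/-- The run with start vertex `j` processes `u` and then generates the chain from `u` to `y`. -/
def Generates (P : Finset ℂ) (o : ℂ) (ℓ : ℝ) (A : SimpleGraph ℂ) (m : ℕ) (σ : ℤ → ℂ)
    (j u y : ℤ) : Prop :=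
  Processed P o ℓ A m σ j u ∧ ProcessingYields P o ℓ A m σ j u y

end Algorithm

/-- The chain from `p` to `e` is a 1-chain whose only convex interior vertex is `c`: all its
vertices lie in `N(c)`, and its endpoints are visible to each other. -/
structure IsOneChain (P : Finset ℂ) (o : ℂ) (ℓ : ℝ) (A : SimpleGraph ℂ) (σ : ℤ → ℂ)
    (p c e : ℤ) : Prop where
  lt_left : p < c
  lt_right : c < e
  convex : IsConvex σ c
  reflex : ∀ t, p < t → t < e → t ≠ c → IsReflex σ t
  mem_nbhd : ∀ t, p ≤ t → t ≤ e → σ t ∈ nbhd o ℓ (σ c)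
  visible : Visible P A σ p e

/-- The chain from `u` to `y` is a 2-chain with convex interior vertices `v` and `v + 1`: the
chains from `u` to `v + 1` and from `v` to `y` are 1-chains. -/
def IsTwoChain (P : Finset ℂ) (o : ℂ) (ℓ : ℝ) (A : SimpleGraph ℂ) (σ : ℤ → ℂ)
    (u v y : ℤ) : Prop :=
  IsOneChain P o ℓ A σ u v (v + 1) ∧ IsOneChain P o ℓ A σ v (v + 1) y

/-- The closed polygon formed by the chain from `u` to `y` and the segment between its ends. -/
def closedPolygon (σ : ℤ → ℂ) (u y : ℤ) : Set ℂ :=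
  {z | (∃ t, u ≤ t ∧ t < y ∧ z ∈ segment ℝ (σ t) (σ (t + 1))) ∨ z ∈ segment ℝ (σ y) (σ u)}

/-- The region `E(u, y)` bounded by the chain from `u` to `y` and the segment between its ends:
the bounded part of the complement of the closed polygon. -/
def region (σ : ℤ → ℂ) (u y : ℤ) : Set ℂ :=
  {z | z ∉ closedPolygon σ u y ∧
    Bornology.IsBounded (connectedComponentIn (closedPolygon σ u y)ᶜ z)}

end GridMWT

/-!
Write `v`, `w = v + 1` for the two convex entries, and `u v w y` also for their points. The ends
of the two 1-chains see each other, so by maximality `u` is outside `N(w)` and `y` outside `N(v)`.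

*The chain consists of two hulls* (`IsFanWalk.exists_end`). From `w`, look into the angle between
`v` and `u`, and take the convex hull of the vertices in this cone. The part of the cone in front
of an edge `a b` of the hull contains no vertex, hence no piece of an edge (`IsPSLG.free_cone`).
The points `a`, `b` lie in `N(v)` and, apart from `v`, outside `N(w)`, and the position of the
cells forces them into neighbouring cells (`mem_nbhd_of_convex`). So `a b` is an edge of the
maximal graph, and the boundary walk follows it. Hence the chain from `v` back to `u` is the hull,
and so is the chain from `w` to `y`, seen from `v`.

*The region.* The segments `u w` and `v y` cross in a point `X` (`exists_isCrossing`). A ray that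
starts at a point of the region and points away from `X` has to meet the polygon, so the region is
covered by the triangles spanned by `X` and the sides of the polygon. The triangles over edges of
the chain contain no further vertex, by the choice of the hull. What remains is the pocket, the
triangle `u X y`.

*The pocket.* Suppose that it contains a vertex off `u y`, and let `h` be the vertex in it that
comes first when a ray is turned about `u` away from `X`, and `h'` the analogous vertex at `y`.
The part of the pocket in front of `u h` is not met by edges. If `u h` is not an edge, then `h` is
outside `N(u)`, and also outside `N(v)`, since a vertex of the hull sees `h` and either this
vertex or `u` would have `h` in its neighbourhood (`IsFanChain.notMem_nbhd`). Likewise for `h'`,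
`N(y)` and `N(w)`. As `h` is in the triangle `X u h'`, it also follows that `h'` is outside
`N(v)`, and `h` outside `N(w)`. Both points are then outside `N(v) ∪ N(w)`, hence in one and the
same cell at a corner, and that cell is next to the cell of `u` or of `y` (`false_of_corner`). So
`u h` or `y h'` is an edge.

*The algorithm* excludes this. If `u h` is an edge, then `h` is the entry before `u`, and `u` is
convex. As `u` has been processed, either the entry before `u` is convex, and then an edge at `h`
enters the empty part of the pocket, or Step 1 does not apply at the entry before `u`, although it
sees the entry after `u` (`IsTwoChain.not_adj_left`). If `y h'` is an edge, then `h'` is the entry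
after `y`, and `y` is convex; but the algorithm ends a 2-chain at a reflex entry unless all
entries are convex, and in that case an edge at `h'` enters the empty part of the pocket
(`IsTwoChain.not_adj_right`).
-/

namespace GridMWT

/-! ### Orientations -/

/-- `orient ε a b c` is `ε` times twice the signed area of the triangle `a, b, c`. With `ε = 1` it
is positive if the triangle is counterclockwise; `ε = -1` gives the mirror image, so that one
argument serves both ends of the chain. -/
def orient (ε : ℝ) (a b c : ℂ) : ℝ :=
  ε * ((b.re - a.re) * (c.im - a.im) - (b.im - a.im) * (c.re - a.re))

theorem orient_rot (ε : ℝ) (a b c : ℂ) : orient ε a b c = orient ε b c a := by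
  unfold orient; ring

theorem orient_swap (ε : ℝ) (a b c : ℂ) : orient ε a c b = -orient ε a b c := by
  unfold orient; ring

theorem orient_swap_left (ε : ℝ) (a b c : ℂ) : orient ε b a c = -orient ε a b c := by
  unfold orient; ring

theorem orient_neg (ε : ℝ) (a b c : ℂ) : orient (-ε) a b c = -orient ε a b c := by
  unfold orient; ring

@[simp] theorem orient_self_left (ε : ℝ) (a b : ℂ) : orient ε a a b = 0 := by
  unfold orient; ring

@[simp] theorem orient_self_right (ε : ℝ) (a b : ℂ) : orient ε a b b = 0 := by
  unfold orient; ring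

@[simp] theorem orient_self_mid (ε : ℝ) (a b : ℂ) : orient ε a b a = 0 := by
  unfold orient; ring

theorem ne_of_orient {ε : ℝ} {a b c : ℂ} (h : 0 < orient ε a b c) : a ≠ b ∧ b ≠ c ∧ a ≠ c := by
  refine ⟨?_, ?_, ?_⟩ <;> rintro rfl <;> simp at h

/-- The Plücker relation for four directions at `a`. -/
theorem orient_pluecker (ε : ℝ) (a b c d e : ℂ) :
    orient ε a b d * orient ε a c e =
      orient ε a b c * orient ε a d e + orient ε a b e * orient ε a c d := by
  unfold orient; ring

theorem orient_comb {ε : ℝ} {c d p q z : ℂ} {s t : ℝ} (hst : s + t = 1)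
    (hz : s • p + t • q = z) : orient ε c d z = s * orient ε c d p + t * orient ε c d q := by
  subst hz
  obtain rfl : s = 1 - t := by linarith
  simp only [orient, Complex.add_re, Complex.add_im, Complex.real_smul, Complex.mul_re,
    Complex.mul_im, Complex.ofReal_re, Complex.ofReal_im]
  ring

theorem orient_of_mem_openSegment {p q z : ℂ} (hz : z ∈ openSegment ℝ p q) :
    ∃ s t : ℝ, 0 < s ∧ 0 < t ∧ s + t = 1 ∧
      ∀ ε c d, orient ε c d z = s * orient ε c d p + t * orient ε c d q := by
  obtain ⟨s, t, hs, ht, hst, h⟩ := hz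
  exact ⟨s, t, hs, ht, hst, fun ε c d => orient_comb hst h⟩

theorem orient_of_mem_segment {p q z : ℂ} (hz : z ∈ segment ℝ p q) :
    ∃ s t : ℝ, 0 ≤ s ∧ 0 ≤ t ∧ s + t = 1 ∧
      ∀ ε c d, orient ε c d z = s * orient ε c d p + t * orient ε c d q := by
  obtain ⟨s, t, hs, ht, hst, h⟩ := hz
  exact ⟨s, t, hs, ht, hst, fun ε c d => orient_comb hst h⟩

/-- A point on the line through `x` and `a`, in terms of its position on that line. -/
theorem exists_smul_of_orient_eq_zero {ε : ℝ} (hε : ε ≠ 0) {x a z : ℂ} (hxa : x ≠ a)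
    (h : orient ε x a z = 0) : ∃ t : ℝ, z = (1 - t) • x + t • a := by
  have h0 : (a.re - x.re) * (z.im - x.im) - (a.im - x.im) * (z.re - x.re) = 0 := by
    unfold orient at h
    rcases mul_eq_zero.1 h with h | h
    · exact absurd h hε
    · exact h
  have hn : (a.re - x.re) ^ 2 + (a.im - x.im) ^ 2 ≠ 0 := by
    intro h1
    apply hxa
    have h2 : a.re - x.re = 0 := by nlinarith [sq_nonneg (a.re - x.re), sq_nonneg (a.im - x.im)]
    have h3 : a.im - x.im = 0 := by nlinarith [sq_nonneg (a.re - x.re), sq_nonneg (a.im - x.im)]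
    exact Complex.ext (by linarith) (by linarith)
  refine ⟨((z.re - x.re) * (a.re - x.re) + (z.im - x.im) * (a.im - x.im)) /
    ((a.re - x.re) ^ 2 + (a.im - x.im) ^ 2), ?_⟩
  apply Complex.ext
  · simp only [Complex.add_re, Complex.real_smul, Complex.mul_re, Complex.ofReal_re,
      Complex.ofReal_im]
    field_simp
    linear_combination (-(a.im - x.im)) * h0
  · simp only [Complex.add_im, Complex.real_smul, Complex.mul_im, Complex.ofReal_re,
      Complex.ofReal_im]
    field_simp
    linear_combination (a.re - x.re) * h0

theorem collinear_of_orient_eq_zero {ε : ℝ} (hε : ε ≠ 0) {a b c : ℂ} (h : orient ε a b c = 0) :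
    Collinear ℝ {a, b, c} := by
  by_cases hab : a = b
  · subst hab
    simpa using collinear_pair ℝ a c
  obtain ⟨t, ht⟩ := exists_smul_of_orient_eq_zero hε hab h
  rw [collinear_iff_of_mem (p₀ := a) (by simp)]
  refine ⟨b - a, ?_⟩
  rintro p (rfl | rfl | rfl)
  · exact ⟨0, by simp⟩
  · exact ⟨1, by simp⟩
  · refine ⟨t, ?_⟩
    rw [ht]
    simp only [vadd_eq_add, Complex.real_smul, Complex.ofReal_sub, Complex.ofReal_one]
    ring

theorem GeneralPosition.eq_of_orient {P : Finset ℂ} (hP : GeneralPosition P) {ε : ℝ} (hε : ε ≠ 0)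
    {a b c : ℂ} (ha : a ∈ P) (hb : b ∈ P) (hc : c ∈ P) (h : orient ε a b c = 0) (hab : a ≠ b) :
    c = a ∨ c = b := by
  by_contra hcon
  push Not at hcon
  exact hP a ha b hb c hc hab (Ne.symm hcon.2) (Ne.symm hcon.1)
    (collinear_of_orient_eq_zero hε h)

theorem GeneralPosition.notMem_openSegment {P : Finset ℂ} (hP : GeneralPosition P)
    {a b c : ℂ} (ha : a ∈ P) (hb : b ∈ P) (hc : c ∈ P) (hab : a ≠ b) :
    c ∉ openSegment ℝ a b := by
  intro h
  obtain ⟨s, t, hs, ht, hst, H⟩ := orient_of_mem_openSegment h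
  have h0 : orient 1 a b c = 0 := by rw [H]; simp
  rcases hP.eq_of_orient one_ne_zero ha hb hc h0 hab with rfl | rfl
  · exact hab (left_mem_openSegment_iff.1 h)
  · exact hab (right_mem_openSegment_iff.1 h)

/-- Among finitely many points strictly to one side of the line from `w` to `t`, some point `q`
comes first when the ray from `t` through `w` is rotated towards them. -/
theorem exists_first_by_angle {ε : ℝ} {w t : ℂ} {C : Finset ℂ} (hC : C.Nonempty)
    (h : ∀ p ∈ C, 0 < orient ε w t p) : ∃ q ∈ C, ∀ p ∈ C, orient ε t q p ≤ 0 := by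
  set f : ℂ → ℝ := fun p => ((w.re - t.re) * (p.re - t.re) + (w.im - t.im) * (p.im - t.im)) /
    orient ε w t p with hf
  obtain ⟨q, hq, hmax⟩ := C.exists_max_image f hC
  refine ⟨q, hq, fun p hp => ?_⟩
  have h1 := hmax p hp
  simp only [hf] at h1
  rw [div_le_div_iff₀ (h p hp) (h q hq)] at h1
  have hwt : 0 < (w.re - t.re) ^ 2 + (w.im - t.im) ^ 2 := by
    by_contra hcon
    have h2 : w.re - t.re = 0 := by nlinarith [sq_nonneg (w.re - t.re), sq_nonneg (w.im - t.im)]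
    have h3 : w.im - t.im = 0 := by nlinarith [sq_nonneg (w.re - t.re), sq_nonneg (w.im - t.im)]
    have := h p hp
    unfold orient at this
    rw [show t.re - w.re = 0 by linarith, show t.im - w.im = 0 by linarith] at this
    simp at this
  by_contra hcon
  push Not at hcon
  have key : ((w.re - t.re) ^ 2 + (w.im - t.im) ^ 2) * orient ε t q p =
      ((w.re - t.re) * (p.re - t.re) + (w.im - t.im) * (p.im - t.im)) * orient ε w t q -
      ((w.re - t.re) * (q.re - t.re) + (w.im - t.im) * (q.im - t.im)) * orient ε w t p := by
    unfold orient; ring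
  nlinarith [mul_pos hwt hcon]

/-! ### Neighbourhoods -/

theorem mem_nbhd_comm {o : ℂ} {ℓ : ℝ} {v w : ℂ} : v ∈ nbhd o ℓ w ↔ w ∈ nbhd o ℓ v := by
  simp only [nbhd, Set.mem_ofPred_eq]
  rw [abs_sub_comm (cell o ℓ v).1, abs_sub_comm (cell o ℓ v).2]

theorem self_mem_nbhd {o : ℂ} {ℓ : ℝ} {v : ℂ} : v ∈ nbhd o ℓ v := by
  simp [nbhd]

theorem convex_abs_floor_le (k : ℤ) (a ℓ : ℝ) (hℓ : 0 < ℓ) :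
    Convex ℝ {x : ℝ | |⌊(x - a) / ℓ⌋ - k| ≤ 1} := by
  have : {x : ℝ | |⌊(x - a) / ℓ⌋ - k| ≤ 1} = Set.Ico (a + ℓ * (k - 1)) (a + ℓ * (k + 2)) := by
    ext x
    simp only [Set.mem_ofPred_eq, Set.mem_Ico, abs_le]
    constructor
    · rintro ⟨h1, h2⟩
      have h3 : (k - 1 : ℤ) ≤ ⌊(x - a) / ℓ⌋ := by linarith
      have h4 : ⌊(x - a) / ℓ⌋ < k + 2 := by linarith
      rw [Int.le_floor, le_div_iff₀ hℓ] at h3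
      rw [Int.floor_lt, div_lt_iff₀ hℓ] at h4
      push_cast at h3 h4
      constructor <;> linarith
    · rintro ⟨h1, h2⟩
      have h3 : (k - 1 : ℤ) ≤ ⌊(x - a) / ℓ⌋ := by
        rw [Int.le_floor, le_div_iff₀ hℓ]; push_cast; linarith
      have h4 : ⌊(x - a) / ℓ⌋ < k + 2 := by
        rw [Int.floor_lt, div_lt_iff₀ hℓ]; push_cast; linarith
      constructor <;> linarith
  rw [this]
  exact convex_Ico _ _

theorem convex_nbhd {o : ℂ} {ℓ : ℝ} (hℓ : 0 < ℓ) (v : ℂ) : Convex ℝ (nbhd o ℓ v) := by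
  have h1 : nbhd o ℓ v =
      Complex.reLm ⁻¹' {x : ℝ | |⌊(x - o.re) / ℓ⌋ - (cell o ℓ v).1| ≤ 1} ∩
      Complex.imLm ⁻¹' {x : ℝ | |⌊(x - o.im) / ℓ⌋ - (cell o ℓ v).2| ≤ 1} := by
    ext z
    simp [nbhd, cell]
  rw [h1]
  exact ((convex_abs_floor_le _ _ _ hℓ).linear_preimage _).inter
    ((convex_abs_floor_le _ _ _ hℓ).linear_preimage _)

/-! ### Planar straight-line graphs -/

theorem IsPSLG.right_mem {P : Finset ℂ} {A : SimpleGraph ℂ} (hA : IsPSLG P A) {p q : ℂ}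
    (h : A.Adj p q) : q ∈ P := hA.left_mem q p h.symm

theorem mem_segment_cases {x y z : ℂ} (h : z ∈ segment ℝ x y) :
    z = x ∨ z = y ∨ z ∈ openSegment ℝ x y := by
  by_cases h1 : x = z
  · exact Or.inl h1.symm
  by_cases h2 : y = z
  · exact Or.inr (Or.inl h2.symm)
  exact Or.inr (Or.inr (mem_openSegment_of_ne_left_right h1 h2 h))

/-- In a maximal graph, two points in neighbouring cells are adjacent unless some other edge
crosses the segment between them. -/
theorem IsMaximalPSLG.adj_of_unblocked {P : Finset ℂ} {o : ℂ} {ℓ : ℝ} {A : SimpleGraph ℂ}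
    (hmax : IsMaximalPSLG P o ℓ A) (hP : GeneralPosition P) {x y : ℂ} (hx : x ∈ P) (hy : y ∈ P)
    (hne : x ≠ y) (hN : y ∈ nbhd o ℓ x)
    (hfree : ∀ p q, A.Adj p q → ∀ z ∈ openSegment ℝ x y, z ∈ segment ℝ p q → s(p, q) = s(x, y)) :
    A.Adj x y := by
  by_contra hadj
  have hA := hmax.prop.1
  have hnew : ∀ p q, s(p, q) = s(x, y) → (p = x ∧ q = y) ∨ (p = y ∧ q = x) := by
    intro p q h
    simpa using h
  have hadj' : ∀ p q, s(p, q) = s(x, y) → ¬ A.Adj p q := by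
    intro p q h hpq
    rcases hnew p q h with ⟨rfl, rfl⟩ | ⟨rfl, rfl⟩
    · exact hadj hpq
    · exact hadj hpq.symm
  let B : SimpleGraph ℂ :=
    { Adj := fun p q => A.Adj p q ∨ s(p, q) = s(x, y)
      symm := ⟨fun p q h => h.imp (fun h => h.symm) (fun h => by rw [Sym2.eq_swap]; exact h)⟩
      loopless := ⟨fun p h => by
        rcases h with h | h
        · exact A.loopless.irrefl p h
        · rcases hnew p p h with ⟨h1, h2⟩ | ⟨h1, h2⟩
          · exact hne (h1.symm.trans h2)
          · exact hne (h2.symm.trans h1)⟩ }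
  have hseg : ∀ p q, s(p, q) = s(x, y) → segment ℝ p q = segment ℝ x y := by
    intro p q h
    rcases hnew p q h with ⟨rfl, rfl⟩ | ⟨rfl, rfl⟩
    · rfl
    · exact segment_symm ℝ _ _
  have hmix : ∀ p q r s, A.Adj p q → s(r, s) = s(x, y) → ∀ z, z ∈ segment ℝ p q →
      z ∈ segment ℝ r s → (z = p ∨ z = q) ∧ (z = r ∨ z = s) := by
    intro p q r s hpq hrs z hz1 hz2
    rw [hseg r s hrs] at hz2
    have hzxy : z = x ∨ z = y := by
      rcases mem_segment_cases hz2 with h | h | h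
      · exact Or.inl h
      · exact Or.inr h
      · exact absurd hpq (hadj' p q (hfree p q hpq z h hz1))
    have hzP : z ∈ P := by rcases hzxy with rfl | rfl <;> assumption
    refine ⟨hA.vertex_on_edge p q hpq z hzP hz1, ?_⟩
    rcases hnew r s hrs with ⟨rfl, rfl⟩ | ⟨rfl, rfl⟩
    · exact hzxy
    · exact hzxy.symm
  have hB : IsPSLG P B ∧ InAdjacencyGraph o ℓ B := by
    refine ⟨⟨?_, ?_, ?_⟩, ?_⟩
    · rintro p q (h | h)
      · exact hA.left_mem p q h
      · rcases hnew p q h with ⟨rfl, rfl⟩ | ⟨rfl, rfl⟩ <;> assumption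
    · rintro p q (h | h) r hr hrs
      · exact hA.vertex_on_edge p q h r hr hrs
      · rw [hseg p q h] at hrs
        have : r = x ∨ r = y := by
          rcases mem_segment_cases hrs with h | h | h
          · exact Or.inl h
          · exact Or.inr h
          · exact absurd h (hP.notMem_openSegment hx hy hr hne)
        rcases hnew p q h with ⟨rfl, rfl⟩ | ⟨rfl, rfl⟩
        · exact this
        · exact this.symm
    · rintro p q r s (h1 | h1) (h2 | h2) hne' z hz1 hz2
      · exact hA.noncrossing p q r s h1 h2 hne' z hz1 hz2
      · exact hmix p q r s h1 h2 z hz1 hz2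
      · exact (hmix r s p q h2 h1 z hz2 hz1).symm
      · exact absurd (h1.trans h2.symm) hne'
    · rintro p q (h | h)
      · exact hmax.prop.2 p q h
      · rcases hnew p q h with ⟨rfl, rfl⟩ | ⟨rfl, rfl⟩
        · exact hN
        · exact mem_nbhd_comm.1 hN
  have hle : A ≤ B := fun p q h => Or.inl h
  exact hadj (hmax.le_of_ge hB hle (Or.inr rfl : B.Adj x y))

/-- `Unblocked A ε x a` says that no edge crosses the open segment from `x` to `a`. -/
def Unblocked (A : SimpleGraph ℂ) (ε : ℝ) (x a : ℂ) : Prop :=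
  ∀ p q, A.Adj p q → ∀ z ∈ openSegment ℝ x a, z ∈ segment ℝ p q →
    orient ε x a p = 0 ∧ orient ε x a q = 0

theorem IsPSLG.unblocked_of_adj {P : Finset ℂ} {A : SimpleGraph ℂ} (hA : IsPSLG P A) {x a : ℂ}
    (h : A.Adj x a) (ε : ℝ) : Unblocked A ε x a := by
  intro p q hpq z hz1 hz2
  by_cases hs : s(p, q) = s(x, a)
  · rcases Sym2.eq_iff.1 hs with ⟨rfl, rfl⟩ | ⟨rfl, rfl⟩ <;> simp
  · exfalso
    have := (hA.noncrossing p q x a hpq h hs z hz2 (openSegment_subset_segment ℝ _ _ hz1)).2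
    rcases this with rfl | rfl
    · exact h.ne (left_mem_openSegment_iff.1 hz1)
    · exact h.ne (right_mem_openSegment_iff.1 hz1)

theorem unblocked_of_disjoint {P : Finset ℂ} {A : SimpleGraph ℂ} {x a : ℂ} (ε : ℝ)
    (h : Disjoint (openSegment ℝ x a) (drawing P A)) : Unblocked A ε x a :=
  fun p q hpq _ hz1 hz2 => absurd (Or.inr ⟨p, q, hpq, hz2⟩) (Set.disjoint_left.1 h hz1)

/-- Let `x, a, b` be a triangle whose sides at `x` are not crossed by edges, such that no edge at
`x` leaves into the angle at `x`. If there is no vertex in the part of the angle on the side of `x`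
of a line separating `x` from `a` and `b`, then no edge meets that part: an edge that did could
be followed in the direction in which it does not approach the line, and would have to leave
through one of the two sides. -/
theorem IsPSLG.free_cone {P : Finset ℂ} {A : SimpleGraph ℂ} (hA : IsPSLG P A) {ε : ℝ}
    (hε : ε ≠ 0) {x a b c d : ℂ} (hab : 0 < orient ε x a b) (ga : orient ε c d a ≤ 0)
    (gb : orient ε c d b ≤ 0) (gx : 0 < orient ε c d x) (ha : Unblocked A ε x a)
    (hb : Unblocked A ε x b)
    (hx : ∀ p q, A.Adj p q → x ∈ segment ℝ p q → x = p ∨ x = q)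
    (hx' : ∀ z, A.Adj x z → 0 < orient ε x a z → 0 < orient ε x z b → False)
    (hP : ∀ p ∈ P, 0 < orient ε x a p → 0 < orient ε x p b → orient ε c d p ≤ 0)
    {p q z : ℂ} (hpq : A.Adj p q) (hz : z ∈ segment ℝ p q) (hza : 0 < orient ε x a z)
    (hzb : 0 < orient ε x z b) : orient ε c d z ≤ 0 := by
  by_contra hcon
  push Not at hcon
  obtain ⟨hxa, -, hxb⟩ := ne_of_orient hab
  -- an edge through `x` cannot contain `z`
  have hapex : x ∉ segment ℝ p q := by
    have aux : ∀ q', A.Adj x q' → z ∈ segment ℝ x q' → False := by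
      intro q' h' hz'
      obtain ⟨s, t, hs, ht, hst, H⟩ := orient_of_mem_segment hz'
      have h1 := H ε x a
      have h2 : orient ε x z b = t * orient ε x q' b := by
        have := H ε b x
        rw [orient_rot ε x z b, orient_rot ε z b x, this, orient_rot ε x q' b,
          orient_rot ε q' b x]
        simp
      simp only [orient_self_mid, mul_zero, zero_add] at h1
      have ht' : 0 < t := by
        rcases ht.lt_or_eq with h | h
        · exact h
        · rw [← h] at h1; linarith
      refine hx' q' h' ?_ ?_
      · rw [h1] at hza; exact (mul_pos_iff_of_pos_left ht').1 hza
      · rw [h2] at hzb; exact (mul_pos_iff_of_pos_left ht').1 hzb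
    intro hxs
    rcases hx p q hpq hxs with rfl | rfl
    · exact aux q hpq hz
    · exact aux p hpq.symm (by rwa [segment_symm])
  have hline : ∀ e, orient ε x e p = 0 ∧ orient ε x e q = 0 → orient ε x e z = 0 := by
    intro e he
    obtain ⟨s, t, -, -, -, H⟩ := orient_of_mem_segment hz
    rw [H, he.1, he.2]; ring
  have exit_a : ∀ z' ∈ segment ℝ p q, orient ε x a z' = 0 → 0 ≤ orient ε x z' b →
      0 < orient ε c d z' → False := by
    intro z' hz' h1 h2 h3
    obtain ⟨l, hl⟩ := exists_smul_of_orient_eq_zero hε hxa h1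
    have e2 : orient ε b x z' = l * orient ε b x a := by
      rw [orient_comb (by ring) hl.symm]; simp
    have e3 := orient_comb (ε := ε) (c := c) (d := d) (by ring) hl.symm
    rw [orient_rot, orient_rot, e2, ← orient_rot ε a b x, ← orient_rot ε x a b] at h2
    have l0 : 0 ≤ l := nonneg_of_mul_nonneg_left h2 hab
    rcases l0.lt_or_eq with l0 | l0
    · have l1 : l < 1 := by
        by_contra hl1
        push Not at hl1
        nlinarith
      have := ha p q hpq z' ⟨1 - l, l, by linarith, l0, by ring, hl.symm⟩ hz'
      have := hline a this
      linarith
    · subst l0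
      apply hapex
      simpa [hl] using hz'
  have exit_b : ∀ z' ∈ segment ℝ p q, orient ε x z' b = 0 → 0 ≤ orient ε x a z' →
      0 < orient ε c d z' → False := by
    intro z' hz' h1 h2 h3
    have h1' : orient ε x b z' = 0 := by rw [orient_swap, h1]; simp
    obtain ⟨l, hl⟩ := exists_smul_of_orient_eq_zero hε hxb h1'
    have e2 : orient ε x a z' = l * orient ε x a b := by
      rw [orient_comb (by ring) hl.symm]; simp
    have e3 := orient_comb (ε := ε) (c := c) (d := d) (by ring) hl.symm
    rw [e2] at h2
    have l0 : 0 ≤ l := nonneg_of_mul_nonneg_left h2 hab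
    rcases l0.lt_or_eq with l0 | l0
    · have l1 : l < 1 := by
        by_contra hl1
        push Not at hl1
        nlinarith
      have := hb p q hpq z' ⟨1 - l, l, by linarith, l0, by ring, hl.symm⟩ hz'
      have := hline b this
      rw [orient_swap] at this
      linarith
    · subst l0
      apply hapex
      simpa [hl] using hz'
  -- follow the edge from `z` to an endpoint `e` that is at least as far from the line
  have main : ∀ e, e ∈ P → segment ℝ z e ⊆ segment ℝ p q → orient ε c d z ≤ orient ε c d e →
      False := by
    intro e heP hsub hge
    have hpt : ∀ t : ℝ, 0 ≤ t → t ≤ 1 → ∃ z' ∈ segment ℝ p q,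
        orient ε x a z' = (1 - t) * orient ε x a z + t * orient ε x a e ∧
        orient ε x z' b = (1 - t) * orient ε x z b + t * orient ε x e b ∧
        0 < orient ε c d z' := by
      intro t h0 h1
      refine ⟨(1 - t) • z + t • e, hsub ⟨1 - t, t, by linarith, h0, by ring, rfl⟩,
        orient_comb (by ring) rfl, ?_, ?_⟩
      · rw [orient_rot, orient_rot, orient_comb (by ring) rfl, orient_rot ε x z b,
          orient_rot ε z b x, orient_rot ε x e b, orient_rot ε e b x]
      · rw [orient_comb (z := (1 - t) • z + t • e) (s := 1 - t) (by ring) rfl]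
        nlinarith
    have hnot : orient ε x a e ≤ 0 ∨ orient ε x e b ≤ 0 := by
      by_contra hno
      push Not at hno
      have := hP e heP hno.1 hno.2
      linarith
    have hta : orient ε x a e ≤ 0 → ∃ t : ℝ, 0 < t ∧ t ≤ 1 ∧
        (1 - t) * orient ε x a z + t * orient ε x a e = 0 := by
      intro h
      refine ⟨orient ε x a z / (orient ε x a z - orient ε x a e), by
        apply div_pos hza; linarith, by rw [div_le_one (by linarith)]; linarith, ?_⟩
      have : orient ε x a z - orient ε x a e ≠ 0 := by linarith
      field_simp
      ring
    have htb : orient ε x e b ≤ 0 → ∃ t : ℝ, 0 < t ∧ t ≤ 1 ∧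
        (1 - t) * orient ε x z b + t * orient ε x e b = 0 := by
      intro h
      refine ⟨orient ε x z b / (orient ε x z b - orient ε x e b), by
        apply div_pos hzb; linarith, by rw [div_le_one (by linarith)]; linarith, ?_⟩
      have : orient ε x z b - orient ε x e b ≠ 0 := by linarith
      field_simp
      ring
    by_cases h1 : orient ε x a e ≤ 0
    · obtain ⟨t, t0, t1, ht⟩ := hta h1
      obtain ⟨z', hz', e1, e2, e3⟩ := hpt t t0.le t1
      by_cases h2 : 0 ≤ orient ε x z' b
      · exact exit_a z' hz' (e1.trans ht) h2 e3
      · push Not at h2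
        rw [e2] at h2
        have h3 : orient ε x e b < 0 := by
          by_contra h3
          push Not at h3
          have := mul_nonneg t0.le h3
          have := mul_nonneg (sub_nonneg.2 t1) hzb.le
          linarith
        obtain ⟨r, r0, r1, hr⟩ := htb h3.le
        obtain ⟨z'', hz'', f1, f2, f3⟩ := hpt r r0.le r1
        refine exit_b z'' hz'' (f2.trans hr) ?_ f3
        rw [f1]
        have hrt : r < t := by nlinarith
        nlinarith
    · have h2 := hnot.resolve_left h1
      obtain ⟨t, t0, t1, ht⟩ := htb h2
      obtain ⟨z', hz', e1, e2, e3⟩ := hpt t t0.le t1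
      refine exit_b z' hz' (e2.trans ht) ?_ e3
      rw [e1]
      push Not at h1
      have := mul_nonneg t0.le h1.le
      have := mul_nonneg (sub_nonneg.2 t1) hza.le
      linarith
  obtain ⟨s, t, hs, ht, hst, H⟩ := orient_of_mem_segment hz
  have hconv := convex_segment (𝕜 := ℝ) p q
  by_cases hle : orient ε c d z ≤ orient ε c d p
  · exact main p (hA.left_mem p q hpq) (hconv.segment_subset hz (left_mem_segment ℝ p q)) hle
  · refine main q (hA.right_mem hpq) (hconv.segment_subset hz (right_mem_segment ℝ p q)) ?_
    have := H ε c d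
    push Not at hle
    by_contra hlt
    push Not at hlt
    have h1 := mul_le_mul_of_nonneg_left hle.le hs
    have h2 := mul_le_mul_of_nonneg_left hlt.le ht
    obtain rfl : s = 1 - t := by linarith
    rcases ht.lt_or_eq with h | h
    · have := mul_lt_mul_of_pos_left hlt h
      linarith
    · subst h
      linarith

theorem exists_small {α β : ℝ} (hα : 0 < α) (hβ : 0 < β) (d e : ℝ) :
    ∃ t : ℝ, 0 < t ∧ t < 1 ∧ 0 < (1 - t) * α + t * d ∧ 0 < (1 - t) * β + t * e := by
  have h : ∀ᶠ t in nhdsWithin (0 : ℝ) (Set.Ioi 0),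
      0 < (1 - t) * α + t * d ∧ 0 < (1 - t) * β + t * e := by
    apply Filter.Eventually.filter_mono nhdsWithin_le_nhds
    apply Filter.Eventually.and
    · have : ContinuousAt (fun t : ℝ => (1 - t) * α + t * d) 0 := by fun_prop
      exact this.eventually (lt_mem_nhds (by simpa using hα))
    · have : ContinuousAt (fun t : ℝ => (1 - t) * β + t * e) 0 := by fun_prop
      exact this.eventually (lt_mem_nhds (by simpa using hβ))
  have h1 : ∀ᶠ t in nhdsWithin (0 : ℝ) (Set.Ioi 0), t ∈ Set.Ioo (0 : ℝ) 1 :=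
    Ioo_mem_nhdsGT one_pos
  obtain ⟨t, h2, h3⟩ := (h.and h1).exists
  exact ⟨t, h3.1, h3.2, h2.1, h2.2⟩

/-- If no edge meets the part of the cone at `x` on the near side of the line through `c` and `d`,
then an edge meeting the open segment from `c` to `d` inside the cone is that segment. -/
theorem IsPSLG.eq_of_far_side {P : Finset ℂ} {A : SimpleGraph ℂ} (hA : IsPSLG P A)
    (hP : GeneralPosition P) {ε : ℝ} (hε : ε ≠ 0) {x a b c d : ℂ}
    (hfree : ∀ p q z, A.Adj p q → z ∈ segment ℝ p q → 0 < orient ε x a z → 0 < orient ε x z b →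
      orient ε c d z ≤ 0) (hc : c ∈ P) (hd : d ∈ P) (hcd : c ≠ d) {p q z : ℂ} (hpq : A.Adj p q)
    (hzs : z ∈ openSegment ℝ c d) (hz : z ∈ segment ℝ p q) (hza : 0 < orient ε x a z)
    (hzb : 0 < orient ε x z b) : s(p, q) = s(c, d) := by
  have hp := hA.left_mem p q hpq
  have hq := hA.right_mem hpq
  have hz0 : orient ε c d z = 0 := by
    obtain ⟨s, t, -, -, -, H⟩ := orient_of_mem_openSegment hzs
    rw [H]; simp
  have hzP : z ∉ P := fun h => hP.notMem_openSegment hc hd h hcd hzs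
  have aux : ∀ e, segment ℝ z e ⊆ segment ℝ p q → orient ε c d e ≤ 0 := by
    intro e hsub
    by_contra hcon
    push Not at hcon
    obtain ⟨t, t0, t1, h1, h2⟩ := exists_small hza hzb (orient ε x a e) (orient ε x e b)
    have := hfree p q ((1 - t) • z + t • e) hpq
      (hsub ⟨1 - t, t, by linarith, t0.le, by ring, rfl⟩)
      (by rw [orient_comb (by ring) rfl]; exact h1)
      (by
        rw [orient_rot, orient_rot, orient_comb (by ring) rfl, ← orient_rot ε z b x,
          ← orient_rot ε x z b, ← orient_rot ε e b x, ← orient_rot ε x e b]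
        exact h2)
    rw [orient_comb (z := (1 - t) • z + t • e) (s := 1 - t) (by ring) rfl, hz0] at this
    nlinarith
  have hconv := convex_segment (𝕜 := ℝ) p q
  have hp0 := aux p (hconv.segment_subset hz (left_mem_segment ℝ p q))
  have hq0 := aux q (hconv.segment_subset hz (right_mem_segment ℝ p q))
  have hzo : z ∈ openSegment ℝ p q := by
    rcases mem_segment_cases hz with rfl | rfl | h
    · exact absurd hp hzP
    · exact absurd hq hzP
    · exact h
  obtain ⟨s, t, hs, ht, hst, H⟩ := orient_of_mem_openSegment hzo
  have h1 := H ε c d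
  rw [hz0] at h1
  have hp1 : orient ε c d p = 0 := by nlinarith
  have hq1 : orient ε c d q = 0 := by nlinarith
  have hne := hpq.ne
  rcases hP.eq_of_orient hε hc hd hp hp1 hcd with rfl | rfl <;>
    rcases hP.eq_of_orient hε hc hd hq hq1 hcd with rfl | rfl
  · exact absurd rfl hne
  · rfl
  · exact Sym2.eq_swap
  · exact absurd rfl hne

/-! ### Positions of cells -/

/-- Coordinates and cell indices (column and row) for a family of points in a grid of unit side
length. The only link between the two that is recorded is `compat`. Unlike the half-open cells, it
is invariant under the symmetries of the square. -/
structure Chart (ι : Type*) where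
  x : ι → ℝ
  y : ι → ℝ
  c : ι → ℤ
  d : ι → ℤ
  /-- Coordinate differences and differences of cell indices differ by less than `1`. -/
  compat : ∀ p q, |(x p - x q) - ((c p - c q : ℤ) : ℝ)| < 1 ∧
    |(y p - y q) - ((d p - d q : ℤ) : ℝ)| < 1

namespace Chart

variable {ι : Type*}

/-- The cells of `p` and `q` coincide or are neighbours. -/
def Near (g : Chart ι) (p q : ι) : Prop := |g.c p - g.c q| ≤ 1 ∧ |g.d p - g.d q| ≤ 1

/-- The analogue of `orient 1`. -/
def cross (g : Chart ι) (a b c : ι) : ℝ :=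
  (g.x b - g.x a) * (g.y c - g.y a) - (g.y b - g.y a) * (g.x c - g.x a)

/-- `z` is the combination of `p, q, r` with the given coefficients. -/
def IsComb (g : Chart ι) (α β γ : ℝ) (p q r z : ι) : Prop :=
  g.x z = α * g.x p + β * g.x q + γ * g.x r ∧ g.y z = α * g.y p + β * g.y q + γ * g.y r

/-- `g'` arises from `g` by a symmetry of the grid that multiplies orientations by `ε`. -/
structure IsImage (ε : ℝ) (g g' : Chart ι) : Prop where
  near : ∀ p q, g'.Near p q ↔ g.Near p q
  cross : ∀ a b c, g'.cross a b c = ε * g.cross a b c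
  comb : ∀ α β γ p q r z, g.IsComb α β γ p q r z → g'.IsComb α β γ p q r z

theorem abs_unit_mul {i : ℤ} (hi : i = 1 ∨ i = -1) (a b : ℝ) (m n : ℤ) :
    |((i : ℝ) * a - i * b) - ((i * m - i * n : ℤ) : ℝ)| = |(a - b) - ((m - n : ℤ) : ℝ)| := by
  have : ((i : ℝ) * a - i * b) - ((i * m - i * n : ℤ) : ℝ) =
      (i : ℝ) * ((a - b) - ((m - n : ℤ) : ℝ)) := by push_cast; ring
  rw [this, abs_mul]
  rcases hi with rfl | rfl <;> simp

theorem abs_unit_mul_int {i : ℤ} (hi : i = 1 ∨ i = -1) (m n : ℤ) :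
    |i * m - i * n| = |m - n| := by
  rw [← mul_sub, abs_mul]
  rcases hi with rfl | rfl <;> simp

/-- Reflections in the coordinate axes. -/
def flip (g : Chart ι) {i j : ℤ} (hi : i = 1 ∨ i = -1) (hj : j = 1 ∨ j = -1) : Chart ι where
  x p := i * g.x p
  y p := j * g.y p
  c p := i * g.c p
  d p := j * g.d p
  compat p q := by
    rw [abs_unit_mul hi, abs_unit_mul hj]
    exact g.compat p q

/-- Reflections in the coordinate axes, followed by an exchange of the coordinates. -/
def flipSwap (g : Chart ι) {i j : ℤ} (hi : i = 1 ∨ i = -1) (hj : j = 1 ∨ j = -1) : Chart ι where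
  x p := j * g.y p
  y p := i * g.x p
  c p := j * g.d p
  d p := i * g.c p
  compat p q := by
    rw [abs_unit_mul hi, abs_unit_mul hj]
    exact (g.compat p q).symm

theorem isImage_flip (g : Chart ι) {i j : ℤ} (hi : i = 1 ∨ i = -1) (hj : j = 1 ∨ j = -1) :
    IsImage ((i : ℝ) * j) g (g.flip hi hj) where
  near p q := by simp only [Near, flip, abs_unit_mul_int hi, abs_unit_mul_int hj]
  cross a b c := by simp only [Chart.cross, flip]; ring
  comb α β γ p q r z h := by
    simp only [IsComb, flip] at h ⊢
    rw [h.1, h.2]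
    constructor <;> ring

theorem isImage_flipSwap (g : Chart ι) {i j : ℤ} (hi : i = 1 ∨ i = -1) (hj : j = 1 ∨ j = -1) :
    IsImage (-((i : ℝ) * j)) g (g.flipSwap hi hj) where
  near p q := by simp only [Near, flipSwap, abs_unit_mul_int hi, abs_unit_mul_int hj, and_comm]
  cross a b c := by simp only [Chart.cross, flipSwap]; ring
  comb α β γ p q r z h := by
    simp only [IsComb, flipSwap] at h ⊢
    rw [h.1, h.2]
    constructor <;> ring

/-- Up to symmetry, one of two different neighbouring cells is the right or the upper right
neighbour of the other one, and the orientation can be chosen. -/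
theorem exists_isImage (g : Chart ι) {ε : ℝ} (hε : ε = 1 ∨ ε = -1) {v w : ι} (h : g.Near w v)
    (hne : ¬ (g.c w = g.c v ∧ g.d w = g.d v)) :
    ∃ g', IsImage ε g g' ∧ g'.c w - g'.c v = 1 ∧
      (g'.d w - g'.d v = 0 ∨ g'.d w - g'.d v = 1) := by
  obtain ⟨e, he, rfl⟩ : ∃ e : ℤ, (e = 1 ∨ e = -1) ∧ (e : ℝ) = ε := by
    rcases hε with rfl | rfl
    · exact ⟨1, Or.inl rfl, by simp⟩
    · exact ⟨-1, Or.inr rfl, by simp⟩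
  have hc : g.c w - g.c v = 0 ∨ g.c w - g.c v = 1 ∨ g.c w - g.c v = -1 := by
    have := abs_le.1 h.1; omega
  have hd : g.d w - g.d v = 0 ∨ g.d w - g.d v = 1 ∨ g.d w - g.d v = -1 := by
    have := abs_le.1 h.2; omega
  have unit_mul : ∀ {a b : ℤ}, (a = 1 ∨ a = -1) → (b = 1 ∨ b = -1) → (a * b = 1 ∨ a * b = -1) := by
    rintro a b (rfl | rfl) (rfl | rfl) <;> simp
  have key : ∀ a b : ℤ, g.c w - g.c v = a → g.d w - g.d v = b → (a = 1 ∨ a = -1) →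
      (b = 1 ∨ b = -1) →
      ∃ g', IsImage (e : ℝ) g g' ∧ g'.c w - g'.c v = 1 ∧ g'.d w - g'.d v = 1 := by
    intro a b ha hb ha1 hb1
    by_cases hab : a * b = e
    · refine ⟨g.flip ha1 hb1, ?_, ?_, ?_⟩
      · have := g.isImage_flip ha1 hb1
        rwa [← Int.cast_mul, hab] at this
      · simp only [flip, ← mul_sub, ha]; rcases ha1 with rfl | rfl <;> rfl
      · simp only [flip, ← mul_sub, hb]; rcases hb1 with rfl | rfl <;> rfl
    · refine ⟨g.flipSwap ha1 hb1, ?_, ?_, ?_⟩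
      · have := g.isImage_flipSwap ha1 hb1
        rw [← Int.cast_mul, ← Int.cast_neg] at this
        have h2 : -(a * b) = e := by
          rcases ha1 with rfl | rfl <;> rcases hb1 with rfl | rfl <;> rcases he with rfl | rfl <;>
            simp_all
        rwa [h2] at this
      · simp only [flipSwap, ← mul_sub, hb]; rcases hb1 with rfl | rfl <;> rfl
      · simp only [flipSwap, ← mul_sub, ha]; rcases ha1 with rfl | rfl <;> rfl
  have key1 : ∀ a : ℤ, g.c w - g.c v = a → g.d w - g.d v = 0 → (a = 1 ∨ a = -1) →
      ∃ g', IsImage (e : ℝ) g g' ∧ g'.c w - g'.c v = 1 ∧ g'.d w - g'.d v = 0 := by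
    intro a ha hb ha1
    refine ⟨g.flip ha1 (unit_mul ha1 he), ?_, ?_, ?_⟩
    · have := g.isImage_flip ha1 (unit_mul ha1 he)
      rw [← Int.cast_mul, ← mul_assoc] at this
      have h2 : a * a * e = e := by rcases ha1 with rfl | rfl <;> simp
      rwa [h2] at this
    · simp only [flip, ← mul_sub, ha]; rcases ha1 with rfl | rfl <;> rfl
    · simp only [flip, ← mul_sub, hb]; simp
  have key2 : ∀ b : ℤ, g.c w - g.c v = 0 → g.d w - g.d v = b → (b = 1 ∨ b = -1) →
      ∃ g', IsImage (e : ℝ) g g' ∧ g'.c w - g'.c v = 1 ∧ g'.d w - g'.d v = 0 := by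
    intro b ha hb hb1
    have hbe : -(b * e) = 1 ∨ -(b * e) = -1 := by
      rcases unit_mul hb1 he with h | h <;> simp [h]
    refine ⟨g.flipSwap hbe hb1, ?_, ?_, ?_⟩
    · have := g.isImage_flipSwap hbe hb1
      rw [← Int.cast_mul, ← Int.cast_neg] at this
      have h2 : -(-(b * e) * b) = e := by rcases hb1 with rfl | rfl <;> simp
      rwa [h2] at this
    · simp only [flipSwap, ← mul_sub, hb]; rcases hb1 with rfl | rfl <;> rfl
    · simp only [flipSwap, ← mul_sub, ha]; simp
  rcases hc with hc | hc <;> rcases hd with hd | hd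
  · exact absurd ⟨by omega, by omega⟩ hne
  · obtain ⟨T, h1, h2, h3⟩ := key2 (g.d w - g.d v) hc rfl hd
    exact ⟨T, h1, h2, Or.inl h3⟩
  · obtain ⟨T, h1, h2, h3⟩ := key1 (g.c w - g.c v) rfl hd hc
    exact ⟨T, h1, h2, Or.inl h3⟩
  · obtain ⟨T, h1, h2, h3⟩ := key (g.c w - g.c v) (g.d w - g.d v) rfl rfl hc hd
    exact ⟨T, h1, h2, Or.inr h3⟩

theorem x_lt (g : Chart ι) {p q : ι} (hc : g.c p < g.c q) : g.x p < g.x q := by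
  have := (abs_lt.1 (g.compat p q).1).2
  have h2 : ((g.c p - g.c q : ℤ) : ℝ) ≤ -1 := by exact_mod_cast (by omega : g.c p - g.c q ≤ -1)
  linarith

theorem y_lt (g : Chart ι) {p q : ι} (hc : g.d p < g.d q) : g.y p < g.y q := by
  have := (abs_lt.1 (g.compat p q).2).2
  have h2 : ((g.d p - g.d q : ℤ) : ℝ) ≤ -1 := by exact_mod_cast (by omega : g.d p - g.d q ≤ -1)
  linarith

theorem x_lt_one (g : Chart ι) {p q : ι} (hc : g.c p ≤ g.c q) : g.x p < g.x q + 1 := by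
  have := (abs_lt.1 (g.compat p q).1).2
  have h2 : ((g.c p - g.c q : ℤ) : ℝ) ≤ 0 := by exact_mod_cast (by omega : g.c p - g.c q ≤ 0)
  linarith

theorem y_lt_one (g : Chart ι) {p q : ι} (hc : g.d p ≤ g.d q) : g.y p < g.y q + 1 := by
  have := (abs_lt.1 (g.compat p q).2).2
  have h2 : ((g.d p - g.d q : ℤ) : ℝ) ≤ 0 := by exact_mod_cast (by omega : g.d p - g.d q ≤ 0)
  linarith

theorem x_add_one_lt (g : Chart ι) {p q : ι} (hc : g.c p + 2 ≤ g.c q) :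
    g.x p + 1 < g.x q := by
  have := (abs_lt.1 (g.compat p q).1).2
  have h2 : ((g.c p - g.c q : ℤ) : ℝ) ≤ -2 := by exact_mod_cast (by omega : g.c p - g.c q ≤ -2)
  linarith

theorem y_add_one_lt (g : Chart ι) {p q : ι} (hc : g.d p + 2 ≤ g.d q) :
    g.y p + 1 < g.y q := by
  have := (abs_lt.1 (g.compat p q).2).2
  have h2 : ((g.d p - g.d q : ℤ) : ℝ) ≤ -2 := by exact_mod_cast (by omega : g.d p - g.d q ≤ -2)
  linarith

theorem near_iff (g : Chart ι) {p q : ι} : g.Near p q ↔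
    -1 ≤ g.c p - g.c q ∧ g.c p - g.c q ≤ 1 ∧ -1 ≤ g.d p - g.d q ∧ g.d p - g.d q ≤ 1 := by
  simp only [Near, abs_le]; tauto

/-- In the diagonal position, the points of `N(v)` outside `N(w)` on the right of `v w` lie below
`v`. -/
theorem below_of_diagonal (g : Chart ι) {v w a : ι} (h1 : g.c w - g.c v = 1)
    (h2 : g.d w - g.d v = 1) (ha : g.Near a v) (ha' : ¬ g.Near a w) (hD : 0 < g.cross v a w) :
    g.y a < g.y v ∧ g.d a ≤ g.d v ∧ (g.c a - g.c v = -1 ∨ g.d a - g.d v = -1) := by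
  rw [near_iff] at ha ha'
  have hp := g.x_lt (p := v) (q := w) (by omega)
  have hq := g.y_lt (p := v) (q := w) (by omega)
  have h3 : g.c a - g.c v = -1 ∨ g.d a - g.d v = -1 := by omega
  have h4 : g.y a < g.y v := by
    rcases h3 with h3 | h3
    · have hx := g.x_lt (p := a) (q := v) (by omega)
      unfold cross at hD
      by_contra hcon
      push Not at hcon
      nlinarith [mul_nonneg (sub_nonneg.2 hcon) (sub_pos.2 hp).le,
        mul_pos (sub_pos.2 hx) (sub_pos.2 hq)]
    · exact g.y_lt (p := a) (q := v) (by omega)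
  refine ⟨h4, ?_, h3⟩
  by_contra hcon
  exact absurd (g.y_lt (p := v) (q := a) (by omega)) (by linarith)

/-- If `a` and `b` were not in neighbouring cells, they would be at opposite ends of the part of
`N(v)` outside `N(w)`; then `v, a, b` turns towards `w`, or `w` is on the wrong side of `a b`. -/
theorem near_of_convex_aux (g : Chart ι) {v w a b : ι} (h1 : g.c w - g.c v = 1)
    (h2 : g.d w - g.d v = 0 ∨ g.d w - g.d v = 1) (ha : g.Near a v) (hb : g.Near b v)
    (ha' : ¬ g.Near a w) (hb' : ¬ g.Near b w) (hDa : 0 < g.cross v a w) (hDb : 0 < g.cross v b w)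
    (hvab : g.cross v a b < 0) (habw : 0 < g.cross a b w) : g.Near b a := by
  by_contra hn
  rcases h2 with h2 | h2
  · rw [near_iff] at ha hb ha' hb' hn
    have ac : g.c a - g.c v = -1 := by omega
    have bc : g.c b - g.c v = -1 := by omega
    have hax := g.x_lt (p := a) (q := v) (by omega)
    have hbx := g.x_lt (p := b) (q := v) (by omega)
    have hcase : (g.d a - g.d v = 1 ∧ g.d b - g.d v = -1) ∨
        (g.d a - g.d v = -1 ∧ g.d b - g.d v = 1) := by omega
    unfold cross at hvab habw
    rcases hcase with ⟨ad, bd⟩ | ⟨ad, bd⟩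
    · have hay := g.y_lt (p := v) (q := a) (by omega)
      have hby := g.y_lt (p := b) (q := v) (by omega)
      nlinarith [mul_pos (sub_pos.2 hax) (sub_pos.2 hby), mul_pos (sub_pos.2 hay) (sub_pos.2 hbx)]
    · have e1 := g.x_lt_one (p := b) (q := a) (by omega)
      have e2 := g.x_add_one_lt (p := a) (q := w) (by omega)
      have e3 := g.y_lt (p := w) (q := b) (by omega)
      have e4 := g.y_lt (p := a) (q := w) (by omega)
      nlinarith [mul_pos (sub_pos.2 e1) (sub_pos.2 e4), mul_pos (sub_pos.2 e3) (sub_pos.2 e2),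
        mul_pos (sub_pos.2 e4) (sub_pos.2 e2)]
  · obtain ⟨hay, had, hac⟩ := g.below_of_diagonal h1 h2 ha ha' hDa
    obtain ⟨hby, hbd, hbc⟩ := g.below_of_diagonal h1 h2 hb hb' hDb
    rw [near_iff] at ha hb hn
    have hcase : (g.c a - g.c v = 1 ∧ g.c b - g.c v = -1) ∨
        (g.c a - g.c v = -1 ∧ g.c b - g.c v = 1) := by omega
    unfold cross at hvab habw
    rcases hcase with ⟨ac, bc⟩ | ⟨ac, bc⟩
    · have e1 := g.x_add_one_lt (p := b) (q := a) (by omega)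
      have e2 := g.y_add_one_lt (p := a) (q := w) (by omega)
      have e3 := g.x_lt_one (p := w) (q := a) (by omega)
      have e4 := g.x_lt_one (p := a) (q := w) (by omega)
      have e5 := g.y_lt (p := b) (q := w) (by omega)
      have e6 := g.y_lt_one (p := a) (q := b) (by omega)
      by_cases hs : g.x a ≤ g.x w
      · nlinarith [mul_pos (sub_pos.2 e1) (show 0 < g.y w - g.y a by linarith),
          mul_nonneg (sub_nonneg.2 hs) (show 0 ≤ g.y b - g.y a + 1 by linarith),
          mul_pos (sub_pos.2 e2) (show 0 < g.y w - g.y a by linarith)]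
      · push Not at hs
        nlinarith [mul_pos (sub_pos.2 e1) (show 0 < g.y w - g.y a by linarith),
          mul_pos (sub_pos.2 hs) (sub_pos.2 e5),
          mul_pos (show 0 < g.x w + 1 - g.x a by linarith) (show 0 < g.y w - g.y a by linarith)]
    · have e1 := g.x_lt (p := a) (q := v) (by omega)
      have e2 := g.x_lt (p := v) (q := b) (by omega)
      nlinarith [mul_pos (sub_pos.2 e1) (sub_pos.2 hby), mul_pos (sub_pos.2 e2) (sub_pos.2 hay)]

/-- Two vectors to the right of the direction `(p, q)`, `0 < p`, the first pointing to the left and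
the second to the right, are positively oriented. -/
theorem cross_pos_of_below {p q ux uy yx yy : ℝ} (hp : 0 < p) (hu : ux < 0) (hy : 0 < yx)
    (h1 : 0 < ux * q - uy * p) (h2 : 0 < yx * q - yy * p) : 0 < ux * yy - uy * yx := by
  have : 0 < p * (ux * yy - uy * yx) := by
    nlinarith [mul_pos h1 hy, mul_pos h2 (neg_pos.2 hu)]
  exact (mul_pos_iff_of_pos_left hp).1 this

theorem cross_pos_aux (g : Chart ι) {v w u y : ι} (h1 : g.c w - g.c v = 1)
    (h2 : g.d w - g.d v = 0 ∨ g.d w - g.d v = 1) (hu : g.Near u v) (hu' : ¬ g.Near u w)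
    (hy : g.Near y w) (hy' : ¬ g.Near y v) (hDu : 0 < g.cross v u w) (hDy : 0 < g.cross v y w) :
    0 < g.cross v u y ∧ 0 < g.cross w u y := by
  have hp := g.x_lt (p := v) (q := w) (by omega)
  have hDu' : 0 < (g.x u - g.x w) * (g.y w - g.y v) - (g.y u - g.y w) * (g.x w - g.x v) := by
    unfold cross at hDu; linarith
  have hDy' : 0 < (g.x y - g.x w) * (g.y w - g.y v) - (g.y y - g.y w) * (g.x w - g.x v) := by
    unfold cross at hDy; linarith
  rcases h2 with h2 | h2
  · rw [near_iff] at hu hu' hy hy'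
    have uc : g.c u - g.c v = -1 := by omega
    have yc : g.c y - g.c v = 2 := by omega
    have e1 := g.x_lt (p := u) (q := v) (by omega)
    have e2 := g.x_lt (p := w) (q := y) (by omega)
    exact ⟨cross_pos_of_below (sub_pos.2 hp) (by linarith) (by linarith) hDu hDy,
      cross_pos_of_below (sub_pos.2 hp) (by linarith) (by linarith) hDu' hDy'⟩
  · obtain ⟨huy, hud, huc⟩ := g.below_of_diagonal h1 h2 hu hu' hDu
    have hq := g.y_lt (p := v) (q := w) (by omega)
    rw [near_iff] at hu hu' hy hy'
    have yx : g.x w < g.x y := by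
      by_cases yc : g.c y - g.c v = 2
      · exact g.x_lt (p := w) (q := y) (by omega)
      · have := g.y_lt (p := w) (q := y) (by omega)
        by_contra hcon
        push Not at hcon
        nlinarith [mul_pos (sub_pos.2 this) (sub_pos.2 hp),
          mul_nonneg (sub_nonneg.2 hcon) (sub_pos.2 hq).le]
    constructor
    · by_cases ux : g.x u < g.x v
      · exact cross_pos_of_below (sub_pos.2 hp) (by linarith) (by linarith) hDu hDy
      · push Not at ux
        unfold cross
        by_cases hyy : g.y v ≤ g.y y
        · nlinarith [mul_nonneg (sub_nonneg.2 ux) (sub_nonneg.2 hyy),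
            mul_pos (sub_pos.2 huy) (show 0 < g.x y - g.x v by linarith)]
        · push Not at hyy
          have yd : g.d y ≤ g.d v := by
            by_contra hcon
            exact absurd (g.y_lt (p := v) (q := y) (by omega)) (by linarith)
          have uc : g.c v ≤ g.c u := by
            by_contra hcon
            exact absurd (g.x_lt (p := u) (q := v) (by omega)) (by linarith)
          have e1 := g.y_lt (p := u) (q := y) (by omega)
          have e2 := g.x_lt (p := u) (q := y) (by omega)
          nlinarith [mul_pos (sub_pos.2 e1) (show 0 < g.x y - g.x v by linarith),
            mul_pos (sub_pos.2 hyy) (sub_pos.2 e2)]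
    · by_cases ux : g.x u < g.x w
      · exact cross_pos_of_below (sub_pos.2 hp) (by linarith) (by linarith) hDu' hDy'
      · push Not at ux
        unfold cross
        by_cases hyy : g.y w ≤ g.y y
        · nlinarith [mul_nonneg (sub_nonneg.2 ux) (sub_nonneg.2 hyy),
            mul_pos (show 0 < g.y w - g.y u by linarith) (show 0 < g.x y - g.x w by linarith)]
        · push Not at hyy
          have yd : g.d y ≤ g.d w := by
            by_contra hcon
            exact absurd (g.y_lt (p := w) (q := y) (by omega)) (by linarith)
          have uc : g.c w ≤ g.c u := by
            by_contra hcon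
            exact absurd (g.x_lt (p := u) (q := w) (by omega)) (by linarith)
          have e1 := g.y_lt (p := u) (q := y) (by omega)
          have e2 := g.x_lt (p := u) (q := y) (by omega)
          nlinarith [mul_pos (sub_pos.2 e1) (show 0 < g.x y - g.x w by linarith),
            mul_pos (sub_pos.2 hyy) (sub_pos.2 e2)]

/-- If `u` and `t` are both to one side of `v`, horizontally or vertically, then the cell of `h` is
not on the other side, as `h` is in the cone at `v` between them. -/
theorem near_of_hidden_aux (g : Chart ι) {v w u t h : ι}
    (h1 : g.c w - g.c v = 1) (h2 : g.d w - g.d v = 0 ∨ g.d w - g.d v = 1) (hu : g.Near u v)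
    (hu' : ¬ g.Near u w) (ht : g.Near t v) (ht' : ¬ g.Near t w) (hDu : 0 < g.cross v u w)
    (hDt : 0 < g.cross v t w) (hh : g.Near h v) (huh : 0 < g.cross v u h) (hht : 0 ≤ g.cross v h t)
    (hut : 0 < g.cross v u t) : g.Near u h ∨ g.Near t h := by
  have ex : g.cross v u t * (g.x h - g.x v) =
      g.cross v h t * (g.x u - g.x v) + g.cross v u h * (g.x t - g.x v) := by unfold cross; ring
  have ey : g.cross v u t * (g.y h - g.y v) =
      g.cross v h t * (g.y u - g.y v) + g.cross v u h * (g.y t - g.y v) := by unfold cross; ring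
  have xneg : g.c u < g.c v → g.c t < g.c v → g.c h ≤ g.c v := by
    intro hu1 ht1
    by_contra hcon
    have e1 := g.x_lt (p := u) (q := v) hu1
    have e2 := g.x_lt (p := t) (q := v) ht1
    have e3 := g.x_lt (p := v) (q := h) (by omega)
    nlinarith [mul_pos hut (sub_pos.2 e3), mul_nonneg hht (sub_pos.2 e1).le,
      mul_pos huh (sub_pos.2 e2)]
  have xpos : g.c v < g.c u → g.c v < g.c t → g.c v ≤ g.c h := by
    intro hu1 ht1
    by_contra hcon
    have e1 := g.x_lt (p := v) (q := u) hu1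
    have e2 := g.x_lt (p := v) (q := t) ht1
    have e3 := g.x_lt (p := h) (q := v) (by omega)
    nlinarith [mul_pos hut (sub_pos.2 e3), mul_nonneg hht (sub_pos.2 e1).le,
      mul_pos huh (sub_pos.2 e2)]
  have yneg : g.y u < g.y v → g.y t < g.y v → g.d h ≤ g.d v := by
    intro e1 e2
    by_contra hcon
    have e3 := g.y_lt (p := v) (q := h) (by omega)
    nlinarith [mul_pos hut (sub_pos.2 e3), mul_nonneg hht (sub_pos.2 e1).le,
      mul_pos huh (sub_pos.2 e2)]
  have ypos : g.d v < g.d u → g.d v < g.d t → g.d v ≤ g.d h := by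
    intro hu1 ht1
    by_contra hcon
    have e1 := g.y_lt (p := v) (q := u) hu1
    have e2 := g.y_lt (p := v) (q := t) ht1
    have e3 := g.y_lt (p := h) (q := v) (by omega)
    nlinarith [mul_pos hut (sub_pos.2 e3), mul_nonneg hht (sub_pos.2 e1).le,
      mul_pos huh (sub_pos.2 e2)]
  rcases h2 with h2 | h2
  · have yneg' : g.d u < g.d v → g.d t < g.d v → g.d h ≤ g.d v := fun a b =>
      yneg (g.y_lt (p := u) (q := v) a) (g.y_lt (p := t) (q := v) b)
    rw [near_iff] at hu hu' ht ht' hh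
    rw [near_iff, near_iff]
    omega
  · obtain ⟨huy, hud, huc⟩ := g.below_of_diagonal h1 h2 hu hu' hDu
    obtain ⟨hty, htd, htc⟩ := g.below_of_diagonal h1 h2 ht ht' hDt
    have := yneg huy hty
    rw [near_iff] at hu hu' ht ht' hh
    rw [near_iff, near_iff]
    omega

/-- A point of a triangle is in a row and in a column between those of the corners. -/
theorem cell_bounds (g : Chart ι) {u X y z : ι} {α β γ : ℝ}
    (h : g.IsComb α β γ u X y z) (hα : 0 ≤ α) (hβ : 0 ≤ β) (hγ : 0 ≤ γ) (hs : α + β + γ = 1) :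
    (g.c z ≤ g.c u ∨ g.c z ≤ g.c X ∨ g.c z ≤ g.c y) ∧
    (g.c u ≤ g.c z ∨ g.c X ≤ g.c z ∨ g.c y ≤ g.c z) ∧
    (g.d z ≤ g.d u ∨ g.d z ≤ g.d X ∨ g.d z ≤ g.d y) ∧
    (g.d u ≤ g.d z ∨ g.d X ≤ g.d z ∨ g.d y ≤ g.d z) := by
  obtain ⟨hx, hy⟩ := h
  have aux : ∀ a b c e : ℝ, e = α * a + β * b + γ * c → a < e → b < e → c < e → False := by
    intro a b c e he ha hb hc
    have h1 := mul_le_mul_of_nonneg_left ha.le hα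
    have h2 := mul_le_mul_of_nonneg_left hb.le hβ
    have h3 := mul_le_mul_of_nonneg_left hc.le hγ
    obtain rfl : α = 1 - β - γ := by linarith
    rcases hβ.lt_or_eq with h | h
    · have := mul_lt_mul_of_pos_left hb h; linarith
    rcases hγ.lt_or_eq with h' | h'
    · have := mul_lt_mul_of_pos_left hc h'; linarith
    subst h; subst h'; linarith
  refine ⟨?_, ?_, ?_, ?_⟩ <;> by_contra! hcon
  · exact aux _ _ _ _ hx (g.x_lt (p := u) (q := z) hcon.1) (g.x_lt (p := X) (q := z) hcon.2.1)
      (g.x_lt (p := y) (q := z) hcon.2.2)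
  · exact aux (-g.x u) (-g.x X) (-g.x y) (-g.x z) (by linarith)
      (neg_lt_neg (g.x_lt (p := z) (q := u) hcon.1))
      (neg_lt_neg (g.x_lt (p := z) (q := X) hcon.2.1))
      (neg_lt_neg (g.x_lt (p := z) (q := y) hcon.2.2))
  · exact aux _ _ _ _ hy (g.y_lt (p := u) (q := z) hcon.1) (g.y_lt (p := X) (q := z) hcon.2.1)
      (g.y_lt (p := y) (q := z) hcon.2.2)
  · exact aux (-g.y u) (-g.y X) (-g.y y) (-g.y z) (by linarith)
      (neg_lt_neg (g.y_lt (p := z) (q := u) hcon.1))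
      (neg_lt_neg (g.y_lt (p := z) (q := X) hcon.2.1))
      (neg_lt_neg (g.y_lt (p := z) (q := y) hcon.2.2))

/-- A point of the triangle outside `N(v) ∪ N(w)` and to the right of `v w` is in the lower right
corner cell of the bounding box of `N(v) ∪ N(w)`, so this is the cell of `h` and of `k`. If it is
next to neither `u` nor `y`, the corners of the triangle are all on one side of the diagonal
through `h`. -/
theorem false_of_corner_aux (g : Chart ι) {v w u y X h k : ι}
    (h1 : g.c w - g.c v = 1) (h2 : g.d w - g.d v = 0 ∨ g.d w - g.d v = 1) (hu : g.Near u v)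
    (hy : g.Near y w) (hX : g.Near X v) (hX' : g.Near X w)
    {α β γ α' β' γ' : ℝ} (hh : g.IsComb α β γ u X y h) (hα : 0 ≤ α) (hβ : 0 ≤ β) (hγ : 0 ≤ γ)
    (hs : α + β + γ = 1) (hk : g.IsComb α' β' γ' u X y k) (hα' : 0 ≤ α') (hβ' : 0 ≤ β')
    (hγ' : 0 ≤ γ') (hs' : α' + β' + γ' = 1) (hhv : ¬ g.Near h v) (hhw : ¬ g.Near h w)
    (hkv : ¬ g.Near k v) (hkw : ¬ g.Near k w) (hDh : 0 < g.cross v h w) (hDk : 0 < g.cross v k w)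
    (huh : ¬ g.Near u h) (hyk : ¬ g.Near y k) : False := by
  obtain ⟨a1, a2, a3, a4⟩ := g.cell_bounds hh hα hβ hγ hs
  obtain ⟨b1, b2, b3, b4⟩ := g.cell_bounds hk hα' hβ' hγ' hs'
  have corner : ∀ z : ι, ¬ g.Near z v → ¬ g.Near z w → 0 < g.cross v z w →
      (g.c z ≤ g.c u ∨ g.c z ≤ g.c X ∨ g.c z ≤ g.c y) →
      (g.c u ≤ g.c z ∨ g.c X ≤ g.c z ∨ g.c y ≤ g.c z) →
      (g.d z ≤ g.d u ∨ g.d z ≤ g.d X ∨ g.d z ≤ g.d y) →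
      (g.d u ≤ g.d z ∨ g.d X ≤ g.d z ∨ g.d y ≤ g.d z) →
      g.d w - g.d v = 1 ∧ g.c z - g.c v = 2 ∧ g.d z - g.d v = -1 := by
    intro z hzv hzw hD c1 c2 c3 c4
    rw [near_iff] at hu hy hX hX' hzv hzw
    have e1 : g.c z - g.c v ≤ 2 := by
      clear hzv hzw c2 c3 c4 a1 a2 a3 a4 b1 b2 b3 b4 huh hyk
      rcases c1 with h | h | h <;> omega
    have e2 : -1 ≤ g.c z - g.c v := by
      clear hzv hzw c1 c3 c4 a1 a2 a3 a4 b1 b2 b3 b4 huh hyk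
      rcases c2 with h | h | h <;> omega
    have e3 : g.d z - g.d v ≤ 2 := by
      clear hzv hzw c1 c2 c4 a1 a2 a3 a4 b1 b2 b3 b4 huh hyk
      rcases h2 with h2 | h2 <;> rcases c3 with h | h | h <;> omega
    have e4 : -1 ≤ g.d z - g.d w + (g.d w - g.d v) := by
      clear hzv hzw c1 c2 c3 a1 a2 a3 a4 b1 b2 b3 b4 huh hyk
      rcases h2 with h2 | h2 <;> rcases c4 with h | h | h <;> omega
    have e5 : g.d w - g.d v = 0 → g.d z - g.d v ≤ 1 := by
      clear hzv hzw c1 c2 c4 a1 a2 a3 a4 b1 b2 b3 b4 huh hyk h2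
      intro h2
      rcases c3 with h | h | h <;> omega
    have hcase : g.d w - g.d v = 1 ∧
        ((g.c z - g.c v = 2 ∧ g.d z - g.d v = -1) ∨ (g.c z - g.c v = -1 ∧ g.d z - g.d v = 2)) := by
      clear hu hy hX hX' c1 c2 c3 c4 a1 a2 a3 a4 b1 b2 b3 b4 huh hyk
      rcases h2 with h2 | h2 <;> omega
    refine ⟨hcase.1, ?_⟩
    rcases hcase.2 with h | h
    · exact h
    · exfalso
      have e1 := g.x_lt (p := z) (q := v) (by omega)
      have e2 := g.y_lt (p := v) (q := z) (by omega)
      have e3 := g.x_lt (p := v) (q := w) (by omega)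
      have e4 := g.y_lt (p := v) (q := w) (by omega)
      unfold cross at hD
      nlinarith [mul_pos (sub_pos.2 e1) (sub_pos.2 e4), mul_pos (sub_pos.2 e2) (sub_pos.2 e3)]
  obtain ⟨h3, hc, hd⟩ := corner h hhv hhw hDh a1 a2 a3 a4
  obtain ⟨-, kc, kd⟩ := corner k hkv hkw hDk b1 b2 b3 b4
  rw [near_iff] at hu hy hX hX' huh hyk
  obtain ⟨hx, hy1⟩ := hh
  have u1 := g.x_add_one_lt (p := u) (q := h) (by omega)
  have u2 := g.y_lt_one (p := h) (q := u) (by omega)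
  have X1 := g.x_lt (p := X) (q := h) (by omega)
  have X2 := g.y_lt (p := h) (q := X) (by omega)
  have y1 := g.x_lt_one (p := y) (q := h) (by omega)
  have y2 := g.y_add_one_lt (p := h) (q := y) (by omega)
  obtain rfl : α = 1 - β - γ := by linarith
  -- `h` would be strictly the largest in the direction `(1, -1)`
  have m1 : g.x u - g.y u < g.x h - g.y h := by linarith
  have m2 : g.x X - g.y X < g.x h - g.y h := by linarith
  have m3 : g.x y - g.y y < g.x h - g.y h := by linarith
  have n1 := mul_le_mul_of_nonneg_left m1.le hα
  have n2 := mul_le_mul_of_nonneg_left m2.le hβ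
  have n3 := mul_le_mul_of_nonneg_left m3.le hγ
  rcases hβ.lt_or_eq with h | h
  · have := mul_lt_mul_of_pos_left m2 h; linarith
  rcases hγ.lt_or_eq with h' | h'
  · have := mul_lt_mul_of_pos_left m3 h'; linarith
  subst h; subst h'; linarith

end Chart

/-- The chart given by the grid, with the side length of the cells as the unit. -/
noncomputable def gridChart (o : ℂ) (ℓ : ℝ) : Chart ℂ where
  x z := (z.re - o.re) / ℓ
  y z := (z.im - o.im) / ℓ
  c z := (cell o ℓ z).1
  d z := (cell o ℓ z).2
  compat p q := by
    simp only [cell]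
    push_cast
    rw [abs_lt, abs_lt]
    refine ⟨⟨?_, ?_⟩, ?_, ?_⟩
    · linarith [Int.floor_le ((p.re - o.re) / ℓ), Int.lt_floor_add_one ((q.re - o.re) / ℓ)]
    · linarith [Int.floor_le ((q.re - o.re) / ℓ), Int.lt_floor_add_one ((p.re - o.re) / ℓ)]
    · linarith [Int.floor_le ((p.im - o.im) / ℓ), Int.lt_floor_add_one ((q.im - o.im) / ℓ)]
    · linarith [Int.floor_le ((q.im - o.im) / ℓ), Int.lt_floor_add_one ((p.im - o.im) / ℓ)]

theorem gridChart_near {o : ℂ} {ℓ : ℝ} {p q : ℂ} : (gridChart o ℓ).Near p q ↔ p ∈ nbhd o ℓ q :=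
  Iff.rfl

theorem gridChart_cross (o : ℂ) {ℓ : ℝ} (hℓ : 0 < ℓ) (ε : ℝ) (a b c : ℂ) :
    ε * (gridChart o ℓ).cross a b c = orient ε a b c / ℓ ^ 2 := by
  simp only [Chart.cross, gridChart, orient]
  field_simp
  ring

theorem gridChart_comb (o : ℂ) {ℓ : ℝ} (hℓ : 0 < ℓ) {α β γ : ℝ} (hs : α + β + γ = 1)
    {p q r z : ℂ} (h : α • p + β • q + γ • r = z) : (gridChart o ℓ).IsComb α β γ p q r z := by
  subst h
  obtain rfl : α = 1 - β - γ := by linarith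
  simp only [Chart.IsComb, gridChart, Complex.add_re, Complex.add_im, Complex.real_smul,
    Complex.mul_re, Complex.mul_im, Complex.ofReal_re, Complex.ofReal_im]
  constructor
  · field_simp; ring
  · field_simp; ring

/-- The symmetries of the grid reduce statements about `v`, `w` in different neighbouring cells to
two relative positions. -/
theorem exists_chart {o : ℂ} {ℓ : ℝ} (hℓ : 0 < ℓ) {ε : ℝ} (hε : ε = 1 ∨ ε = -1) {v w u : ℂ}
    (hw : w ∈ nbhd o ℓ v) (hu : u ∈ nbhd o ℓ v) (hu' : u ∉ nbhd o ℓ w) :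
    ∃ g : Chart ℂ, g.c w - g.c v = 1 ∧ (g.d w - g.d v = 0 ∨ g.d w - g.d v = 1) ∧
      (∀ p q, g.Near p q ↔ p ∈ nbhd o ℓ q) ∧
      (∀ a b c, g.cross a b c = orient ε a b c / ℓ ^ 2) ∧
      (∀ α β γ : ℝ, ∀ p q r z : ℂ, α + β + γ = 1 → α • p + β • q + γ • r = z →
        g.IsComb α β γ p q r z) := by
  have hne : ¬ ((gridChart o ℓ).c w = (gridChart o ℓ).c v ∧
      (gridChart o ℓ).d w = (gridChart o ℓ).d v) := by
    rintro ⟨h1, h2⟩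
    apply hu'
    rw [← gridChart_near, Chart.Near, h1, h2]
    exact hu
  obtain ⟨g, hg, h1, h2⟩ := (gridChart o ℓ).exists_isImage hε (v := v) (w := w) hw hne
  exact ⟨g, h1, h2, fun p q => hg.near p q, fun a b c => by rw [hg.cross, gridChart_cross o hℓ],
    fun α β γ p q r z hs h => hg.comb _ _ _ _ _ _ _ (gridChart_comb o hℓ hs h)⟩

section Cells

variable {o : ℂ} {ℓ : ℝ} {ε : ℝ} {v w : ℂ}

/-- If `v, a, b` turns away from `w`, then consecutive points `a, b` of a chain in `N(v)` outside
`N(w)` lie in neighbouring cells. -/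
theorem mem_nbhd_of_convex (hℓ : 0 < ℓ) (hε : ε = 1 ∨ ε = -1) (hw : w ∈ nbhd o ℓ v) {a b : ℂ}
    (ha : a ∈ nbhd o ℓ v) (hb : b ∈ nbhd o ℓ v) (ha' : a ∉ nbhd o ℓ w) (hb' : b ∉ nbhd o ℓ w)
    (hDa : 0 < orient ε w v a) (hDb : 0 < orient ε w v b) (hvab : orient ε v a b < 0)
    (habw : 0 < orient ε a b w) : b ∈ nbhd o ℓ a := by
  obtain ⟨g, h1, h2, hn, hc, -⟩ := exists_chart hℓ hε hw ha ha'
  have hl : 0 < ℓ ^ 2 := by positivity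
  rw [← hn]
  refine g.near_of_convex_aux h1 h2 ((hn _ _).2 ha) ((hn _ _).2 hb) (mt (hn _ _).1 ha')
    (mt (hn _ _).1 hb') ?_ ?_ ?_ ?_
  · rw [hc, ← orient_rot]; exact div_pos hDa hl
  · rw [hc, ← orient_rot]; exact div_pos hDb hl
  · rw [hc]; exact div_neg_of_neg_of_pos hvab hl
  · rw [hc]; exact div_pos habw hl

/-- The segments `u w` and `v y` cross. -/
theorem orient_pos_of_cells (hℓ : 0 < ℓ) (hε : ε = 1 ∨ ε = -1) (hw : w ∈ nbhd o ℓ v) {u y : ℂ}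
    (hu : u ∈ nbhd o ℓ v) (hu' : u ∉ nbhd o ℓ w) (hy : y ∈ nbhd o ℓ w) (hy' : y ∉ nbhd o ℓ v)
    (hDu : 0 < orient ε w v u) (hDy : 0 < orient ε w v y) :
    0 < orient ε v u y ∧ 0 < orient ε w u y := by
  obtain ⟨g, h1, h2, hn, hc, -⟩ := exists_chart hℓ hε hw hu hu'
  have hl : 0 < ℓ ^ 2 := by positivity
  have := g.cross_pos_aux h1 h2 ((hn _ _).2 hu) (mt (hn _ _).1 hu') ((hn _ _).2 hy)
    (mt (hn _ _).1 hy') (by rw [hc, ← orient_rot]; exact div_pos hDu hl)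
    (by rw [hc, ← orient_rot]; exact div_pos hDy hl)
  simpa only [hc, div_pos_iff_of_pos_right hl] using this

/-- A point `h` of `N(v)` in the angle at `v` between two points `u`, `t` of `N(v)` outside `N(w)`
lies in `N(u)` or in `N(t)`. -/
theorem mem_nbhd_of_hidden (hℓ : 0 < ℓ) (hε : ε = 1 ∨ ε = -1) (hw : w ∈ nbhd o ℓ v) {u t h : ℂ}
    (hu : u ∈ nbhd o ℓ v) (hu' : u ∉ nbhd o ℓ w) (ht : t ∈ nbhd o ℓ v) (ht' : t ∉ nbhd o ℓ w)
    (hDu : 0 < orient ε w v u) (hDt : 0 < orient ε w v t) (hh : h ∈ nbhd o ℓ v)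
    (huh : 0 < orient ε v u h) (hht : 0 ≤ orient ε v h t) (hut : 0 < orient ε v u t) :
    u ∈ nbhd o ℓ h ∨ t ∈ nbhd o ℓ h := by
  obtain ⟨g, h1, h2, hn, hc, -⟩ := exists_chart hℓ hε hw hu hu'
  have hl : 0 < ℓ ^ 2 := by positivity
  rw [← hn, ← hn]
  refine g.near_of_hidden_aux h1 h2 ((hn _ _).2 hu) (mt (hn _ _).1 hu') ((hn _ _).2 ht)
    (mt (hn _ _).1 ht') ?_ ?_ ((hn _ _).2 hh) ?_ ?_ ?_
  · rw [hc, ← orient_rot]; exact div_pos hDu hl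
  · rw [hc, ← orient_rot]; exact div_pos hDt hl
  · rw [hc]; exact div_pos huh hl
  · rw [hc]; exact div_nonneg hht hl.le
  · rw [hc]; exact div_pos hut hl

/-- Two points `h`, `k` of the triangle `u, X, y` outside `N(v) ∪ N(w)` lie in one and the same
cell, a corner of the bounding box of `N(v) ∪ N(w)`, which is a neighbour of the cell of `u` or of
the cell of `y`. -/
theorem false_of_corner (hℓ : 0 < ℓ) (hε : ε = 1 ∨ ε = -1) (hw : w ∈ nbhd o ℓ v) {u y X h k : ℂ}
    (hu : u ∈ nbhd o ℓ v) (hu' : u ∉ nbhd o ℓ w) (hy : y ∈ nbhd o ℓ w)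
    (hX : X ∈ nbhd o ℓ v) (hX' : X ∈ nbhd o ℓ w)
    (hh : h ∈ convexHull ℝ {u, X, y}) (hk : k ∈ convexHull ℝ {u, X, y})
    (hhv : h ∉ nbhd o ℓ v) (hhw : h ∉ nbhd o ℓ w) (hkv : k ∉ nbhd o ℓ v) (hkw : k ∉ nbhd o ℓ w)
    (hDh : 0 < orient ε w v h) (hDk : 0 < orient ε w v k)
    (huh : u ∉ nbhd o ℓ h) (hyk : y ∉ nbhd o ℓ k) : False := by
  obtain ⟨g, h1, h2, hn, hc, hcomb⟩ := exists_chart hℓ hε hw hu hu'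
  have hl : 0 < ℓ ^ 2 := by positivity
  simp only [convexHull_insert (Set.insert_nonempty _ _), convexHull_pair,
    mem_convexJoin, Set.mem_singleton_iff, exists_eq_left] at hh hk
  have comb : ∀ z : ℂ, (∃ b ∈ segment ℝ X y, z ∈ segment ℝ u b) → ∃ α β γ : ℝ, 0 ≤ α ∧ 0 ≤ β ∧
      0 ≤ γ ∧ α + β + γ = 1 ∧ α • u + β • X + γ • y = z := by
    rintro z ⟨b, ⟨s, t, hs, ht, hst, rfl⟩, s', t', hs', ht', hst', rfl⟩
    refine ⟨s', t' * s, t' * t, hs', by positivity, by positivity, ?_, ?_⟩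
    · rw [add_assoc, ← mul_add, hst, mul_one, hst']
    · rw [smul_add, smul_smul, smul_smul, add_assoc]
  obtain ⟨α, β, γ, e1, e2, e3, e4, e5⟩ := comb h hh
  obtain ⟨α', β', γ', f1, f2, f3, f4, f5⟩ := comb k hk
  exact g.false_of_corner_aux h1 h2 ((hn _ _).2 hu) ((hn _ _).2 hy)
    ((hn _ _).2 hX) ((hn _ _).2 hX') (hcomb _ _ _ _ _ _ _ e4 e5) e1 e2 e3 e4
    (hcomb _ _ _ _ _ _ _ f4 f5) f1 f2 f3 f4 (mt (hn _ _).1 hhv) (mt (hn _ _).1 hhw)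
    (mt (hn _ _).1 hkv) (mt (hn _ _).1 hkw) (by rw [hc, ← orient_rot]; exact div_pos hDh hl)
    (by rw [hc, ← orient_rot]; exact div_pos hDk hl) (mt (hn _ _).1 huh) (mt (hn _ _).1 hyk)

end Cells

/-! ### The fan of edges seen from one end of an edge -/

section Fan

/-- Barycentric coordinates with respect to a positively oriented triangle. -/
theorem exists_barycentric {ε : ℝ} {x a b p : ℂ} (h : 0 < orient ε x a b)
    (h1 : 0 ≤ orient ε x a p) (h2 : 0 ≤ orient ε x p b) (h3 : 0 ≤ orient ε a b p) :
    ∃ α β γ : ℝ, 0 ≤ α ∧ 0 ≤ β ∧ 0 ≤ γ ∧ α + β + γ = 1 ∧ α • x + β • a + γ • b = p := by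
  have hs : orient ε a b p + orient ε x p b + orient ε x a p = orient ε x a b := by
    unfold orient; ring
  refine ⟨orient ε a b p / orient ε x a b, orient ε x p b / orient ε x a b,
    orient ε x a p / orient ε x a b, div_nonneg h3 h.le, div_nonneg h2 h.le, div_nonneg h1 h.le,
    ?_, ?_⟩
  · rw [← add_div, ← add_div, hs, div_self h.ne']
  · have e1 : orient ε a b p * x.re + orient ε x p b * a.re + orient ε x a p * b.re =
        orient ε x a b * p.re := by unfold orient; ring
    have e2 : orient ε a b p * x.im + orient ε x p b * a.im + orient ε x a p * b.im =
        orient ε x a b * p.im := by unfold orient; ring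
    have := h.ne'
    apply Complex.ext
    · simp only [Complex.add_re, Complex.real_smul, Complex.mul_re, Complex.ofReal_re,
        Complex.ofReal_im]
      field_simp
      linarith
    · simp only [Complex.add_im, Complex.real_smul, Complex.mul_im, Complex.ofReal_re,
        Complex.ofReal_im]
      field_simp
      linarith

theorem mem_of_convex_of_orient {S : Set ℂ} (hS : Convex ℝ S) {ε : ℝ} {x a b p : ℂ}
    (hx : x ∈ S) (ha : a ∈ S) (hb : b ∈ S) (h : 0 < orient ε x a b)
    (h1 : 0 ≤ orient ε x a p) (h2 : 0 ≤ orient ε x p b) (h3 : 0 ≤ orient ε a b p) : p ∈ S := by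
  obtain ⟨α, β, γ, hα, hβ, hγ, hs, rfl⟩ := exists_barycentric h h1 h2 h3
  have hsub : convexHull ℝ {x, a, b} ⊆ S := by
    apply convexHull_min _ hS
    rintro z (rfl | rfl | rfl) <;> assumption
  apply hsub
  have := (convex_convexHull ℝ ({x, a, b} : Set ℂ)).sum_mem (t := Finset.univ)
    (w := ![α, β, γ]) (z := ![x, a, b]) ?_ ?_ ?_
  · simpa [Fin.sum_univ_three] using this
  · intro i _; fin_cases i <;> simp [hα, hβ, hγ]
  · simp [Fin.sum_univ_three, hs]
  · intro i _
    apply subset_convexHull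
    fin_cases i <;> simp

/-- The situation at the end `w` of an edge `w v` that sees `u` in the sector beginning with `v`. -/
structure IsFanBase (P : Finset ℂ) (o : ℂ) (ℓ : ℝ) (A : SimpleGraph ℂ) (ε : ℝ) (v w u : ℂ) :
    Prop where
  adj : A.Adj w v
  mem : u ∈ P
  disjoint : Disjoint (openSegment ℝ w u) (drawing P A)
  mem_nbhd : u ∈ nbhd o ℓ v
  pos : 0 < orient ε w v u
  sector : ∀ z, A.Adj w z → 0 < orient ε w v z → 0 < orient ε w z u → False

/-- An edge `a b` that, seen from `w`, is the side of the convex hull of the vertices in the cone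
between `a` and `u`: no vertex and no edge of the cone is nearer to `w`. -/
structure IsFanStep (P : Finset ℂ) (o : ℂ) (ℓ : ℝ) (A : SimpleGraph ℂ) (ε : ℝ) (v w u a b : ℂ) :
    Prop where
  adj : A.Adj a b
  pos : 0 < orient ε w a b
  pos_left : 0 < orient ε w a u
  nonneg_right : 0 ≤ orient ε w b u
  pos_base : 0 < orient ε w v b
  extremal : ∀ p ∈ P, 0 < orient ε w a p → 0 ≤ orient ε w p u → orient ε a b p ≤ 0
  free : ∀ p q z, A.Adj p q → z ∈ segment ℝ p q → 0 < orient ε w a z → 0 < orient ε w z u →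
    orient ε a b z ≤ 0
  mem_nbhd : b ∈ nbhd o ℓ v
  notMem_nbhd : b ∉ nbhd o ℓ w
  /-- The vertices in the rest of the cone are not on the side of `w` of the line `v a`. -/
  base_left : ∀ p ∈ P, 0 < orient ε w a p → 0 ≤ orient ε w p u → orient ε v a p ≤ 0

/-- What is known about a vertex of the fan before the next edge is found. -/
structure IsFanVertex (P : Finset ℂ) (o : ℂ) (ℓ : ℝ) (A : SimpleGraph ℂ) (ε : ℝ) (v w u a : ℂ) :
    Prop where
  mem : a ∈ P
  unblocked : Unblocked A ε w a
  pos_left : 0 < orient ε w a u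
  base : a = v ∨ 0 < orient ε w v a ∧ a ∈ nbhd o ℓ v ∧ a ∉ nbhd o ℓ w
  base_left : ∀ p ∈ P, 0 < orient ε w a p → 0 ≤ orient ε w p u → orient ε v a p ≤ 0

/-- The walk along the boundary of the face, followed from `v` away from `w`: it starts with the
first edge at `v` after the one to `w`, and turns as sharply as possible at each vertex. -/
structure IsFanWalk (A : SimpleGraph ℂ) (ε : ℝ) (v w : ℂ) (s : ℕ → ℂ) : Prop where
  zero : s 0 = v
  first : A.Adj v (s 1) ∧ 0 < orient ε v (s 1) w ∧
    ∀ z, A.Adj v z → 0 < orient ε v (s 1) z → 0 < orient ε v z w → False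
  turn : ∀ i q, A.Adj (s (i + 1)) q → 0 < orient ε (s (i + 1)) q w →
    0 < orient ε (s (i + 1)) w (s i) →
    (∀ z, A.Adj (s (i + 1)) z → 0 < orient ε (s (i + 1)) q z → 0 < orient ε (s (i + 1)) z w →
      False) →
    (∀ z, A.Adj (s (i + 1)) z → 0 < orient ε (s (i + 1)) z (s i) → False) → s (i + 2) = q

variable {P : Finset ℂ} {o : ℂ} {ℓ : ℝ} {A : SimpleGraph ℂ} {ε : ℝ} {v w u a b : ℂ}

/-- Vertices joined by a segment off the drawing are not in neighbouring cells: otherwise the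
segment could be added to the graph. -/
theorem IsMaximalPSLG.notMem_nbhd_of_disjoint (hA : IsMaximalPSLG P o ℓ A)
    (hP : GeneralPosition P) {x y : ℂ} (hx : x ∈ P) (hy : y ∈ P) (hxy : x ≠ y)
    (h : Disjoint (openSegment ℝ x y) (drawing P A)) : y ∉ nbhd o ℓ x := by
  intro hN
  have hadj := hA.adj_of_unblocked hP hx hy hxy hN
    fun p q hpq z hz hz' => absurd (Or.inr ⟨p, q, hpq, hz'⟩) (Set.disjoint_left.1 h hz)
  obtain ⟨z, hz⟩ : (openSegment ℝ x y).Nonempty :=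
    ⟨_, midpoint_mem_openSegment (𝕜 := ℝ) x y⟩
  exact Set.disjoint_left.1 h hz (Or.inr ⟨x, y, hadj, openSegment_subset_segment ℝ _ _ hz⟩)

/-- An edge cannot leave one of its ends into a region, given by strict inequalities that hold at
that end and a further one that holds along the edge, which is not met by edges. -/
theorem false_of_edge_into_free {α β : ℂ → ℝ} {R : ℂ → ℝ} {x z : ℂ}
    (hα : ∀ t : ℝ, α ((1 - t) • x + t • z) = (1 - t) * α x + t * α z)
    (hβ : ∀ t : ℝ, β ((1 - t) • x + t • z) = (1 - t) * β x + t * β z)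
    (hR : ∀ t : ℝ, R ((1 - t) • x + t • z) = (1 - t) * R x + t * R z)
    (h1 : 0 < α x ∨ α x = 0 ∧ 0 < α z) (h2 : 0 < β x ∨ β x = 0 ∧ 0 < β z) (h3 : R x = 0)
    (h4 : 0 < R z) (hxz : A.Adj x z)
    (hfree : ∀ p q z, A.Adj p q → z ∈ segment ℝ p q → 0 < α z → 0 < β z → R z ≤ 0) : False := by
  have key : ∀ α : ℂ → ℝ, (∀ t : ℝ, α ((1 - t) • x + t • z) = (1 - t) * α x + t * α z) →
      (0 < α x ∨ α x = 0 ∧ 0 < α z) →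
      ∃ r : ℝ, 0 < r ∧ ∀ t : ℝ, 0 < t → t < r → 0 < α ((1 - t) • x + t • z) := by
    intro α hα h
    rcases h with h | ⟨h, h'⟩
    · refine ⟨α x / (α x + |α z|), by positivity, fun t t0 tr => ?_⟩
      rw [hα]
      rw [lt_div_iff₀ (by positivity)] at tr
      have := mul_le_mul_of_nonneg_left (neg_abs_le (α z)) t0.le
      linarith
    · refine ⟨1, one_pos, fun t t0 _ => ?_⟩
      rw [hα, h]
      have := mul_pos t0 h'
      linarith
  obtain ⟨r1, r1', H1⟩ := key α hα h1
  obtain ⟨r2, r2', H2⟩ := key β hβ h2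
  set t := min 1 (min r1 r2) / 2 with ht
  have hm : 0 < min 1 (min r1 r2) := lt_min one_pos (lt_min r1' r2')
  have t0 : 0 < t := by positivity
  have tm : t < min 1 (min r1 r2) := half_lt_self hm
  have t1 : t < 1 := tm.trans_le (min_le_left _ _)
  have tr1 : t < r1 := tm.trans_le ((min_le_right _ _).trans (min_le_left _ _))
  have tr2 : t < r2 := tm.trans_le ((min_le_right _ _).trans (min_le_right _ _))
  have := hfree x z _ hxz ⟨1 - t, t, by linarith, t0.le, by ring, rfl⟩ (H1 t t0 tr1) (H2 t t0 tr2)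
  rw [hR, h3] at this
  have := mul_pos t0 h4
  linarith

theorem orient_line (ε : ℝ) (c d x z : ℂ) (t : ℝ) :
    orient ε c d ((1 - t) • x + t • z) = (1 - t) * orient ε c d x + t * orient ε c d z :=
  orient_comb (by ring) rfl

theorem orient_line_mid (ε : ℝ) (c d x z : ℂ) (t : ℝ) :
    orient ε c ((1 - t) • x + t • z) d = (1 - t) * orient ε c x d + t * orient ε c z d := by
  rw [orient_swap, orient_line, orient_swap ε c d x, orient_swap ε c d z]
  ring

theorem IsFanBase.isFanVertex (h : IsFanBase P o ℓ A ε v w u) (hA : IsPSLG P A) :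
    IsFanVertex P o ℓ A ε v w u v where
  mem := hA.right_mem h.adj
  unblocked := hA.unblocked_of_adj h.adj ε
  pos_left := h.pos
  base := Or.inl rfl
  base_left p _ _ _ := by simp

theorem IsFanVertex.nonneg_base (ha : IsFanVertex P o ℓ A ε v w u a) : 0 ≤ orient ε w v a := by
  rcases ha.base with rfl | h
  · simp
  · exact h.1.le

theorem IsFanStep.pos_right (hA : IsPSLG P A) (hP : GeneralPosition P) (hε : ε ≠ 0)
    (hb : IsFanBase P o ℓ A ε v w u) (h : IsFanStep P o ℓ A ε v w u a b) (hbu : b ≠ u) :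
    0 < orient ε w b u := by
  refine h.nonneg_right.lt_of_ne fun h0 => ?_
  rcases hP.eq_of_orient hε (hA.left_mem _ _ hb.adj) (hA.right_mem h.adj) hb.mem h0.symm
    (ne_of_orient h.pos).2.2 with h1 | h1
  · exact (ne_of_orient hb.pos).2.2 h1.symm
  · exact hbu h1.symm

/-- The cone seen from `w` is empty up to the first edge of the hull, and this is an edge of the
graph. -/
theorem IsFanVertex.exists_step (hℓ : 0 < ℓ) (hε : ε = 1 ∨ ε = -1) (hP : GeneralPosition P)
    (hA : IsMaximalPSLG P o ℓ A) (hb : IsFanBase P o ℓ A ε v w u)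
    (ha : IsFanVertex P o ℓ A ε v w u a) :
    ∃ b, IsFanStep P o ℓ A ε v w u a b ∧ (b ≠ u → IsFanVertex P o ℓ A ε v w u b) := by
  classical
  have hε0 : ε ≠ 0 := by rcases hε with rfl | rfl <;> norm_num
  have hA' := hA.prop.1
  have hwP := hA'.left_mem _ _ hb.adj
  have hvP := hA'.right_mem hb.adj
  have hau := ha.pos_left
  have hav := ha.nonneg_base
  have hwN : w ∈ nbhd o ℓ v := hA.prop.2 _ _ hb.adj.symm
  have huw : u ∉ nbhd o ℓ w :=
    hA.notMem_nbhd_of_disjoint hP hwP hb.mem (ne_of_orient hb.pos).2.2 hb.disjoint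
  have haN : a ∈ nbhd o ℓ v := by
    rcases ha.base with rfl | h
    · exact self_mem_nbhd
    · exact h.2.1
  -- points of the cone between `a` and `u` lie in the cone between `v` and `u`
  have hbase : ∀ p, 0 < orient ε w a p → 0 ≤ orient ε w p u → 0 < orient ε w v p := by
    intro p h1 h2
    have := orient_pluecker ε w v a p u
    have := mul_pos hb.pos h1
    have := mul_nonneg hav h2
    refine pos_of_mul_pos_left (b := orient ε w a u) ?_ hau.le
    linarith
  set C := P.filter fun p => 0 < orient ε w a p ∧ 0 ≤ orient ε w p u with hC
  have huC : u ∈ C := by simp [hC, hb.mem, hau]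
  obtain ⟨q, hqC, hq⟩ := exists_first_by_angle ⟨u, huC⟩
    (fun p hp => (Finset.mem_filter.1 hp).2.1)
  obtain ⟨hqP, haq, hqu⟩ := Finset.mem_filter.1 hqC
  have hext : ∀ p ∈ P, 0 < orient ε w a p → 0 ≤ orient ε w p u → orient ε a q p ≤ 0 :=
    fun p hp h1 h2 => hq p (Finset.mem_filter.2 ⟨hp, h1, h2⟩)
  have hvq := hbase q haq hqu
  have haqw : 0 < orient ε a q w := by rw [← orient_rot]; exact haq
  have haqu : orient ε a q u ≤ 0 := hext u hb.mem hau (by simp)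
  have hfree : ∀ p q' z, A.Adj p q' → z ∈ segment ℝ p q' → 0 < orient ε w a z →
      0 < orient ε w z u → orient ε a q z ≤ 0 := by
    intro p q' z hpq hz h1 h2
    refine hA'.free_cone hε0 hau (by simp) haqu haqw ha.unblocked
      (unblocked_of_disjoint ε hb.disjoint) (fun p q h => hA'.vertex_on_edge p q h w hwP) ?_
      (fun p hp h1 h2 => hext p hp h1 h2.le) hpq hz h1 h2
    exact fun z hz h1 h2 => hb.sector z hz (hbase z h1 h2.le) h2
  have hqN : q ∈ nbhd o ℓ v := by
    refine mem_of_convex_of_orient (convex_nbhd hℓ v) hwN haN hb.mem_nbhd hau haq.le hqu ?_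
    rw [orient_swap]
    linarith
  have hwq : q ≠ u → 0 < orient ε w q u ∧ Disjoint (openSegment ℝ w q) (drawing P A) := by
    intro hne
    have hqu' : 0 < orient ε w q u := by
      refine hqu.lt_of_ne fun h0 => ?_
      rcases hP.eq_of_orient hε0 hwP hqP hb.mem h0.symm (ne_of_orient haq).2.2 with h1 | h1
      · exact (ne_of_orient hb.pos).2.2 h1.symm
      · exact hne h1.symm
    refine ⟨hqu', Set.disjoint_left.2 fun z hz hzd => ?_⟩
    obtain ⟨s, t, hs, ht, hst, rfl⟩ := hz
    obtain rfl : s = 1 - t := by linarith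
    have h1 : 0 < orient ε w a ((1 - t) • w + t • q) := by
      rw [orient_line]; simpa using mul_pos ht haq
    have h2 : 0 < orient ε w ((1 - t) • w + t • q) u := by
      rw [orient_line_mid]; simpa using mul_pos ht hqu'
    have h3 : 0 < orient ε a q ((1 - t) • w + t • q) := by
      rw [orient_line]; simpa using mul_pos hs haqw
    rcases hzd with hzP | ⟨p, q', hpq, hz⟩
    · linarith [hext _ hzP h1 h2.le]
    · linarith [hfree _ _ _ hpq hz h1 h2]
  have hqN' : q ∉ nbhd o ℓ w := by
    by_cases h : q = u
    · rw [h]; exact huw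
    · exact hA.notMem_nbhd_of_disjoint hP hwP hqP (ne_of_orient haq).2.2 (hwq h).2
  have haq' : a ≠ q := (ne_of_orient haq).2.1
  have hvaq : orient ε v a q ≤ 0 := ha.base_left q hqP haq hqu
  have hNaq : q ∈ nbhd o ℓ a := by
    rcases ha.base with rfl | ⟨h1, h2, h3⟩
    · exact hqN
    · refine mem_nbhd_of_convex hℓ hε hwN h2 hqN h3 hqN' h1 hvq (hvaq.lt_of_ne fun h0 => ?_) haqw
      rcases hP.eq_of_orient hε0 hvP ha.mem hqP h0 (ne_of_orient h1).2.1 with h | h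
      · exact (ne_of_orient hvq).2.1 h.symm
      · exact haq' h.symm
  have hadj : A.Adj a q := by
    refine hA.adj_of_unblocked hP ha.mem hqP haq' hNaq fun p q' hpq z hz hz' => ?_
    refine hA'.eq_of_far_side hP hε0 (x := w) (a := a) (b := u) hfree ha.mem hqP haq' hpq hz hz'
      ?_ ?_
    · obtain ⟨s, t, hs, ht, hst, H⟩ := orient_of_mem_openSegment hz
      rw [H]; simpa using mul_pos ht haq
    · obtain ⟨s, t, hs, ht, hst, rfl⟩ := hz
      obtain rfl : s = 1 - t := by linarith
      rw [orient_line_mid]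
      have := mul_pos hs hau
      have := mul_nonneg ht.le hqu
      linarith
  refine ⟨q, ⟨hadj, haq, hau, hqu, hvq, hext, hfree, hqN, hqN', ha.base_left⟩, fun hne => ?_⟩
  refine ⟨hqP, unblocked_of_disjoint ε (hwq hne).2, (hwq hne).1, Or.inr ⟨hvq, hqN, hqN'⟩, ?_⟩
  intro p hp h1 h2
  have hap : 0 < orient ε w a p := by
    have h3 := orient_pluecker ε w a q p u
    have := mul_pos hau h1
    have := mul_nonneg haq.le h2
    refine pos_of_mul_pos_left (b := orient ε w q u) ?_ hqu
    linarith
  have key : orient ε w a q * orient ε v q p =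
      orient ε w q p * orient ε v a q + orient ε w v q * orient ε a q p := by
    unfold orient; ring
  have h4 := hext p hp hap h2
  have h5 := mul_nonpos_of_nonneg_of_nonpos h1.le hvaq
  have h6 := mul_nonpos_of_nonneg_of_nonpos hvq.le h4
  by_contra hcon
  push Not at hcon
  have := mul_pos haq hcon
  linarith

/-- The walk follows the hull up to `u`. -/
theorem IsFanWalk.exists_end (hℓ : 0 < ℓ) (hε : ε = 1 ∨ ε = -1) (hP : GeneralPosition P)
    (hA : IsMaximalPSLG P o ℓ A) (hb : IsFanBase P o ℓ A ε v w u) {s : ℕ → ℂ}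
    (hs : IsFanWalk A ε v w s) :
    ∃ k, 0 < k ∧ s k = u ∧ ∀ i < k, IsFanStep P o ℓ A ε v w u (s i) (s (i + 1)) := by
  classical
  have hε0 : ε ≠ 0 := by rcases hε with rfl | rfl <;> norm_num
  have hA' := hA.prop.1
  have hstep : ∀ i, IsFanVertex P o ℓ A ε v w u (s i) →
      (∀ j, i = j + 1 → IsFanStep P o ℓ A ε v w u (s j) (s (j + 1))) →
      IsFanStep P o ℓ A ε v w u (s i) (s (i + 1)) ∧
        (s (i + 1) ≠ u → IsFanVertex P o ℓ A ε v w u (s (i + 1))) := by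
    intro i hi hprev
    obtain ⟨q, hq, hq'⟩ := hi.exists_step hℓ hε hP hA hb
    have hcone : ∀ z, A.Adj (s i) z → 0 < orient ε (s i) q z → 0 < orient ε (s i) z w → False := by
      intro z hz h1 h2
      refine false_of_edge_into_free (A := A) (α := fun x => orient ε w (s i) x)
        (β := fun x => orient ε w x u) (R := fun x => orient ε (s i) q x)
        (orient_line _ _ _ _ _) (orient_line_mid _ _ _ _ _) (orient_line _ _ _ _ _)
        (Or.inr ⟨by simp, by simpa [orient_rot ε w] using h2⟩) (Or.inl hi.pos_left) (by simp) h1 hz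
        hq.free
    have hqw : 0 < orient ε (s i) q w := by rw [← orient_rot]; exact hq.pos
    have heq : s (i + 1) = q := by
      rcases i with _ | j
      · rw [hs.zero] at hq hqw hcone
        obtain ⟨f1, f2, f3⟩ := hs.first
        rcases lt_trichotomy (orient ε v (s 1) q) 0 with h | h | h
        · rw [orient_swap] at h
          exact (hcone (s 1) f1 (by linarith) f2).elim
        · rcases hP.eq_of_orient hε0 (hA'.left_mem _ _ f1) (hA'.right_mem f1)
            (hA'.right_mem hq.adj) h f1.ne with h | h
          · exact absurd h.symm hq.adj.ne
          · exact h.symm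
        · exact (f3 q hq.adj h hqw).elim
      · have hp := hprev j rfl
        refine hs.turn j q hq.adj hqw ?_ hcone ?_
        · rw [← orient_rot, ← orient_rot]; exact hp.pos
        · intro z hz h1
          exact false_of_edge_into_free (A := A) (α := fun x => orient ε w (s j) x)
            (β := fun x => orient ε w x u) (R := fun x => orient ε (s j) (s (j + 1)) x)
            (orient_line _ _ _ _ _) (orient_line_mid _ _ _ _ _) (orient_line _ _ _ _ _)
            (Or.inl hp.pos) (Or.inl hi.pos_left) (by simp)
            (by rw [orient_rot]; exact h1) hz hp.free
    rw [← heq] at hq hq'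
    exact ⟨hq, hq'⟩
  have main : ∀ n i, (P.filter fun p => 0 < orient ε w (s i) p ∧ 0 ≤ orient ε w p u).card = n →
      IsFanVertex P o ℓ A ε v w u (s i) →
      (∀ j, j < i → IsFanStep P o ℓ A ε v w u (s j) (s (j + 1))) →
      ∃ k, 0 < k ∧ s k = u ∧ ∀ i < k, IsFanStep P o ℓ A ε v w u (s i) (s (i + 1)) := by
    intro n
    induction n using Nat.strong_induction_on with
    | _ n ih =>
      intro i hn hi hprev
      obtain ⟨h1, h2⟩ := hstep i hi fun j hj => hprev j (by omega)
      have hprev' : ∀ j, j < i + 1 → IsFanStep P o ℓ A ε v w u (s j) (s (j + 1)) := by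
        intro j hj
        rcases Nat.lt_succ_iff_lt_or_eq.1 hj with hj | rfl
        · exact hprev j hj
        · exact h1
      by_cases hu : s (i + 1) = u
      · exact ⟨i + 1, by omega, hu, hprev'⟩
      · refine ih _ ?_ (i + 1) rfl (h2 hu) hprev'
        rw [← hn]
        apply Finset.card_lt_card
        rw [Finset.ssubset_iff_of_subset]
        · exact ⟨s (i + 1), by simp [hA'.right_mem h1.adj, h1.pos, h1.nonneg_right], by simp⟩
        · intro p hp
          rw [Finset.mem_filter] at hp ⊢
          refine ⟨hp.1, ?_, hp.2.2⟩
          have h3 := orient_pluecker ε w (s i) (s (i + 1)) p u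
          have := mul_pos h1.pos_left hp.2.1
          have := mul_nonneg h1.pos.le hp.2.2
          refine pos_of_mul_pos_left (b := orient ε w (s (i + 1)) u) ?_ h1.nonneg_right
          linarith
  exact main _ 0 rfl (by rw [hs.zero]; exact hb.isFanVertex hA') (by omega)

end Fan

/-! ### Angles at an entry of the walk -/

section Angles

variable {a b x y : ℂ}

theorem rightAngle_pos (a b c : ℂ) : 0 < rightAngle a b c := by
  unfold rightAngle
  split_ifs with h
  · exact h
  · linarith [Complex.neg_pi_lt_arg ((c - b) / (a - b)), Real.pi_pos]

theorem rightAngle_le (a b c : ℂ) : rightAngle a b c ≤ 2 * Real.pi := by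
  unfold rightAngle
  split_ifs with h
  · linarith [Complex.arg_le_pi ((c - b) / (a - b)), Real.pi_pos]
  · linarith

theorem rightAngle_self (hab : a ≠ b) : rightAngle a b a = 2 * Real.pi := by
  unfold rightAngle
  simp [div_self (sub_ne_zero.2 hab)]

theorem exists_orient_eq_sin (hab : a ≠ b) (hx : x ≠ b) (hy : y ≠ b) :
    ∃ r : ℝ, 0 < r ∧ orient 1 b x y = r * Real.sin (rightAngle a b y - rightAngle a b x) := by
  have hd : a - b ≠ 0 := sub_ne_zero.2 hab
  have hx' : (x - b) / (a - b) ≠ 0 := div_ne_zero (sub_ne_zero.2 hx) hd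
  have hy' : (y - b) / (a - b) ≠ 0 := div_ne_zero (sub_ne_zero.2 hy) hd
  have hsin : Real.sin (rightAngle a b y - rightAngle a b x) =
      Real.sin (((y - b) / (a - b)).arg - ((x - b) / (a - b)).arg) := by
    unfold rightAngle
    split_ifs with h1 h2 h2
    · rfl
    · rw [← sub_sub, Real.sin_sub_two_pi]
    · rw [add_sub_right_comm, Real.sin_add_two_pi]
    · rw [add_sub_add_right_eq_sub]
  have e1 : x - b = (x - b) / (a - b) * (a - b) := (div_mul_cancel₀ _ hd).symm
  have e2 : y - b = (y - b) / (a - b) * (a - b) := (div_mul_cancel₀ _ hd).symm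
  refine ⟨Complex.normSq (a - b) * ‖(x - b) / (a - b)‖ * ‖(y - b) / (a - b)‖, ?_, ?_⟩
  · have h1 := Complex.normSq_pos.2 hd
    have h2 := norm_pos_iff.2 hx'
    have h3 := norm_pos_iff.2 hy'
    positivity
  rw [hsin, Real.sin_sub, Complex.sin_arg, Complex.sin_arg, Complex.cos_arg hx',
    Complex.cos_arg hy']
  have h2 := (norm_pos_iff.2 hx').ne'
  have h3 := (norm_pos_iff.2 hy').ne'
  generalize (x - b) / (a - b) = z at *
  generalize (y - b) / (a - b) = z' at *
  have r1 := congrArg Complex.re e1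
  have r2 := congrArg Complex.im e1
  have r3 := congrArg Complex.re e2
  have r4 := congrArg Complex.im e2
  simp only [Complex.mul_re, Complex.mul_im, Complex.sub_re, Complex.sub_im] at r1 r2 r3 r4
  simp only [orient, Complex.normSq_apply, Complex.sub_re, Complex.sub_im]
  rw [r1, r2, r3, r4]
  field_simp
  ring

/-- The sign of an orientation at `b`, in terms of the angles measured from `a`. -/
theorem orient_pos_iff (hab : a ≠ b) (hx : x ≠ b) (hy : y ≠ b) :
    0 < orient 1 b x y ↔
      (rightAngle a b x < rightAngle a b y ∧ rightAngle a b y < rightAngle a b x + Real.pi) ∨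
        rightAngle a b y + Real.pi < rightAngle a b x := by
  obtain ⟨r, hr, h⟩ := exists_orient_eq_sin hab hx hy
  rw [h, mul_pos_iff_of_pos_left hr]
  have h1 := rightAngle_pos a b x
  have h2 := rightAngle_pos a b y
  have h3 := rightAngle_le a b x
  have h4 := rightAngle_le a b y
  generalize rightAngle a b x = α at *
  generalize rightAngle a b y = β at *
  constructor
  · intro hs
    by_contra hcon
    push Not at hcon
    obtain ⟨c1, c2⟩ := hcon
    rcases le_or_gt β α with h5 | h5
    · exact absurd hs
        (not_lt.2 (Real.sin_nonpos_of_nonpos_of_neg_pi_le (by linarith) (by linarith)))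
    · have c3 := c1 h5
      have := Real.sin_nonneg_of_nonneg_of_le_pi (x := β - α - Real.pi) (by linarith) (by linarith)
      rw [Real.sin_sub_pi] at this
      linarith
  · rintro (⟨c1, c2⟩ | c1)
    · exact Real.sin_pos_of_pos_of_lt_pi (by linarith) (by linarith)
    · rw [← Real.sin_add_two_pi]
      exact Real.sin_pos_of_pos_of_lt_pi (by linarith) (by linarith)

theorem orient_eq_zero_of_rightAngle_eq (hab : a ≠ b) (hx : x ≠ b) (hy : y ≠ b)
    (h : rightAngle a b x = rightAngle a b y) : orient 1 b x y = 0 := by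
  obtain ⟨r, -, h'⟩ := exists_orient_eq_sin hab hx hy
  rw [h', h]; simp

theorem rightAngle_lt_pi_iff (hab : a ≠ b) (hx : x ≠ b) :
    rightAngle a b x < Real.pi ↔ 0 < orient 1 b a x := by
  rw [orient_pos_iff hab hab hx, rightAngle_self hab]
  have := rightAngle_le a b x
  have := Real.pi_pos
  constructor
  · intro h; right; linarith
  · rintro (⟨h, -⟩ | h) <;> linarith

end Angles

/-! ### Boundary walks -/

section Walk

variable {P : Finset ℂ} {o : ℂ} {ℓ : ℝ} {A : SimpleGraph ℂ} {m : ℕ} {σ : ℤ → ℂ} {u v y : ℤ}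

theorem IsBoundarySequence.adj_prev (hσ : IsBoundarySequence A m σ) (i : ℤ) :
    A.Adj (σ i) (σ (i - 1)) := by
  have := hσ.adj (i - 1)
  rw [sub_add_cancel] at this
  exact this.symm

theorem eq_of_rightAngle_eq (hA : IsPSLG P A) (hP : GeneralPosition P) {a b x y : ℂ}
    (ha : A.Adj b a) (hx : A.Adj b x) (hy : A.Adj b y) (h : rightAngle a b x = rightAngle a b y) :
    x = y := by
  rcases hP.eq_of_orient one_ne_zero (hA.left_mem _ _ ha) (hA.right_mem hx) (hA.right_mem hy)
    (orient_eq_zero_of_rightAngle_eq ha.ne' hx.ne' hy.ne' h) hx.ne with h | h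
  · exact absurd h hy.ne'
  · exact h.symm

theorem IsBoundarySequence.isConvex_iff (hσ : IsBoundarySequence A m σ) (i : ℤ) :
    IsConvex σ i ↔ 0 < orient 1 (σ i) (σ (i - 1)) (σ (i + 1)) :=
  rightAngle_lt_pi_iff (hσ.adj_prev i).ne' (hσ.adj i).ne'

theorem IsBoundarySequence.isConvex_add (hσ : IsBoundarySequence A m σ) (i : ℤ) :
    IsConvex σ (i + m) ↔ IsConvex σ i := by
  unfold IsConvex
  rw [show i + m - 1 = i - 1 + m by ring, show i + m + 1 = i + 1 + m by ring, hσ.periodic,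
    hσ.periodic, hσ.periodic]

/-- The walk is determined by one of its steps. -/
theorem IsBoundarySequence.le_of_eq (hσ : IsBoundarySequence A m σ) (hA : IsPSLG P A)
    (hP : GeneralPosition P) {i d : ℤ} (hd : 0 < d) (h0 : σ (i + d) = σ i)
    (h1 : σ (i + d + 1) = σ (i + 1)) : (m : ℤ) ≤ d := by
  have key : ∀ n : ℕ, σ (i + n + d) = σ (i + n) ∧ σ (i + n + 1 + d) = σ (i + n + 1) := by
    intro n
    induction n with
    | zero =>
      refine ⟨by simpa using h0, ?_⟩
      rw [show i + ((0 : ℕ) : ℤ) + 1 + d = i + d + 1 by push_cast; ring, h1]; simp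
    | succ n ih =>
      obtain ⟨e1, e2⟩ := ih
      refine ⟨by push_cast; rw [← add_assoc]; exact e2, ?_⟩
      push_cast
      have n1 := hσ.next (i + n + 1)
      have n2 := hσ.next (i + n + 1 + d)
      have a1 := hσ.adj (i + n + 1)
      have a2 := hσ.adj (i + n + 1 + d)
      have p1 := hσ.adj_prev (i + n + 1)
      rw [show i + n + 1 + d - 1 = i + n + d by ring,
        show i + n + 1 + d + 1 = i + n + 1 + 1 + d by ring, e1, e2] at n2
      rw [e2, show i + n + 1 + d + 1 = i + n + 1 + 1 + d by ring] at a2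
      rw [add_sub_cancel_right] at n1 p1
      have := eq_of_rightAngle_eq hA hP p1 a1 a2 (le_antisymm (n1 _ a2) (n2 _ a1))
      rw [← add_assoc]
      exact this.symm
  have hper : ∀ (n : ℕ) (x : ℤ), σ (x + n * m) = σ x := by
    intro n x
    induction n with
    | zero => simp
    | succ n ih =>
      push_cast
      rw [add_mul, one_mul, ← add_assoc, hσ.periodic, ih]
  have hall : ∀ x, σ (x + d) = σ x := by
    intro x
    obtain ⟨n, hn⟩ : ∃ n : ℕ, i ≤ x + n * m := by
      refine ⟨(i - x).toNat, ?_⟩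
      have h1 : (1 : ℤ) ≤ m := by exact_mod_cast hσ.pos
      have h2 : i - x ≤ ((i - x).toNat : ℤ) := Int.self_le_toNat _
      have h3 : (0 : ℤ) ≤ ((i - x).toNat : ℤ) := by positivity
      nlinarith
    obtain ⟨k, hk⟩ := Int.eq_ofNat_of_zero_le (sub_nonneg.2 hn)
    have := (key k).1
    rw [← hk, show i + (x + n * m - i) + d = x + d + n * m by ring, hper,
      show i + (x + n * m - i) = x + n * m by ring, hper] at this
    exact this
  have := hσ.minimal d.toNat (by omega) (fun x => by
    rw [Int.toNat_of_nonneg hd.le]; exact hall x)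
  omega

theorem IsBoundarySequence.isFanWalk_backward (hσ : IsBoundarySequence A m σ) (hA : IsPSLG P A)
    (hP : GeneralPosition P) (hv : IsConvex σ v) :
    IsFanWalk A 1 (σ v) (σ (v + 1)) fun i => σ (v - i) where
  zero := by simp
  first := by
    have h1 := (hσ.isConvex_iff v).1 hv
    refine ⟨by simpa using hσ.adj_prev v, by simpa using h1, fun z hz h2 h3 => ?_⟩
    have pa := hσ.adj_prev v
    have ca := hσ.adj v
    have := hσ.next v z hz
    simp only [Nat.cast_one] at h2
    rw [orient_pos_iff pa.ne' pa.ne' hz.ne', rightAngle_self pa.ne'] at h2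
    rw [orient_pos_iff pa.ne' hz.ne' ca.ne'] at h3
    have := rightAngle_le (σ (v - 1)) (σ v) z
    have := rightAngle_pos (σ (v - 1)) (σ v) (σ (v + 1))
    rcases h2 with h2 | h2 <;> rcases h3 with h3 | h3 <;> linarith
  turn i q hq h1 h2 h3 h4 := by
    have pa := hσ.adj_prev (v - (i + 1))
    have ca := hσ.adj (v - (i + 1))
    have hn := hσ.next (v - (i + 1)) q
    simp only [Nat.cast_add, Nat.cast_one, Nat.cast_ofNat] at hq h1 h2 h3 h4 ⊢
    -- a previous entry different from `q` would lie in the cone between `q` and `σ (v + 1)`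
    rw [show v - (i + 1) - 1 = v - (i + 2) by ring] at pa hn
    rw [show v - (i + 1) + 1 = v - (i : ℤ) by ring] at ca hn
    by_contra hne
    have hw : σ (v + 1) ≠ σ (v - (i + 1)) := (ne_of_orient h1).2.2.symm
    have hn := hn hq
    have h5 : rightAngle (σ (v - (i + 2))) (σ (v - (i + 1))) q ≠ 2 * Real.pi := by
      intro h
      rw [← rightAngle_self pa.ne'] at h
      exact hne (eq_of_rightAngle_eq hA hP pa hq pa h).symm
    have h6 := h4 _ pa
    rw [← rightAngle_lt_pi_iff pa.ne' ca.ne', imp_false, not_lt] at h6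
    have h7 := h3 _ pa
    have h8 : rightAngle (σ (v - (i + 2))) (σ (v - (i + 1))) (σ (v - i)) ≠
        rightAngle (σ (v - (i + 2))) (σ (v - (i + 1))) q := by
      intro h
      have := eq_of_rightAngle_eq hA hP pa ca hq h
      rw [← this, orient_swap] at h1
      linarith
    have h8 := lt_of_le_of_ne hn h8
    have h5 := lt_of_le_of_ne (rightAngle_le _ _ _) h5
    have h9 := rightAngle_pos (σ (v - (i + 2))) (σ (v - (i + 1))) (σ (v + 1))
    have h10 := rightAngle_le (σ (v - (i + 2))) (σ (v - (i + 1))) (σ (v + 1))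
    rw [orient_pos_iff pa.ne' hq.ne' hw] at h1
    rw [orient_pos_iff pa.ne' hw ca.ne'] at h2
    rw [orient_pos_iff pa.ne' hq.ne' pa.ne', orient_pos_iff pa.ne' pa.ne' hw,
      rightAngle_self pa.ne'] at h7
    refine h7 (Or.inl ⟨h5, by linarith⟩) (Or.inr ?_)
    rcases h1 with h1 | h1 <;> rcases h2 with h2 | h2 <;> linarith

theorem IsBoundarySequence.isFanWalk_forward (hσ : IsBoundarySequence A m σ) (hA : IsPSLG P A)
    (hP : GeneralPosition P) (hv : IsConvex σ (v + 1)) :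
    IsFanWalk A (-1) (σ (v + 1)) (σ v) fun i => σ (v + 1 + i) where
  zero := by simp
  first := by
    have h1 := (hσ.isConvex_iff (v + 1)).1 hv
    have pa := hσ.adj_prev (v + 1)
    have ca := hσ.adj (v + 1)
    rw [add_sub_cancel_right] at h1 pa
    refine ⟨by simpa using ca, ?_, fun z hz h2 h3 => ?_⟩
    · rw [orient_neg, orient_swap]; simpa using h1
    have hn := hσ.next (v + 1) z hz
    rw [add_sub_cancel_right] at hn
    rw [orient_neg, ← orient_swap] at h2 h3
    simp only [Nat.cast_one] at h2
    rw [orient_pos_iff pa.ne' hz.ne' ca.ne'] at h2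
    rw [← rightAngle_lt_pi_iff pa.ne' hz.ne'] at h3
    have := rightAngle_pos (σ v) (σ (v + 1)) (σ (v + 1 + 1))
    rcases h2 with h2 | h2 <;> linarith
  turn i q hq h1 h2 h3 h4 := by
    have pa := hσ.adj_prev (v + 1 + (i + 1))
    have ca := hσ.adj (v + 1 + (i + 1))
    have hn := hσ.next (v + 1 + (i + 1)) q
    simp only [Nat.cast_add, Nat.cast_one, Nat.cast_ofNat] at hq h1 h2 h3 h4 ⊢
    -- a next entry different from `q` would lie in the cone between `σ v` and `q`
    rw [show v + 1 + (i + 1) - 1 = v + 1 + (i : ℤ) by ring] at pa hn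
    rw [show v + 1 + (i + 1) + 1 = v + 1 + ((i : ℤ) + 2) by ring] at ca hn
    by_contra hne
    have hw : σ v ≠ σ (v + 1 + (i + 1)) := (ne_of_orient h1).2.2.symm
    have hn := hn hq
    have h3 := h3 _ ca
    have h4 := h4 _ ca
    rw [orient_neg, ← orient_swap] at h1 h2 h3 h4
    rw [orient_neg, ← orient_swap] at h3
    rw [← rightAngle_lt_pi_iff pa.ne' ca.ne', imp_false, not_lt] at h4
    have hn := lt_of_le_of_ne hn fun h => hne (eq_of_rightAngle_eq hA hP pa ca hq h)
    rw [orient_pos_iff pa.ne' hw hq.ne'] at h1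
    rw [← rightAngle_lt_pi_iff pa.ne' hw] at h2
    rw [orient_pos_iff pa.ne' ca.ne' hq.ne', orient_pos_iff pa.ne' hw ca.ne'] at h3
    have := rightAngle_le (σ (v + 1 + i)) (σ (v + 1 + (i + 1))) q
    have := rightAngle_pos (σ (v + 1 + i)) (σ (v + 1 + (i + 1))) q
    rcases h1 with h1 | h1
    · exact h3 (Or.inl ⟨hn, by linarith⟩) (Or.inl ⟨by linarith, by linarith⟩)
    · linarith

theorem IsOneChain.isFanBase_backward (hσ : IsBoundarySequence A m σ) (hA : IsMaximalPSLG P o ℓ A)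
    (h : IsOneChain P o ℓ A σ u v (v + 1)) (hw : IsConvex σ (v + 1)) :
    IsFanBase P o ℓ A 1 (σ v) (σ (v + 1)) (σ u) := by
  obtain ⟨hdis, -, hs⟩ := h.visible
  have pa := hσ.adj_prev (v + 1)
  have ca := hσ.adj (v + 1)
  have hn := hσ.next (v + 1)
  unfold InSector at hs
  unfold IsConvex at hw
  rw [add_sub_cancel_right] at pa hs hn hw
  have huP := hA.prop.1.left_mem _ _ (hσ.adj u)
  have hne : σ u ≠ σ (v + 1) := by
    intro h0
    have hd := hdis
    rw [h0, openSegment_same, Set.disjoint_singleton_left] at hd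
    exact hd (Or.inl (hA.prop.1.left_mem _ _ ca))
  have hpos : 0 < orient 1 (σ (v + 1)) (σ v) (σ u) := by
    rw [← rightAngle_lt_pi_iff pa.ne' hne]; linarith
  refine ⟨pa, huP, by rwa [openSegment_symm], h.mem_nbhd u le_rfl (by have := h.lt_left; omega),
    hpos, fun z hz h1 h2 => ?_⟩
  have := hn z hz
  rw [← rightAngle_lt_pi_iff pa.ne' hz.ne'] at h1
  rw [orient_pos_iff pa.ne' hz.ne' hne] at h2
  have := rightAngle_pos (σ v) (σ (v + 1)) (σ u)
  rcases h2 with h2 | h2 <;> linarith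

theorem IsOneChain.isFanBase_forward (hσ : IsBoundarySequence A m σ) (hA : IsMaximalPSLG P o ℓ A)
    (h : IsOneChain P o ℓ A σ v (v + 1) y) (hv : IsConvex σ v) :
    IsFanBase P o ℓ A (-1) (σ (v + 1)) (σ v) (σ y) := by
  obtain ⟨hdis, hs, -⟩ := h.visible
  have pa := hσ.adj_prev v
  have ca := hσ.adj v
  have hn := hσ.next v
  unfold InSector at hs
  unfold IsConvex at hv
  have hyP := hA.prop.1.left_mem _ _ (hσ.adj y)
  have hne : σ y ≠ σ v := by
    intro h0
    have hd := hdis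
    rw [h0, openSegment_same, Set.disjoint_singleton_left] at hd
    exact hd (Or.inl (hA.prop.1.left_mem _ _ ca))
  refine ⟨ca, hyP, hdis, h.mem_nbhd y (by have := h.lt_right; omega) le_rfl, ?_,
    fun z hz h1 h2 => ?_⟩
  · rw [orient_neg, ← orient_swap, orient_pos_iff pa.ne' hne ca.ne']
    have := rightAngle_pos (σ (v - 1)) (σ v) (σ y)
    exact Or.inl ⟨hs, by linarith⟩
  have := hn z hz
  rw [orient_neg, ← orient_swap] at h1 h2
  rw [orient_pos_iff pa.ne' hz.ne' ca.ne'] at h1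
  rw [orient_pos_iff pa.ne' hne hz.ne'] at h2
  have := rightAngle_pos (σ (v - 1)) (σ v) (σ y)
  have := rightAngle_pos (σ (v - 1)) (σ v) (σ (v + 1))
  have := rightAngle_le (σ (v - 1)) (σ v) z
  rcases h1 with h1 | h1 <;> rcases h2 with h2 | h2 <;> linarith

/-- No edge at the end `u` of the hull enters the last triangle of the fan. -/
theorem IsFanStep.not_enter {ε : ℝ} {v w u a : ℂ} (h : IsFanStep P o ℓ A ε v w u a u) {z : ℂ}
    (hz : A.Adj u z) (h1 : 0 < orient ε u w z) (h2 : 0 < orient ε u z a) : False := by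
  refine false_of_edge_into_free (A := A) (α := fun x => orient ε w a x)
    (β := fun x => orient ε w x u) (R := fun x => orient ε a u x)
    (orient_line _ _ _ _ _) (orient_line_mid _ _ _ _ _) (orient_line _ _ _ _ _)
    (Or.inl h.pos) (Or.inr ⟨by simp, by rwa [← orient_rot]⟩) (by simp)
    (by rwa [orient_rot]) hz h.free

/-- The part of the walk before `v` is the hull of the fan seen from `v + 1`. -/
theorem IsTwoChain.isFanStep_backward (hσ : IsBoundarySequence A m σ) (hA : IsMaximalPSLG P o ℓ A)
    (hP : GeneralPosition P) (hℓ : 0 < ℓ) (h : IsTwoChain P o ℓ A σ u v y) :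
    ∀ t, u < t → t ≤ v →
      IsFanStep P o ℓ A 1 (σ v) (σ (v + 1)) (σ u) (σ t) (σ (t - 1)) := by
  have hb := h.1.isFanBase_backward hσ hA h.2.convex
  have hA' := hA.prop.1
  obtain ⟨k, k0, hk, hstep⟩ := (hσ.isFanWalk_backward hA' hP h.1.convex).exists_end hℓ
    (Or.inl rfl) hP hA hb
  have hku : v - k = u := by
    rcases lt_trichotomy (v - k) u with hlt | heq | hgt
    · exfalso
      have hs := hstep (v - u).toNat (by omega)
      have := hs.pos_left
      have h1 := h.1.lt_left
      have e : v - ((v - u).toNat : ℤ) = u := by omega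
      simp only [e] at this
      simp at this
    · exact heq
    -- the hull ends at an earlier visit to the point `σ u`, whose next step is the one at `u`; then
    -- a period fits in between, and the copy of `v` one period before is a convex interior entry
    · exfalso
      obtain ⟨k, rfl⟩ : ∃ k', k = k' + 1 := ⟨k - 1, by omega⟩
      have hs := hstep k (by omega)
      rw [hk] at hs
      obtain ⟨-, hsec, -⟩ := h.1.visible
      unfold InSector at hsec
      have pa := hσ.adj_prev u
      have ca := hσ.adj u
      have hn := hσ.next u _ hs.adj.symm
      have hwu : σ (v + 1) ≠ σ u := (ne_of_orient hb.pos).2.2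
      have hpos := hs.pos
      rw [orient_rot, orient_rot, orient_pos_iff pa.ne' hwu hs.adj.ne] at hpos
      have heq : σ (u + 1) = σ (v - k) := by
        by_contra hne
        have hn := lt_of_le_of_ne hn fun h => hne (eq_of_rightAngle_eq hA' hP pa ca hs.adj.symm h)
        have := Real.pi_pos
        refine hs.not_enter ca ?_ ?_
        · rw [orient_pos_iff pa.ne' hwu ca.ne']
          left
          rcases hpos with hpos | hpos <;> constructor <;> linarith
        · rw [orient_pos_iff pa.ne' ca.ne' hs.adj.ne]
          left
          rcases hpos with hpos | hpos <;> constructor <;> linarith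
      have hm := hσ.le_of_eq hA' hP (i := u) (d := v - (k + 1 : ℕ) - u) (by omega)
        (by rw [← hk]; congr 1; ring) (by rw [heq]; congr 1; push_cast; ring)
      push_cast at hm hgt
      have hm0 := hσ.pos
      refine h.1.reflex (v - m) (by omega) (by omega) (by omega) ?_
      rw [← hσ.isConvex_add, sub_add_cancel]
      exact h.1.convex
  intro t h1 h2
  have := hstep (v - t).toNat (by omega)
  push_cast at this
  rwa [show v - ((v - t).toNat : ℤ) = t by omega,
    show v - (((v - t).toNat : ℤ) + 1) = t - 1 by omega] at this

/-- The part of the walk after `v + 1` is the hull of the fan seen from `v`. -/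
theorem IsTwoChain.isFanStep_forward (hσ : IsBoundarySequence A m σ) (hA : IsMaximalPSLG P o ℓ A)
    (hP : GeneralPosition P) (hℓ : 0 < ℓ) (h : IsTwoChain P o ℓ A σ u v y) :
    ∀ t, v + 1 ≤ t → t < y →
      IsFanStep P o ℓ A (-1) (σ (v + 1)) (σ v) (σ y) (σ t) (σ (t + 1)) := by
  have hb := h.2.isFanBase_forward hσ hA h.1.convex
  have hA' := hA.prop.1
  obtain ⟨k, k0, hk, hstep⟩ := (hσ.isFanWalk_forward hA' hP h.2.convex).exists_end hℓ
    (Or.inr rfl) hP hA hb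
  have hky : v + 1 + k = y := by
    rcases lt_trichotomy y (v + 1 + k) with hlt | heq | hgt
    · exfalso
      have hs := hstep (y - (v + 1)).toNat (by omega)
      have := hs.pos_left
      have h1 := h.2.lt_right
      have e : v + 1 + ((y - (v + 1)).toNat : ℤ) = y := by omega
      simp only [e] at this
      simp at this
    · exact heq.symm
    -- as before, with the previous step at `y`
    · exfalso
      obtain ⟨k, rfl⟩ : ∃ k', k = k' + 1 := ⟨k - 1, by omega⟩
      have hs := hstep k (by omega)
      rw [hk] at hs
      obtain ⟨-, -, hsec⟩ := h.2.visible
      unfold InSector at hsec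
      have pa := hσ.adj_prev y
      have ca := hσ.adj y
      have hn := hσ.next y _ hs.adj.symm
      have hvy : σ v ≠ σ y := (ne_of_orient hb.pos).2.2
      have hpos := hs.pos
      rw [orient_neg, ← orient_swap, orient_rot, orient_rot, orient_swap_left, ← orient_swap,
        orient_rot, orient_pos_iff pa.ne' hs.adj.ne hvy] at hpos
      have heq : σ (y - 1) = σ (v + 1 + k) := by
        by_contra hne
        have h2 : rightAngle (σ (y - 1)) (σ y) (σ (v + 1 + k)) ≠ 2 * Real.pi := by
          intro h
          rw [← rightAngle_self pa.ne'] at h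
          exact hne (eq_of_rightAngle_eq hA' hP pa hs.adj.symm pa h).symm
        have h2 := lt_of_le_of_ne (rightAngle_le _ _ _) h2
        have := rightAngle_pos (σ (y - 1)) (σ y) (σ v)
        refine hs.not_enter pa ?_ ?_
        · rw [orient_neg, ← orient_swap, ← rightAngle_lt_pi_iff pa.ne' hvy]
          rcases hpos with hpos | hpos <;> linarith
        · rw [orient_neg, ← orient_swap, orient_pos_iff pa.ne' hs.adj.ne pa.ne',
            rightAngle_self pa.ne']
          left
          rcases hpos with hpos | hpos <;> constructor <;> linarith
      have hm := hσ.le_of_eq hA' hP (i := v + 1 + k) (d := y - 1 - (v + 1 + k)) (by omega)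
        (by rw [← heq]; congr 1; ring) (by
          rw [show v + 1 + k + (y - 1 - (v + 1 + k)) + 1 = y by ring, ← hk]
          congr 1; push_cast; ring)
      have hm0 := hσ.pos
      refine h.2.reflex (v + 1 + m) (by omega) (by omega) (by omega) ?_
      rw [hσ.isConvex_add]
      exact h.2.convex
  intro t h1 h2
  have := hstep (t - (v + 1)).toNat (by omega)
  push_cast at this
  rwa [show v + 1 + ((t - (v + 1)).toNat : ℤ) = t by omega,
    show v + 1 + (((t - (v + 1)).toNat : ℤ) + 1) = t + 1 by omega] at this

end Walk

/-! ### The pocket between the two fans -/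

section Pocket

/-- Two fans over the same edge `v w`: the segments from `w` to `u` and from `v` to `y`, along which
the ends of the fans are seen, cross in `X`. -/
structure IsCrossing (P : Finset ℂ) (o : ℂ) (ℓ : ℝ) (A : SimpleGraph ℂ) (ε : ℝ)
    (v w u y X : ℂ) : Prop where
  left : IsFanBase P o ℓ A ε v w u
  right : IsFanBase P o ℓ A (-ε) w v y
  mem_left : X ∈ openSegment ℝ w u
  mem_right : X ∈ openSegment ℝ v y

/-- A fan whose hull is the path `s 0, …, s k` from `v` to `u`. -/
structure IsFanChain (P : Finset ℂ) (o : ℂ) (ℓ : ℝ) (A : SimpleGraph ℂ) (ε : ℝ) (v w u : ℂ)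
    (s : ℕ → ℂ) (k : ℕ) : Prop where
  zero : s 0 = v
  last : s k = u
  pos : 0 < k
  step : ∀ i < k, IsFanStep P o ℓ A ε v w u (s i) (s (i + 1))

/-- The vertex `h` comes first among the vertices in the cone at `X` between `u` and `y` when a ray
from `u` through `X` is rotated, and it lies in the triangle `X u y`. -/
structure IsFirstVertex (P : Finset ℂ) (ε : ℝ) (u y X h : ℂ) : Prop where
  mem : h ∈ P
  pos_left : 0 < orient ε X u h
  pos_right : 0 < orient ε X h y
  pos_base : 0 < orient ε u y h
  extremal : ∀ p ∈ P, 0 < orient ε X u p → 0 ≤ orient ε X p y → orient ε u h p ≤ 0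

variable {P : Finset ℂ} {o : ℂ} {ℓ : ℝ} {A : SimpleGraph ℂ} {ε : ℝ} {v w u y X h h' : ℂ}
  {s : ℕ → ℂ} {k : ℕ}

theorem IsCrossing.symm (hX : IsCrossing P o ℓ A ε v w u y X) :
    IsCrossing P o ℓ A (-ε) w v y u X :=
  ⟨hX.right, by rw [neg_neg]; exact hX.left, hX.mem_right, hX.mem_left⟩

/-- The two segments cross since `u` and `y` are visible, hence not in neighbouring cells. -/
theorem exists_isCrossing (hℓ : 0 < ℓ) (hε : ε = 1 ∨ ε = -1) (hP : GeneralPosition P)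
    (hA : IsMaximalPSLG P o ℓ A) (hu : IsFanBase P o ℓ A ε v w u)
    (hy : IsFanBase P o ℓ A (-ε) w v y) : ∃ X, IsCrossing P o ℓ A ε v w u y X := by
  have hε0 : ε ≠ 0 := by rcases hε with rfl | rfl <;> norm_num
  have hDy : 0 < orient ε w v y := by
    have := hy.pos
    rw [orient_neg, ← orient_swap_left] at this
    exact this
  obtain ⟨h1, h2⟩ := orient_pos_of_cells hℓ hε (hA.prop.2 _ _ hu.adj.symm) hu.mem_nbhd
    (hA.notMem_nbhd_of_disjoint hP (hA.prop.1.left_mem _ _ hu.adj) hu.mem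
      (ne_of_orient hu.pos).2.2 hu.disjoint) hy.mem_nbhd
    (hA.notMem_nbhd_of_disjoint hP (hA.prop.1.left_mem _ _ hy.adj) hy.mem
      (ne_of_orient hy.pos).2.2 hy.disjoint) hu.pos hDy
  have e1 : orient ε v y u < 0 := by rw [orient_swap]; linarith
  have e2 : 0 < orient ε v y w := by rw [← orient_rot]; exact hDy
  have e3 : orient ε w u v < 0 := by rw [orient_swap]; linarith [hu.pos]
  have hd : 0 < orient ε v y w - orient ε v y u := by linarith
  set t := orient ε v y w / (orient ε v y w - orient ε v y u) with ht
  have t0 : 0 < t := div_pos e2 hd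
  have t1 : t < 1 := by rw [ht, div_lt_one hd]; linarith
  have hX : orient ε v y ((1 - t) • w + t • u) = 0 := by
    rw [orient_line, ht]
    field_simp
    ring
  obtain ⟨l, hl⟩ := exists_smul_of_orient_eq_zero hε0 (ne_of_orient e2).1 hX
  have hl0 : (1 - l) * orient ε w u v + l * orient ε w u y = 0 := by
    rw [← orient_line, ← hl, orient_line]; simp
  have l0 : 0 < l := by
    by_contra hcon
    push Not at hcon
    have := mul_nonpos_of_nonpos_of_nonneg hcon h2.le
    have := mul_neg_of_pos_of_neg (show 0 < 1 - l by linarith) e3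
    linarith
  have l1 : l < 1 := by
    by_contra hcon
    push Not at hcon
    have := mul_pos l0 h2
    have := mul_nonneg_of_nonpos_of_nonpos (show 1 - l ≤ 0 by linarith) e3.le
    linarith
  exact ⟨_, hu, hy, ⟨1 - t, t, by linarith, t0, by ring, rfl⟩,
    ⟨1 - l, l, by linarith, l0, by ring, hl.symm⟩⟩

/-- Signs at the crossing point, as far as they do not depend on other points. -/
theorem IsCrossing.orient_pos (hX : IsCrossing P o ℓ A ε v w u y X) :
    0 < orient ε w v y ∧ 0 < orient ε v u y ∧ 0 < orient ε w u y ∧ 0 < orient ε X u y ∧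
      0 < orient ε w v X ∧ 0 < orient ε v u X := by
  obtain ⟨α, β, hα, hβ, hαβ, H⟩ := orient_of_mem_openSegment hX.mem_left
  obtain ⟨α', β', hα', hβ', hαβ', H'⟩ := orient_of_mem_openSegment hX.mem_right
  have h0 := hX.left.pos
  have h1 : 0 < orient ε w v y := by
    have := hX.right.pos
    rwa [orient_neg, ← orient_swap_left] at this
  have h2 : 0 < orient ε v u X := by
    rw [H, ← orient_rot]; simpa using mul_pos hα h0
  have h3 : 0 < orient ε v u y := by
    rw [H'] at h2
    simp only [orient_self_mid, mul_zero, zero_add] at h2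
    exact (mul_pos_iff_of_pos_left hβ').1 h2
  have h4 : 0 < orient ε w u y := by
    have e1 := H ε w u
    have e2 := H' ε w u
    rw [e1, orient_swap ε w v u] at e2
    simp only [orient_self_mid, orient_self_right, mul_zero, add_zero] at e2
    have := mul_pos hα' h0
    refine (mul_pos_iff_of_pos_left hβ').1 ?_
    linarith
  refine ⟨h1, h3, h4, ?_, ?_, h2⟩
  · rw [orient_rot, H, ← orient_rot]; simpa using mul_pos hα h4
  · rw [H]; simpa using mul_pos hβ h0

/-- The lines `X u` and `w u` coincide. -/
theorem IsCrossing.exists_left (hX : IsCrossing P o ℓ A ε v w u y X) :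
    ∃ α : ℝ, 0 < α ∧ ∀ ε z, orient ε X u z = α * orient ε w u z := by
  obtain ⟨α, β, hα, hβ, hαβ, H⟩ := orient_of_mem_openSegment hX.mem_left
  refine ⟨α, hα, fun ε z => ?_⟩
  rw [orient_rot, H, ← orient_rot]
  simp

/-- The lines `X y` and `v y` coincide. -/
theorem IsCrossing.exists_right (hX : IsCrossing P o ℓ A ε v w u y X) :
    ∃ α : ℝ, 0 < α ∧ ∀ ε z, orient ε X z y = α * orient ε v z y := by
  obtain ⟨α, hα, H⟩ := hX.symm.exists_left
  exact ⟨α, hα, fun ε z => by rw [orient_swap, H, orient_swap ε v z]; ring⟩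

theorem IsCrossing.notMem_drawing (hX : IsCrossing P o ℓ A ε v w u y X) : X ∉ drawing P A :=
  Set.disjoint_left.1 hX.left.disjoint hX.mem_left

theorem IsCrossing.disjoint_left (hX : IsCrossing P o ℓ A ε v w u y X) :
    Disjoint (openSegment ℝ X u) (drawing P A) := by
  refine hX.left.disjoint.mono_left ?_
  have h := (convex_openSegment w u (𝕜 := ℝ))
  intro z hz
  obtain ⟨a, b, ha, hb, hab, rfl⟩ := hz
  obtain ⟨α, β, hα, hβ, hαβ, rfl⟩ := hX.mem_left
  refine ⟨a * α, a * β + b, by positivity, by positivity, ?_, ?_⟩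
  · rw [← add_assoc, ← mul_add, hαβ, mul_one, hab]
  · module

theorem IsFirstVertex.orient_nonpos_right (h : IsFirstVertex P ε u y X h') :
    orient ε u h' y ≤ 0 := by
  rw [orient_swap]; linarith [h.pos_base]

/-- If there is a vertex in the pocket, off the side `u y`, then there is a first one. -/
theorem IsCrossing.exists_isFirstVertex (hX : IsCrossing P o ℓ A ε v w u y X)
    (hP : GeneralPosition P) (hε : ε ≠ 0) (hA : IsPSLG P A) {z : ℂ} (hz : z ∈ P)
    (h1 : 0 ≤ orient ε X u z) (h2 : 0 ≤ orient ε X z y) (h3 : 0 < orient ε u y z) :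
    ∃ h, IsFirstVertex P ε u y X h := by
  classical
  obtain ⟨α, hα, H⟩ := hX.exists_left
  obtain ⟨α', hα', H'⟩ := hX.exists_right
  obtain ⟨e1, e2, e3, e4, -, -⟩ := hX.orient_pos
  have huP := hX.left.mem
  have hyP := hX.right.mem
  have hwP := hA.left_mem _ _ hX.left.adj
  have hvP := hA.left_mem _ _ hX.right.adj
  have hz1 : 0 < orient ε X u z := by
    refine h1.lt_of_ne fun h0 => ?_
    rw [H, eq_comm, mul_eq_zero, or_iff_right hα.ne'] at h0
    rcases hP.eq_of_orient hε hwP huP hz h0 (ne_of_orient e3).1 with rfl | rfl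
    · rw [H', orient_swap_left] at h2
      have := mul_pos hα' e1
      linarith
    · simp at h3
  obtain ⟨h, hh, hext⟩ := exists_first_by_angle
    (C := P.filter fun p => 0 < orient ε X u p ∧ 0 ≤ orient ε X p y) (ε := ε) (w := X) (t := u)
    ⟨y, by simp [hyP, e4]⟩ (fun p hp => (Finset.mem_filter.1 hp).2.1)
  obtain ⟨hhP, hh1, hh2⟩ := Finset.mem_filter.1 hh
  have hext' : ∀ p ∈ P, 0 < orient ε X u p → 0 ≤ orient ε X p y → orient ε u h p ≤ 0 :=
    fun p hp h1 h2 => hext p (Finset.mem_filter.2 ⟨hp, h1, h2⟩)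
  have hhy : h ≠ y := by
    rintro rfl
    linarith [hext' z hz hz1 h2]
  have hpr : 0 < orient ε X h y := by
    refine hh2.lt_of_ne fun h0 => ?_
    rw [H', eq_comm, mul_eq_zero, or_iff_right hα'.ne', orient_swap, neg_eq_zero] at h0
    rcases hP.eq_of_orient hε hvP hyP hhP h0 (ne_of_orient e1).2.1 with h | h
    · rw [H, h, orient_swap] at hh1
      have := mul_pos hα hX.left.pos
      linarith
    · exact hhy h
  refine ⟨h, hhP, hh1, hpr, ?_, hext'⟩
  have h5 := hext' y hyP e4 (by simp)
  rw [orient_swap] at h5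
  refine (show 0 ≤ orient ε u y h by linarith).lt_of_ne fun h0 => ?_
  rcases hP.eq_of_orient hε huP hyP hhP h0.symm (ne_of_orient e4).2.1 with h | h
  · exact (ne_of_orient hh1).2.1 h.symm
  · exact hhy h

/-- No edge enters the part of the pocket before the line through `u` and the first vertex. -/
theorem IsCrossing.free (hX : IsCrossing P o ℓ A ε v w u y X) (hε : ε ≠ 0) (hA : IsPSLG P A)
    (hh : IsFirstVertex P ε u y X h) :
    ∀ p q z, A.Adj p q → z ∈ segment ℝ p q → 0 < orient ε X u z → 0 < orient ε X z y →
      orient ε u h z ≤ 0 := by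
  intro p q z hpq hz h1 h2
  refine hA.free_cone hε hX.orient_pos.2.2.2.1 (by simp) hh.orient_nonpos_right
    (by rw [← orient_rot]; exact hh.pos_left) (unblocked_of_disjoint ε hX.disjoint_left)
    (unblocked_of_disjoint ε hX.symm.disjoint_left) ?_ ?_
    (fun p hp h1 h2 => hh.extremal p hp h1 h2.le) hpq hz h1 h2
  · exact fun p q hpq hz => (hX.notMem_drawing (Or.inr ⟨p, q, hpq, hz⟩)).elim
  · exact fun z hz _ _ => (hX.notMem_drawing (Or.inl (hA.left_mem _ _ hz))).elim

/-- If `u` is not joined to the first vertex, it is not in a neighbouring cell either. -/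
theorem IsCrossing.notMem_nbhd_of_not_adj (hX : IsCrossing P o ℓ A ε v w u y X) (hε : ε ≠ 0)
    (hP : GeneralPosition P) (hA : IsMaximalPSLG P o ℓ A) (hh : IsFirstVertex P ε u y X h)
    (huh : ¬ A.Adj u h) : u ∉ nbhd o ℓ h := by
  intro hN
  have hne : u ≠ h := (ne_of_orient hh.pos_left).2.1
  refine huh (hA.adj_of_unblocked hP hX.left.mem hh.mem hne (mem_nbhd_comm.1 hN)
    fun p q hpq z hz hz' => ?_)
  refine hA.prop.1.eq_of_far_side hP hε (x := X) (a := u) (b := y) (hX.free hε hA.prop.1 hh)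
    hX.left.mem hh.mem hne hpq hz hz' ?_ ?_
  · obtain ⟨s, t, hs, ht, hst, H⟩ := orient_of_mem_openSegment hz
    rw [H]; simpa using mul_pos ht hh.pos_left
  · obtain ⟨s, t, hs, ht, hst, rfl⟩ := hz
    obtain rfl : s = 1 - t := by linarith
    rw [orient_line_mid]
    have := mul_pos hs hX.orient_pos.2.2.2.1
    have := mul_pos ht hh.pos_right
    linarith

theorem IsFirstVertex.pos_of_nonneg {c d : ℂ} (hh : IsFirstVertex P ε u y X h)
    (hX : IsCrossing P o ℓ A ε v w u y X) (h1 : 0 < orient ε c d X)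
    (h2 : 0 ≤ orient ε c d u) (h3 : 0 ≤ orient ε c d y) : 0 < orient ε c d h := by
  have key : orient ε X u y * orient ε c d h = orient ε u y h * orient ε c d X +
      orient ε X h y * orient ε c d u + orient ε X u h * orient ε c d y := by
    unfold orient; ring
  have := mul_pos hh.pos_base h1
  have := mul_nonneg hh.pos_right.le h2
  have := mul_nonneg hh.pos_left.le h3
  refine (mul_pos_iff_of_pos_left hX.orient_pos.2.2.2.1).1 ?_
  linarith

theorem IsFirstVertex.pos_base_edge (hh : IsFirstVertex P ε u y X h)
    (hX : IsCrossing P o ℓ A ε v w u y X) : 0 < orient ε w v h :=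
  hh.pos_of_nonneg hX hX.orient_pos.2.2.2.2.1 hX.left.pos.le hX.orient_pos.1.le

theorem IsFirstVertex.pos_diagonal (hh : IsFirstVertex P ε u y X h)
    (hX : IsCrossing P o ℓ A ε v w u y X) : 0 < orient ε v u h :=
  hh.pos_of_nonneg hX hX.orient_pos.2.2.2.2.2 (by simp) hX.orient_pos.2.1.le

theorem IsFirstVertex.pos_line (hh : IsFirstVertex P ε u y X h)
    (hX : IsCrossing P o ℓ A ε v w u y X) : 0 < orient ε w u h := by
  obtain ⟨α, hα, H⟩ := hX.exists_left
  have := hh.pos_left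
  rw [H] at this
  exact (mul_pos_iff_of_pos_left hα).1 this

theorem IsFanChain.nonneg_base (hs : IsFanChain P o ℓ A ε v w u s k) {i : ℕ} (hi : i ≤ k) :
    0 ≤ orient ε w v (s i) := by
  rcases i with _ | i
  · rw [hs.zero]; simp
  · exact (hs.step i (by omega)).pos_base.le

/-- The first vertex is seen from `w` beyond every vertex of the hull. -/
theorem IsFirstVertex.pos_hull (hh : IsFirstVertex P ε u y X h)
    (hX : IsCrossing P o ℓ A ε v w u y X) (hs : IsFanChain P o ℓ A ε v w u s k) {i : ℕ}
    (hi : i < k) : 0 < orient ε w (s i) h := by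
  have key := orient_pluecker ε w v (s i) u h
  have h1 := mul_nonneg (hs.nonneg_base hi.le) (hh.pos_line hX).le
  have h2 := mul_pos (hh.pos_base_edge hX) (hs.step i hi).pos_left
  refine (mul_pos_iff_of_pos_left hX.left.pos).1 ?_
  linarith

/-- The line through the last edge of the hull leaves the first vertex on the side of the
pocket. -/
theorem IsFirstVertex.pos_last (hh : IsFirstVertex P ε u y X h)
    (hX : IsCrossing P o ℓ A ε v w u y X) (hs : IsFanChain P o ℓ A ε v w u s (k + 1)) :
    0 < orient ε (s k) u h := by
  have hk := hs.step k (by omega)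
  have h1 := hk.base_left u hX.left.mem hk.pos_left (by simp)
  rw [orient_swap] at h1
  have key : orient ε w v u * orient ε (s k) u h =
      orient ε v u (s k) * orient ε w u h + orient ε w (s k) u * orient ε v u h := by
    unfold orient; ring
  have := mul_nonneg (show 0 ≤ orient ε v u (s k) by linarith) (hh.pos_line hX).le
  have := mul_pos hk.pos_left (hh.pos_diagonal hX)
  refine (mul_pos_iff_of_pos_left hX.left.pos).1 ?_
  linarith

/-- The first edge of the hull has `y` on the side of the pocket. -/
theorem IsFanChain.pos_first (hs : IsFanChain P o ℓ A ε v w u s k)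
    (hX : IsCrossing P o ℓ A ε v w u y X) (hε : ε ≠ 0) (hP : GeneralPosition P)
    (hA : IsMaximalPSLG P o ℓ A) : 0 < orient ε v (s 1) y := by
  have h0 := hs.step 0 hs.pos
  rw [zero_add, hs.zero] at h0
  have hsec := hX.right.sector (s 1) h0.adj
  rw [orient_neg, orient_neg, ← orient_swap, ← orient_swap] at hsec
  have h1 : 0 < orient ε v (s 1) w := by rw [← orient_rot]; exact h0.pos
  have h2 : 0 ≤ orient ε v (s 1) y := by
    by_contra hcon
    push Not at hcon
    refine hsec h1 ?_
    rw [orient_swap]; linarith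
  refine h2.lt_of_ne fun h3 => ?_
  have hvP := hA.prop.1.left_mem _ _ h0.adj
  rcases hP.eq_of_orient hε hvP (hA.prop.1.right_mem h0.adj) hX.right.mem h3.symm h0.adj.ne
    with h | h
  · exact (ne_of_orient hX.right.pos).2.2 h.symm
  · refine hA.notMem_nbhd_of_disjoint hP hvP hX.right.mem (ne_of_orient hX.right.pos).2.2
      hX.right.disjoint ?_
    rw [h]
    exact h0.mem_nbhd

/-- Every edge of the hull has `X` on its inner side. -/
theorem IsFanChain.pos_crossing (hs : IsFanChain P o ℓ A ε v w u s k)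
    (hX : IsCrossing P o ℓ A ε v w u y X) (hε : ε ≠ 0) (hP : GeneralPosition P)
    (hA : IsMaximalPSLG P o ℓ A) {i : ℕ} (hi : i < k) : 0 < orient ε (s i) (s (i + 1)) X := by
  induction i with
  | zero =>
    obtain ⟨α', β', hα', hβ', hαβ', H'⟩ := orient_of_mem_openSegment hX.mem_right
    have := hs.pos_first hX hε hP hA
    rw [zero_add, hs.zero, H']
    simpa using mul_pos hβ' this
  | succ i ih =>
    have ih := ih (by omega)
    have h1 := hs.step i (by omega)
    have h2 := hs.step (i + 1) hi
    obtain ⟨α, β, hα, hβ, hαβ, H⟩ := orient_of_mem_openSegment hX.mem_left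
    have e1 : 0 < orient ε w (s (i + 1)) X := by
      rw [H]; simpa using mul_pos hβ h2.pos_left
    have e2 : orient ε (s i) (s (i + 1)) (s (i + 2)) ≤ 0 := by
      refine h1.extremal _ (hA.prop.1.right_mem h2.adj) ?_ h2.nonneg_right
      have h3 := orient_pluecker ε w (s i) (s (i + 1)) (s (i + 2)) u
      have := mul_pos h1.pos_left h2.pos
      have := mul_nonneg h1.pos.le h2.nonneg_right
      refine pos_of_mul_pos_left (b := orient ε w (s (i + 1)) u) ?_ h1.nonneg_right
      linarith
    have key : orient ε w (s i) (s (i + 1)) * orient ε (s (i + 1)) (s (i + 2)) X =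
        orient ε w (s (i + 1)) (s (i + 2)) * orient ε (s i) (s (i + 1)) X -
          orient ε (s i) (s (i + 1)) (s (i + 2)) * orient ε w (s (i + 1)) X := by
      unfold orient; ring
    have := mul_pos h2.pos ih
    have := mul_nonpos_of_nonpos_of_nonneg e2 e1.le
    refine (mul_pos_iff_of_pos_left h1.pos).1 ?_
    linarith

/-- The vertices of the fan lie beyond the line `v y`. -/
theorem IsFanChain.orient_nonpos (hs : IsFanChain P o ℓ A ε v w u s k)
    (hX : IsCrossing P o ℓ A ε v w u y X) (hε : ε ≠ 0) (hP : GeneralPosition P)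
    (hA : IsMaximalPSLG P o ℓ A) {i : ℕ} (hi : i < k) : orient ε v y (s i) ≤ 0 := by
  rcases i with _ | i
  · rw [hs.zero]; simp
  have h0 := hs.step 0 hs.pos
  have hi0 := hs.step i (by omega)
  have hi1 := hs.step (i + 1) hi
  rw [zero_add, hs.zero] at h0
  have h1 := h0.extremal _ (hA.prop.1.left_mem _ _ hi1.adj) hi0.pos_base hi1.pos_left.le
  have h2 := hs.pos_first hX hε hP hA
  have key : orient ε w v (s 1) * orient ε v y (s (i + 1)) =
      orient ε v (s 1) (s (i + 1)) * orient ε w v y -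
        orient ε v (s 1) y * orient ε w v (s (i + 1)) := by
    unfold orient; ring
  have := mul_nonpos_of_nonpos_of_nonneg h1 hX.orient_pos.1.le
  have := mul_pos h2 hi0.pos_base
  by_contra hcon
  push Not at hcon
  have := mul_pos h0.pos hcon
  linarith

/-- A vertex of the hull sees the first vertex if the next edge of the hull does not hide it. -/
theorem IsFanChain.disjoint (hs : IsFanChain P o ℓ A ε v w u s k)
    (hX : IsCrossing P o ℓ A ε v w u y X) (hε : ε ≠ 0) (hP : GeneralPosition P)
    (hA : IsMaximalPSLG P o ℓ A) (hh : IsFirstVertex P ε u y X h) {i : ℕ} (hi : i < k)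
    (hpos : 0 < orient ε (s i) (s (i + 1)) h) :
    Disjoint (openSegment ℝ (s i) h) (drawing P A) := by
  have hA' := hA.prop.1
  have hst := hs.step i hi
  have hside := hs.orient_nonpos hX hε hP hA hi
  have hah := hh.pos_hull hX hs hi
  obtain ⟨α, hα, H⟩ := hX.exists_left
  obtain ⟨α', hα', H'⟩ := hX.exists_right
  generalize s i = a at *
  generalize s (i + 1) = b at *
  have hau := hst.pos_left
  have hwuh := hh.pos_line hX
  have habu := hst.extremal u hX.left.mem hau (by simp)
  have habw : 0 < orient ε a b w := by rw [← orient_rot]; exact hst.pos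
  -- the point where the segment leaves the fan lies between `w` and `u`
  have hcross : ∀ t : ℝ, 0 < t → t < 1 → orient ε w u ((1 - t) • a + t • h) = 0 →
      ∃ l : ℝ, 0 < l ∧ l < 1 ∧ (1 - t) • a + t • h = (1 - l) • w + l • u := by
    intro t t0 t1 h0
    obtain ⟨l, hl⟩ := exists_smul_of_orient_eq_zero hε (ne_of_orient hau).2.2 h0
    refine ⟨l, ?_, ?_, hl⟩
    · have e : t * orient ε w a h = l * orient ε w a u := by
        have := orient_line ε w a a h t
        rw [hl, orient_line] at this
        simpa using this.symm
      have := mul_pos t0 hah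
      rw [e] at this
      exact (mul_pos_iff_of_pos_right hau).1 this
    · by_contra hcon
      push Not at hcon
      have e : t * orient ε a b h = (1 - l) * orient ε a b w + l * orient ε a b u := by
        have := orient_line ε a b a h t
        rw [hl, orient_line] at this
        simpa using this.symm
      have := mul_pos t0 hpos
      have := mul_nonpos_of_nonpos_of_nonneg (show 1 - l ≤ 0 by linarith) habw.le
      have := mul_nonpos_of_nonneg_of_nonpos (show 0 ≤ l by linarith) habu
      linarith
  have huha : 0 < orient ε u h a := by
    have hd : 0 < orient ε w a u + orient ε w u h := by linarith
    set t := orient ε w a u / (orient ε w a u + orient ε w u h) with ht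
    have t0 : 0 < t := div_pos hau hd
    have t1 : t < 1 := by rw [ht, div_lt_one hd]; linarith
    obtain ⟨l, l0, l1, hl⟩ := hcross t t0 t1 (by
      rw [orient_line, orient_swap ε w a u, ht]
      field_simp
      ring)
    have e : (1 - t) * orient ε u h a = (1 - l) * orient ε w u h := by
      have := orient_line ε u h a h t
      rw [hl, orient_line] at this
      rw [orient_rot ε w u h]
      simpa using this.symm
    have := mul_pos (show 0 < 1 - l by linarith) hwuh
    rw [← e] at this
    exact (mul_pos_iff_of_pos_left (by linarith)).1 this
  refine Set.disjoint_left.2 fun z hz hzd => ?_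
  obtain ⟨r, t, hr, ht, hrt, rfl⟩ := hz
  obtain rfl : r = 1 - t := by linarith
  rcases lt_trichotomy (orient ε w u ((1 - t) • a + t • h)) 0 with h0 | h0 | h0
  · have h1 : 0 < orient ε w a ((1 - t) • a + t • h) := by
      rw [orient_line]; simpa using mul_pos ht hah
    have h2 : 0 < orient ε w ((1 - t) • a + t • h) u := by rw [orient_swap]; linarith
    have h3 : 0 < orient ε a b ((1 - t) • a + t • h) := by
      rw [orient_line]; simpa using mul_pos ht hpos
    rcases hzd with hzP | ⟨p, q, hpq, hz⟩
    · linarith [hst.extremal _ hzP h1 h2.le]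
    · linarith [hst.free _ _ _ hpq hz h1 h2]
  · obtain ⟨l, l0, l1, hl⟩ := hcross t ht (by linarith) h0
    rw [hl] at hzd
    exact Set.disjoint_left.1 hX.left.disjoint ⟨1 - l, l, by linarith, l0, by ring, rfl⟩ hzd
  · have h1 : 0 < orient ε X u ((1 - t) • a + t • h) := by rw [H]; exact mul_pos hα h0
    have h2 : 0 < orient ε X ((1 - t) • a + t • h) y := by
      rw [H', orient_swap, orient_line]
      have e1 := hh.pos_right
      rw [H', orient_swap, mul_neg] at e1
      have e2 : α' * (t * orient ε v y h) < 0 := by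
        have := mul_pos ht e1
        linarith
      have e3 := mul_nonpos_of_nonneg_of_nonpos (mul_nonneg hα'.le hr.le) hside
      linarith
    have h3 : 0 < orient ε u h ((1 - t) • a + t • h) := by
      rw [orient_line]; simpa using mul_pos hr huha
    rcases hzd with hzP | ⟨p, q, hpq, hz⟩
    · linarith [hh.extremal _ hzP h1 h2.le]
    · linarith [hX.free hε hA' hh _ _ _ hpq hz h1 h2]

/-- The first vertex `h` is outside `N(v)`: some vertex of the hull sees it, and one of this vertex
and `u` would be joined to it. -/
theorem IsFanChain.notMem_nbhd (hs : IsFanChain P o ℓ A ε v w u s k)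
    (hX : IsCrossing P o ℓ A ε v w u y X) (hℓ : 0 < ℓ) (hε : ε = 1 ∨ ε = -1)
    (hP : GeneralPosition P) (hA : IsMaximalPSLG P o ℓ A) (hh : IsFirstVertex P ε u y X h)
    (huh : ¬ A.Adj u h) : h ∉ nbhd o ℓ v := by
  classical
  intro hN
  have hε0 : ε ≠ 0 := by rcases hε with rfl | rfl <;> norm_num
  have hA' := hA.prop.1
  have hex : ∃ i, i < k ∧ 0 < orient ε (s i) (s (i + 1)) h := by
    obtain ⟨j, rfl⟩ : ∃ j, k = j + 1 := ⟨k - 1, by have := hs.pos; omega⟩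
    exact ⟨j, by omega, by rw [hs.last]; exact hh.pos_last hX hs⟩
  obtain ⟨hik, hi⟩ := Nat.find_spec hex
  have hmin : ∀ j < Nat.find hex, ¬ (j < k ∧ 0 < orient ε (s j) (s (j + 1)) h) :=
    fun j hj => Nat.find_min hex hj
  generalize Nat.find hex = i at *
  have hdis := hs.disjoint hX hε0 hP hA hh hik hi
  have hst := hs.step i hik
  have hiP := hA'.left_mem _ _ hst.adj
  have hne : s i ≠ h := (ne_of_orient hi).2.2
  have hnot := hA.notMem_nbhd_of_disjoint hP hiP hh.mem hne hdis
  rcases i with _ | i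
  · rw [hs.zero] at hnot
    exact hnot hN
  have hp := hs.step i (by omega)
  have hneg := hmin i (by omega)
  rw [not_and, not_lt] at hneg
  have hneg := hneg (by omega)
  have hvP := hA'.left_mem _ _ hX.right.adj
  have hvi : v ≠ s (i + 1) := (ne_of_orient hp.pos_base).2.1
  have h1 : orient ε v (s (i + 1)) h ≤ 0 := by
    have key : orient ε w (s i) (s (i + 1)) * orient ε v (s (i + 1)) h =
        orient ε w (s (i + 1)) h * orient ε v (s i) (s (i + 1)) +
          orient ε w v (s (i + 1)) * orient ε (s i) (s (i + 1)) h := by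
      unfold orient; ring
    have := mul_nonpos_of_nonneg_of_nonpos (hh.pos_hull hX hs hik).le
      (hp.base_left _ hiP hp.pos hp.nonneg_right)
    have := mul_nonpos_of_nonneg_of_nonpos hp.pos_base.le hneg
    by_contra hcon
    push Not at hcon
    have := mul_pos hp.pos hcon
    linarith
  have h2 : orient ε v (s (i + 1)) u < 0 := by
    refine (hst.base_left u hX.left.mem hst.pos_left (by simp)).lt_of_ne fun h0 => ?_
    rcases hP.eq_of_orient hε0 hvP hiP hX.left.mem h0 hvi with h | h
    · exact (ne_of_orient hX.left.pos).2.1 h.symm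
    · exact (ne_of_orient hst.pos_left).2.1 h.symm
  have hwP := hA'.left_mem _ _ hX.left.adj
  rcases mem_nbhd_of_hidden hℓ hε (hA.prop.2 _ _ hX.right.adj) hX.left.mem_nbhd
    (hA.notMem_nbhd_of_disjoint hP hwP hX.left.mem (ne_of_orient hX.left.pos).2.2
      hX.left.disjoint) hp.mem_nbhd hp.notMem_nbhd hX.left.pos hp.pos_base hN
    (hh.pos_diagonal hX) (by rw [orient_swap]; linarith) (by rw [orient_swap]; linarith) with h | h
  · exact hX.notMem_nbhd_of_not_adj hε0 hP hA hh huh h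
  · exact hnot (mem_nbhd_comm.1 h)

theorem IsCrossing.mem_nbhd (hX : IsCrossing P o ℓ A ε v w u y X) (hℓ : 0 < ℓ)
    (hA : IsMaximalPSLG P o ℓ A) : X ∈ nbhd o ℓ v :=
  (convex_nbhd hℓ v).openSegment_subset (hA.prop.2 _ _ hX.right.adj) hX.left.mem_nbhd hX.mem_left

/-- Seen from `X`, the first vertex at `u` comes before the first vertex at `y`, and it is in the
triangle spanned by `X`, `u` and the latter. -/
theorem IsFirstVertex.mem_nbhd (hh : IsFirstVertex P ε u y X h)
    (hX : IsCrossing P o ℓ A ε v w u y X) (hℓ : 0 < ℓ) (hA : IsMaximalPSLG P o ℓ A)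
    (hh' : IsFirstVertex P (-ε) y u X h') (hN : h' ∈ nbhd o ℓ v) : h ∈ nbhd o ℓ v := by
  obtain ⟨hP', l', r', b', ext'⟩ := hh'
  rw [orient_neg, ← orient_swap] at l' r'
  rw [orient_neg, ← orient_swap_left] at b'
  have h1 := hh.extremal h' hP' r' l'.le
  have h2 := ext' h hh.mem (by rw [orient_neg, ← orient_swap]; exact hh.pos_right)
    (by rw [orient_neg, ← orient_swap]; exact hh.pos_left.le)
  rw [orient_neg] at h2
  have hT := hX.orient_pos.2.2.2.1
  have e1 : orient ε X u y * orient ε u h h' =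
      orient ε X u h * orient ε u y h' - orient ε u y h * orient ε X u h' := by
    unfold orient; ring
  have e2 : orient ε X u y * orient ε y h' h =
      orient ε u y h' * orient ε X h y - orient ε X h' y * orient ε u y h := by
    unfold orient; ring
  have e3 : orient ε X u y * orient ε X h h' =
      orient ε X h y * orient ε X u h' - orient ε X u h * orient ε X h' y := by
    unfold orient; ring
  have f1 : orient ε X u h * orient ε u y h' ≤ orient ε u y h * orient ε X u h' := by
    have := mul_nonpos_of_nonneg_of_nonpos hT.le h1
    linarith
  have f2 : orient ε X h' y * orient ε u y h ≤ orient ε u y h' * orient ε X h y := by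
    have := mul_nonneg hT.le (show 0 ≤ orient ε y h' h by linarith)
    linarith
  have f3 : 0 ≤ orient ε X h h' := by
    have g1 := mul_le_mul f1 f2 (mul_nonneg l'.le hh.pos_base.le)
      (mul_nonneg hh.pos_base.le r'.le)
    have g2 : 0 < orient ε u y h * orient ε u y h' := mul_pos hh.pos_base b'
    have g3 : orient ε X u h * orient ε X h' y ≤ orient ε X h y * orient ε X u h' := by
      refine le_of_mul_le_mul_left ?_ g2
      linarith
    by_contra hcon
    push Not at hcon
    have := mul_neg_of_pos_of_neg hT hcon
    linarith
  exact mem_of_convex_of_orient (convex_nbhd hℓ v) (hX.mem_nbhd hℓ hA) hX.left.mem_nbhd hN r'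
    hh.pos_left.le f3 (by rw [orient_swap]; linarith)

/-- The pocket contains no vertex, unless an end of one of the fans is joined to the first vertex
of the pocket. -/
theorem IsCrossing.adj_or_adj (hX : IsCrossing P o ℓ A ε v w u y X) (hℓ : 0 < ℓ)
    (hε : ε = 1 ∨ ε = -1) (hP : GeneralPosition P) (hA : IsMaximalPSLG P o ℓ A)
    {s' : ℕ → ℂ} {k' : ℕ} (hs : IsFanChain P o ℓ A ε v w u s k)
    (hs' : IsFanChain P o ℓ A (-ε) w v y s' k') (hh : IsFirstVertex P ε u y X h)
    (hh' : IsFirstVertex P (-ε) y u X h') : A.Adj u h ∨ A.Adj y h' := by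
  by_contra hcon
  push Not at hcon
  obtain ⟨huh, hyh⟩ := hcon
  have hε0 : ε ≠ 0 := by rcases hε with rfl | rfl <;> norm_num
  have hε' : -ε = 1 ∨ -ε = -1 := by rcases hε with rfl | rfl <;> simp
  have hA' := hA.prop.1
  have a1 := hs.notMem_nbhd hX hℓ hε hP hA hh huh
  have a2 := hs'.notMem_nbhd hX.symm hℓ hε' hP hA hh' hyh
  have a3 : h' ∉ nbhd o ℓ v := fun hN => a1 (hh.mem_nbhd hX hℓ hA hh' hN)
  have a4 : h ∉ nbhd o ℓ w := fun hN =>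
    a2 (hh'.mem_nbhd hX.symm hℓ hA (by rwa [neg_neg]) hN)
  have hull : ∀ p, 0 ≤ orient ε X u p → 0 ≤ orient ε X p y → 0 ≤ orient ε u y p →
      p ∈ convexHull ℝ {u, X, y} := fun p h1 h2 h3 =>
    mem_of_convex_of_orient (convex_convexHull ℝ _) (subset_convexHull ℝ _ (by simp))
      (subset_convexHull ℝ _ (by simp)) (subset_convexHull ℝ _ (by simp)) hX.orient_pos.2.2.2.1
      h1 h2 h3
  have d1 := hh'.pos_base_edge hX.symm
  have d2 := hX.symm.notMem_nbhd_of_not_adj (neg_ne_zero.2 hε0) hP hA hh' hyh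
  obtain ⟨-, l', r', b', -⟩ := hh'
  rw [orient_neg, ← orient_swap] at l' r'
  rw [orient_neg, ← orient_swap_left] at b' d1
  have hwP := hA'.left_mem _ _ hX.left.adj
  have hvP := hA'.left_mem _ _ hX.right.adj
  refine false_of_corner hℓ hε (hA.prop.2 _ _ hX.right.adj) hX.left.mem_nbhd
    (hA.notMem_nbhd_of_disjoint hP hwP hX.left.mem (ne_of_orient hX.left.pos).2.2
      hX.left.disjoint) hX.right.mem_nbhd (hX.mem_nbhd hℓ hA) (hX.symm.mem_nbhd hℓ hA)
    (hull h hh.pos_left.le hh.pos_right.le hh.pos_base.le) (hull h' r'.le l'.le b'.le) a1 a4 a3 a2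
    (hh.pos_base_edge hX) d1 (hX.notMem_nbhd_of_not_adj hε0 hP hA hh huh) d2

end Pocket

/-! ### What the algorithm guarantees at the ends of a 2-chain -/

section Run

variable {P : Finset ℂ} {o : ℂ} {ℓ : ℝ} {A : SimpleGraph ℂ} {m : ℕ} {σ : ℤ → ℂ}
  {j p c e u v y : ℤ}

/-- If no entry is a backward support vertex, a single convex entry forces all to be convex. -/
theorem IsBoundarySequence.isConvex_of_forall (hσ : IsBoundarySequence A m σ)
    (h : ∀ k, ¬ IsBackwardSupport σ k) (hv : IsConvex σ v) (t : ℤ) : IsConvex σ t := by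
  by_contra ht
  have hper : ∀ n : ℕ, IsConvex σ (v - n * m) := by
    intro n
    induction n with
    | zero => simpa using hv
    | succ n ih =>
      rw [← hσ.isConvex_add]
      convert ih using 1
      push_cast
      ring
  obtain ⟨b, ⟨hb1, hb2⟩, hb3⟩ := Int.exists_greatest_of_bdd (P := fun b => b < t ∧ IsConvex σ b)
    ⟨t, fun z hz => hz.1.le⟩ ⟨v - ((v - t).toNat + 1 : ℕ) * m, by
      have h1 : (1 : ℤ) ≤ m := by exact_mod_cast hσ.pos
      have h2 : v - t ≤ ((v - t).toNat : ℤ) := Int.self_le_toNat _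
      have h3 : (0 : ℤ) ≤ ((v - t).toNat : ℤ) := by positivity
      push_cast
      nlinarith, hper _⟩
  refine h (b - 1) ⟨t, ht, ?_⟩
  rw [sub_add_cancel]
  refine ⟨hb1, hb2, fun r h1 h2 h3 => ?_⟩
  have := hb3 r ⟨h2, h3⟩
  omega

theorem IsForwardConvex.unique {c' : ℤ} (h : IsForwardConvex σ p c) (h' : IsForwardConvex σ p c') :
    c = c' := by
  rcases lt_trichotomy c c' with hlt | heq | hgt
  · exact absurd h.2.1 (h'.2.2 c h.1 hlt)
  · exact heq
  · exact absurd h'.2.1 (h.2.2 c' h'.1 hgt)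

theorem Extends.reflex {s : ℤ} (h : Extends P o ℓ A σ c s) : IsReflex σ s :=
  h.2.1 s h.1 le_rfl

theorem BasicChain.lt (h : BasicChain P o ℓ A σ p e) : p < e := by
  rcases h with ⟨c, hc, ⟨-, he, -⟩ | ⟨-, he⟩⟩ | ⟨-, he⟩
  · have := hc.1.1
    have := he.1
    omega
  · have := hc.1.1
    omega
  · omega

theorem Processed.lt (hm : 0 < m) (h : Processed P o ℓ A m σ j u) : u < j + m := by
  cases h with
  | start => omega
  | step p e _ _ h => exact h

theorem IsTwoChain.isForwardConvex (h : IsTwoChain P o ℓ A σ u v y) : IsForwardConvex σ u v :=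
  ⟨h.1.lt_left, h.1.convex, fun t h1 h2 => h.1.reflex t h1 (by omega) h2.ne⟩

/-- If `u` is convex, it was reached by Step 1(b), right after a convex entry, or by Step 2. -/
theorem IsTwoChain.convex_or_not_stepOne (hσ : IsBoundarySequence A m σ) (hj : IsStart σ j)
    (hgen : Generates P o ℓ A m σ j u y) (h : IsTwoChain P o ℓ A σ u v y) (hu : IsConvex σ u) :
    IsConvex σ (u - 1) ∨ ¬ ∃ c, StepOne P o ℓ A σ (u - 1) c := by
  obtain ⟨hproc, hy⟩ := hgen
  have huv := h.1.lt_left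
  have hvy := h.2.lt_right
  have hcu : IsConvex σ (u + 1) → v = u + 1 := by
    intro hc
    by_contra hne
    exact h.1.reflex (u + 1) (by omega) (by omega) (Ne.symm hne) hc
  cases hproc with
  -- at the start vertex, `u + 1` would be convex and `u + 2` reflex, or all entries convex
  | start =>
    exfalso
    rcases hj with ⟨r, hr, hr1, hr2, hr3⟩ | ⟨hno, -⟩
    · have hv := hcu hr2
      have hw : IsConvex σ (j + 2) := by
        have := h.2.convex
        rwa [hv, show j + 1 + 1 = j + 2 by ring] at this
      rcases (show j + 2 ≤ r by omega).lt_or_eq with hlt | rfl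
      · exact hr3 (j + 2) (by omega) hlt hw
      · exact hr hw
    · have hall := hσ.isConvex_of_forall hno hu
      have hv := hcu (hall _)
      have hyv : y = v + 2 := by
        by_contra hne
        exact h.2.reflex (v + 2) (by omega) (by omega) (by omega) (hall _)
      rcases hy with ⟨⟨c, hc, hjc⟩, -⟩ | ⟨-, hbas⟩
      · obtain rfl := hc.1.unique h.isForwardConvex
        -- Step 1(c) at the start vertex is impossible, as the period is not `1`
        have hm1 : m = 1 := by have := hσ.pos; omega
        have := (hσ.adj 0).ne
        have hp := hσ.periodic 0
        rw [hm1] at hp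
        exact this hp.symm
      · rcases hbas with ⟨c, hc, ⟨-, he, -⟩ | ⟨-, he⟩⟩ | ⟨-, he⟩
        · exact he.reflex (hall _)
        · obtain rfl := hc.1.unique h.isForwardConvex
          omega
        · omega
  | step p _ hp hyield hlt =>
    rcases hyield with ⟨-, j', hj', rfl⟩ | ⟨-, hbas⟩
    -- a chain from Step 1(c) ends beyond `j + m`
    · have := hj'.lt
      omega
    · rcases hbas with ⟨c, hc, ⟨-, he, -⟩ | ⟨-, he⟩⟩ | ⟨hno, he⟩
      · exact absurd hu he.reflex
      · left
        rw [he, add_sub_cancel_right]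
        exact hc.1.2.1
      · right
        rwa [he, add_sub_cancel_right]

/-- The algorithm ends a 2-chain at a reflex entry: in Step 1(a) at `u` by definition, and in Step
1(c) by the choice of the start vertex, unless all entries are convex. -/
theorem IsTwoChain.reflex_or_convex (hσ : IsBoundarySequence A m σ) (hj : IsStart σ j)
    (hgen : Generates P o ℓ A m σ j u y) (h : IsTwoChain P o ℓ A σ u v y) :
    IsReflex σ y ∨ IsConvex σ (y + 1) := by
  obtain ⟨hproc, hy⟩ := hgen
  have huv := h.1.lt_left
  have hvy := h.2.lt_right
  have hlt := hproc.lt hσ.pos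
  rcases hy with ⟨⟨c, hc, hjc⟩, j', hj', rfl⟩ | ⟨-, hbas⟩
  · obtain rfl := hc.1.unique h.isForwardConvex
    rcases hj with ⟨r, hr, hr1, hr2, hr3⟩ | ⟨hno, -⟩
    · left
      have hr' : IsReflex σ (j + 2) := by
        rcases (show j + 2 ≤ r by omega).lt_or_eq with h1 | rfl
        · exact hr3 _ (by omega) h1
        · exact hr
      have hc1 : IsConvex σ (j + 1 + m) := (hσ.isConvex_add _).2 hr2
      have hr1' : ¬ IsConvex σ (j + 2 + m) := fun h => hr' ((hσ.isConvex_add _).1 h)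
      -- in Step 1(c), `v` is the copy of the start vertex one period later
      have hcj : c = j + m := by
        by_contra hne
        have : c = j + 1 + m := by
          by_contra hne'
          exact h.1.reflex (j + 1 + m) (by omega) (by omega) (Ne.symm hne') hc1
        refine hr1' ?_
        convert h.2.convex using 1
        omega
      have hjf : IsForwardConvex σ j (j + 1) := ⟨by omega, hr2, fun t h1 h2 => by omega⟩
      unfold IsReflex
      rw [hσ.isConvex_add]
      rcases hj' with ⟨c', hc', ⟨-, he, -⟩ | ⟨-, he⟩⟩ | ⟨-, he⟩
      · exact he.reflex
      · obtain rfl := hc'.1.unique hjf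
        rw [he]
        convert hr' using 2
        ring
      · omega
    · right
      exact hσ.isConvex_of_forall hno h.1.convex _
  · left
    rcases hbas with ⟨c, hc, ⟨-, he, -⟩ | ⟨-, he⟩⟩ | ⟨-, he⟩
    · exact he.reflex
    · obtain rfl := hc.1.unique h.isForwardConvex
      omega
    · omega

end Run

/-! ### The ends of the chain are not joined to the first vertices of the pocket -/

section Ends

variable {P : Finset ℂ} {o : ℂ} {ℓ : ℝ} {A : SimpleGraph ℂ} {m : ℕ} {σ : ℤ → ℂ}
  {u v y : ℤ} {X h : ℂ}

theorem IsTwoChain.isFanChain_backward (hσ : IsBoundarySequence A m σ)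
    (hA : IsMaximalPSLG P o ℓ A) (hP : GeneralPosition P) (hℓ : 0 < ℓ)
    (hc : IsTwoChain P o ℓ A σ u v y) :
    IsFanChain P o ℓ A 1 (σ v) (σ (v + 1)) (σ u) (fun i => σ (v - i)) (v - u).toNat := by
  have huv := hc.1.lt_left
  refine ⟨by simp, by congr 1; omega, by omega, fun i hi => ?_⟩
  have := hc.isFanStep_backward hσ hA hP hℓ (v - i) (by omega) (by omega)
  rw [sub_sub] at this
  exact_mod_cast this

theorem IsTwoChain.isFanChain_forward (hσ : IsBoundarySequence A m σ)
    (hA : IsMaximalPSLG P o ℓ A) (hP : GeneralPosition P) (hℓ : 0 < ℓ)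
    (hc : IsTwoChain P o ℓ A σ u v y) :
    IsFanChain P o ℓ A (-1) (σ (v + 1)) (σ v) (σ y) (fun i => σ (v + 1 + i))
      (y - (v + 1)).toNat := by
  have huv := hc.2.lt_right
  refine ⟨by simp, by congr 1; omega, by omega, fun i hi => ?_⟩
  have := hc.isFanStep_forward hσ hA hP hℓ (v + 1 + i) (by omega) (by omega)
  rw [add_assoc (v + 1)] at this
  exact_mod_cast this

/-- An edge from `h` that turns into the pocket at the far end of an edge `u h`. -/
theorem IsCrossing.false_of_edge {ε : ℝ} {v w u y X h q : ℂ}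
    (hX : IsCrossing P o ℓ A ε v w u y X) (hε : ε ≠ 0) (hA : IsPSLG P A)
    (hh : IsFirstVertex P ε u y X h) (hq : A.Adj h q) (hpos : 0 < orient ε u h q) : False :=
  false_of_edge_into_free (A := A) (α := fun x => orient ε X u x)
    (β := fun x => orient ε X x y) (R := fun x => orient ε u h x)
    (orient_line _ _ _ _ _) (orient_line_mid _ _ _ _ _) (orient_line _ _ _ _ _)
    (Or.inl hh.pos_left) (Or.inl hh.pos_right) (by simp) hpos hq (hX.free hε hA hh)

theorem IsCrossing.false_of_edge_at_end {ε : ℝ} {v w u y X h q : ℂ}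
    (hX : IsCrossing P o ℓ A ε v w u y X) (hε : ε ≠ 0) (hA : IsPSLG P A)
    (hh : IsFirstVertex P ε u y X h) (hq : A.Adj u q) (hpos : 0 < orient ε u h q)
    (hpos' : 0 < orient ε u q w) : False := by
  obtain ⟨α, hα, H⟩ := hX.exists_left
  refine false_of_edge_into_free (A := A) (α := fun x => orient ε X u x)
    (β := fun x => orient ε X x y) (R := fun x => orient ε u h x)
    (orient_line _ _ _ _ _) (orient_line_mid _ _ _ _ _) (orient_line _ _ _ _ _)
    (Or.inr ⟨by simp, ?_⟩) (Or.inl hX.orient_pos.2.2.2.1) (by simp) hpos hq (hX.free hε hA hh)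
  rw [H, orient_rot]
  exact mul_pos hα hpos'

/-- If `u` were joined to the first vertex `h` of the pocket, `h` would be the entry before `u`, and
the algorithm would have processed this entry and not have stopped at `u`. -/
theorem IsTwoChain.not_adj_left (hσ : IsBoundarySequence A m σ) (hA : IsMaximalPSLG P o ℓ A)
    (hP : GeneralPosition P) (hℓ : 0 < ℓ) (hc : IsTwoChain P o ℓ A σ u v y)
    (halg : IsConvex σ u → IsConvex σ (u - 1) ∨ ¬ ∃ c, StepOne P o ℓ A σ (u - 1) c)
    (hX : IsCrossing P o ℓ A 1 (σ v) (σ (v + 1)) (σ u) (σ y) X)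
    (hh : IsFirstVertex P 1 (σ u) (σ y) X h) : ¬ A.Adj (σ u) h := by
  intro huh
  have hA' := hA.prop.1
  have hs := hc.isFanChain_backward hσ hA hP hℓ
  have huv := hc.1.lt_left
  have pa := hσ.adj_prev u
  have ca := hσ.adj u
  obtain ⟨k, hk⟩ : ∃ k, (v - u).toNat = k + 1 := ⟨(v - u).toNat - 1, by omega⟩
  have hkv : v - (k : ℤ) = u + 1 := by omega
  rw [hk] at hs
  have hlast := hh.pos_last hX hs
  simp only [hkv] at hlast
  -- the sector at `u` contains the direction of `w`, and the cone from `h` to `w` is empty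
  have heq : σ (u - 1) = h := by
    by_contra hne
    obtain ⟨-, hsec, -⟩ := hc.1.visible
    unfold InSector at hsec
    have hn := hσ.next u h huh
    have hwu : σ (v + 1) ≠ σ u := (ne_of_orient hX.left.pos).2.2
    have h1 := hh.pos_line hX
    rw [orient_rot, orient_pos_iff pa.ne' huh.ne' hwu] at h1
    have h2 : rightAngle (σ (u - 1)) (σ u) h ≠ 2 * Real.pi := by
      intro h
      rw [← rightAngle_self pa.ne'] at h
      exact hne (eq_of_rightAngle_eq hA' hP pa huh pa h).symm
    have h2 := lt_of_le_of_ne (rightAngle_le _ _ _) h2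
    have h3 := rightAngle_pos (σ (u - 1)) (σ u) (σ (v + 1))
    refine hX.false_of_edge_at_end one_ne_zero hA' hh pa ?_ ?_
    · rw [orient_pos_iff pa.ne' huh.ne' pa.ne', rightAngle_self pa.ne']
      left
      rcases h1 with h1 | h1 <;> constructor <;> linarith
    · rw [← rightAngle_lt_pi_iff pa.ne' hwu]
      rcases h1 with h1 | h1 <;> linarith
  have hu : IsConvex σ u := by
    rw [hσ.isConvex_iff, heq, ← orient_rot]
    exact hlast
  have hprev : ¬ IsConvex σ (u - 1) := by
    intro hcon
    have hq := hσ.adj_prev (u - 1)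
    rw [hσ.isConvex_iff, sub_add_cancel, heq, ← orient_rot] at hcon
    rw [heq] at hq
    exact hX.false_of_edge one_ne_zero hA' hh hq hcon
  -- Step 1 applies at `u - 1`: its forward convex vertex is `u`, and it sees `u + 1`
  refine (halg hu).elim hprev fun hno => hno ⟨u, ⟨by omega, hu, fun t h1 h2 => by omega⟩, ?_, ?_⟩
  · exact hA.prop.2 _ _ pa.symm
  have hdis := hs.disjoint hX one_ne_zero hP hA hh (i := k) (by omega) (by
    rw [hs.last]
    simp only [hkv]
    exact hlast)
  simp only [hkv] at hdis
  have hne : σ (u + 1) ≠ h := (ne_of_orient hlast).2.2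
  refine ⟨by rwa [heq, openSegment_symm], ?_, ?_⟩
  · unfold InSector
    rw [sub_add_cancel]
    have pa' := hσ.adj_prev (u - 1)
    have ca' := hσ.adj (u - 1)
    unfold IsConvex at hprev
    rw [sub_add_cancel] at hprev ca'
    rw [heq] at hprev ca' pa' ⊢
    rw [orient_rot, orient_rot, orient_pos_iff pa'.ne' hne ca'.ne'] at hlast
    have := rightAngle_le (σ (u - 1 - 1)) h (σ (u + 1))
    rcases hlast with h1 | h1
    · exact h1.1
    · exact absurd (by linarith) hprev
  · unfold InSector
    rw [add_sub_cancel_right, heq]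
    have pb := hσ.adj_prev (u + 1)
    have cb := hσ.adj (u + 1)
    rw [add_sub_cancel_right] at pb
    have h1 := hlast
    rw [← rightAngle_lt_pi_iff pb.ne' hne.symm] at h1
    by_cases hv : u + 1 = v
    · have h2 := hh.pos_base_edge hX
      have hconv := hc.1.convex
      rw [← hv] at h2 hconv
      unfold IsConvex at hconv
      rw [add_sub_cancel_right] at hconv
      rw [orient_rot, orient_pos_iff pb.ne' hne.symm cb.ne'] at h2
      have := rightAngle_pos (σ u) (σ (u + 1)) (σ (u + 1 + 1))
      have := rightAngle_pos (σ u) (σ (u + 1)) h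
      rcases h2 with h2 | h2 <;> linarith
    · have hr := hc.1.reflex (u + 1) (by omega) (by omega) hv
      unfold IsReflex IsConvex at hr
      rw [add_sub_cancel_right, not_lt] at hr
      linarith

/-- If `y` were joined to the first vertex `h` of the pocket, `h` would be the entry after `y`, and
`y` would be convex. -/
theorem IsTwoChain.not_adj_right (hσ : IsBoundarySequence A m σ) (hA : IsMaximalPSLG P o ℓ A)
    (hP : GeneralPosition P) (hℓ : 0 < ℓ) (hc : IsTwoChain P o ℓ A σ u v y)
    (halg : IsReflex σ y ∨ IsConvex σ (y + 1))
    (hX : IsCrossing P o ℓ A (-1) (σ (v + 1)) (σ v) (σ y) (σ u) X)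
    (hh : IsFirstVertex P (-1) (σ y) (σ u) X h) : ¬ A.Adj (σ y) h := by
  intro hyh
  have hA' := hA.prop.1
  have hs := hc.isFanChain_forward hσ hA hP hℓ
  have hvy := hc.2.lt_right
  have pa := hσ.adj_prev y
  have ca := hσ.adj y
  obtain ⟨k, hk⟩ : ∃ k, (y - (v + 1)).toNat = k + 1 := ⟨(y - (v + 1)).toNat - 1, by omega⟩
  have hkv : v + 1 + (k : ℤ) = y - 1 := by omega
  rw [hk] at hs
  have hlast := hh.pos_last hX hs
  simp only [hkv] at hlast
  rw [orient_neg, ← orient_swap_left, ← rightAngle_lt_pi_iff pa.ne' hyh.ne'] at hlast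
  -- the sector at `y` contains the direction of `v`, and the cone from `v` to `h` is empty
  have heq : σ (y + 1) = h := by
    by_contra hne
    obtain ⟨-, -, hsec⟩ := hc.2.visible
    unfold InSector at hsec
    have hn := lt_of_le_of_ne (hσ.next y h hyh)
      fun h => hne (eq_of_rightAngle_eq hA' hP pa ca hyh h)
    have hvy' : σ v ≠ σ y := (ne_of_orient hX.left.pos).2.2
    have h3 := rightAngle_pos (σ (y - 1)) (σ y) (σ v)
    refine hX.false_of_edge_at_end (by norm_num) hA' hh ca ?_ ?_
    · rw [orient_neg, ← orient_swap, orient_pos_iff pa.ne' ca.ne' hyh.ne']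
      left
      constructor <;> linarith
    · rw [orient_neg, ← orient_swap, orient_pos_iff pa.ne' hvy' ca.ne']
      left
      constructor <;> linarith
  have hy : IsConvex σ y := by
    unfold IsConvex
    rw [heq]
    exact hlast
  rcases halg with hr | hcon
  · exact hr hy
  · have hq := hσ.adj (y + 1)
    rw [hσ.isConvex_iff, add_sub_cancel_right, heq] at hcon
    rw [heq] at hq
    refine hX.false_of_edge (by norm_num) hA' hh hq ?_
    rw [orient_neg, ← orient_swap_left]
    exact hcon

end Ends

/-! ### The region bounded by the chain -/

section Region

variable {P : Finset ℂ} {o : ℂ} {ℓ : ℝ} {A : SimpleGraph ℂ} {m : ℕ} {σ : ℤ → ℂ}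
  {u v y : ℤ} {X z : ℂ}

/-- From a point of the region, every ray meets the polygon. -/
theorem exists_mem_closedPolygon (hz : z ∈ region σ u y) (hXz : X ≠ z) :
    ∃ μ : ℝ, 0 < μ ∧ μ < 1 ∧ ∃ q ∈ closedPolygon σ u y, z = (1 - μ) • q + μ • X := by
  obtain ⟨hzp, hbdd⟩ := hz
  by_contra hcon
  push Not at hcon
  set R : Set ℂ := (fun r : ℝ => z + r • (z - X)) '' Set.Ici 0 with hR
  have hRpre : IsPreconnected R :=
    isPreconnected_Ici.image _ (by fun_prop)
  have hzR : z ∈ R := ⟨0, Set.mem_Ici.2 le_rfl, by simp⟩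
  have hRsub : R ⊆ (closedPolygon σ u y)ᶜ := by
    rintro _ ⟨r, hr, rfl⟩ hq
    rcases (Set.mem_Ici.1 hr).lt_or_eq with hr | rfl
    · refine hcon (r / (1 + r)) (by positivity) (by rw [div_lt_one (by linarith)]; linarith) _ hq ?_
      have h1 : (1 : ℂ) + r ≠ 0 := by
        have : (1 + r : ℝ) ≠ 0 := by positivity
        exact_mod_cast this
      simp only [Complex.real_smul]
      push_cast
      field_simp
      ring
    · exact hzp (by simpa using hq)
  have hsub := hRpre.subset_connectedComponentIn hzR hRsub
  obtain ⟨C, hC⟩ := (hbdd.subset hsub).exists_norm_le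
  have hd : 0 < ‖z - X‖ := norm_pos_iff.2 (sub_ne_zero.2 hXz.symm)
  have hC0 : 0 ≤ C := (norm_nonneg _).trans (hC z hzR)
  have h1 := hC _ ⟨(C + ‖z‖ + 1) / ‖z - X‖, Set.mem_Ici.2 (by positivity), rfl⟩
  have h2 := norm_sub_norm_le (((C + ‖z‖ + 1) / ‖z - X‖) • (z - X)) (-z)
  rw [sub_neg_eq_add, add_comm _ z, norm_neg, norm_smul, Real.norm_of_nonneg (by positivity),
    div_mul_cancel₀ _ hd.ne'] at h2
  simp only at h1
  linarith

/-- No vertex lies in the triangle between `X` and an edge of the hull, off that edge. -/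
theorem IsFanStep.false_of_mem {ε : ℝ} {v w u y X a b q : ℂ} {μ : ℝ}
    (hst : IsFanStep P o ℓ A ε v w u a b) (hX : IsCrossing P o ℓ A ε v w u y X)
    (hpos : 0 < orient ε a b X) (h0 : 0 < μ) (h1 : μ < 1) (hq : q ∈ segment ℝ a b)
    (hz : (1 - μ) • q + μ • X ∈ P) : False := by
  obtain ⟨α, β, hα, hβ, hαβ, rfl⟩ := hX.mem_left
  obtain rfl : α = 1 - β := by linarith
  obtain ⟨s, t, hs, ht, hst', rfl⟩ := hq
  obtain rfl : s = 1 - t := by linarith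
  have e1 : 0 < orient ε w a ((1 - μ) • ((1 - t) • a + t • b) + μ • ((1 - β) • w + β • u)) := by
    simp only [orient_line, orient_self_right, orient_self_mid, mul_zero, zero_add]
    have := mul_nonneg ht hst.pos.le
    have := mul_nonneg (sub_nonneg.2 h1.le) this
    have := mul_pos h0 (mul_pos hβ hst.pos_left)
    linarith
  have e2 : 0 ≤ orient ε w ((1 - μ) • ((1 - t) • a + t • b) + μ • ((1 - β) • w + β • u)) u := by
    simp only [orient_line_mid, orient_self_right, orient_self_left, mul_zero, add_zero]
    have := mul_nonneg hs hst.pos_left.le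
    have := mul_nonneg ht hst.nonneg_right
    exact mul_nonneg (sub_nonneg.2 h1.le) (by linarith)
  have e3 := hst.extremal _ hz e1 e2
  rw [orient_line, orient_line ε a b a b] at e3
  simp only [orient_self_right, orient_self_mid, mul_zero, add_zero, zero_add] at e3
  have := mul_pos h0 hpos
  linarith

/-- No vertex lies in the triangle between `X` and the edge `v w`, off that edge. -/
theorem IsFanStep.false_of_mem_base {ε : ℝ} {v w u y X b q : ℂ} {μ : ℝ}
    (hst : IsFanStep P o ℓ A ε v w u v b) (hX : IsCrossing P o ℓ A ε v w u y X)
    (hpos : 0 < orient ε v b X) (h0 : 0 < μ) (h1 : μ < 1) (hq : q ∈ segment ℝ v w)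
    (hz : (1 - μ) • q + μ • X ∈ P) : False := by
  obtain ⟨α, β, hα, hβ, hαβ, rfl⟩ := hX.mem_left
  obtain rfl : α = 1 - β := by linarith
  obtain ⟨s, t, hs, ht, hst', rfl⟩ := hq
  obtain rfl : s = 1 - t := by linarith
  have e1 : 0 < orient ε w v ((1 - μ) • ((1 - t) • v + t • w) + μ • ((1 - β) • w + β • u)) := by
    simp only [orient_line, orient_self_right, orient_self_mid, mul_zero, zero_add]
    have := mul_pos h0 (mul_pos hβ hst.pos_left)
    linarith
  have e2 : 0 ≤ orient ε w ((1 - μ) • ((1 - t) • v + t • w) + μ • ((1 - β) • w + β • u)) u := by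
    simp only [orient_line_mid, orient_self_right, orient_self_left, mul_zero, add_zero]
    exact mul_nonneg (sub_nonneg.2 h1.le) (mul_nonneg hs hst.pos_left.le)
  have e3 := hst.extremal _ hz e1 e2
  rw [orient_line, orient_line ε v b v w] at e3
  simp only [orient_self_mid, mul_zero, zero_add] at e3
  rw [← orient_rot ε w v b] at e3
  have := mul_pos h0 hpos
  have := mul_nonneg (sub_nonneg.2 h1.le) (mul_nonneg ht hst.pos.le)
  linarith

end Region

end GridMWT

theorem mainTheorem3 (P : Finset ℂ) (hP : GridMWT.GeneralPosition P)
    (o : ℂ) (ℓ : ℝ) (hℓ : 0 < ℓ)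
    (A : SimpleGraph ℂ) (hA : GridMWT.IsMaximalPSLG P o ℓ A)
    (m : ℕ) (σ : ℤ → ℂ) (hσ : GridMWT.IsBoundarySequence A m σ)
    (j : ℤ) (hj : GridMWT.IsStart σ j)
    (u v y : ℤ) (hgen : GridMWT.Generates P o ℓ A m σ j u y)
    (hchain : GridMWT.IsTwoChain P o ℓ A σ u v y) :
    Disjoint (GridMWT.region σ u y) (P : Set ℂ) := by
  have hs := hchain.isFanChain_backward hσ hA hP hℓ
  have hs' := hchain.isFanChain_forward hσ hA hP hℓ
  obtain ⟨X, hX⟩ := GridMWT.exists_isCrossing hℓ (Or.inl rfl) hP hA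
    (hchain.1.isFanBase_backward hσ hA hchain.2.convex)
    (hchain.2.isFanBase_forward hσ hA hchain.1.convex)
  have hA' := hA.prop.1
  refine Set.disjoint_left.2 fun z hz hzP => ?_
  have hXz : X ≠ z := by
    rintro rfl
    exact hX.notMem_drawing (Or.inl hzP)
  obtain ⟨μ, h0, h1, q, hq, rfl⟩ := GridMWT.exists_mem_closedPolygon hz hXz
  rcases hq with ⟨t, ht1, ht2, hq⟩ | hq
  · rcases lt_trichotomy t v with htv | rfl | htv
    · have hi : (v - (t + 1)).toNat < (v - u).toNat := by omega
      have hst := hs.step _ hi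
      have hpos := hs.pos_crossing hX one_ne_zero hP hA hi
      have e1 : v - ((v - (t + 1)).toNat : ℤ) = t + 1 := by omega
      have e2 : v - (((v - (t + 1)).toNat + 1 : ℕ) : ℤ) = t := by omega
      simp only [e1, e2] at hst hpos
      exact hst.false_of_mem hX hpos h0 h1 (by rwa [segment_symm]) hzP
    · have hst := hs.step 0 hs.pos
      have hpos := hs.pos_crossing hX one_ne_zero hP hA hs.pos
      simp only [Nat.cast_zero, sub_zero] at hst hpos
      exact hst.false_of_mem_base hX hpos h0 h1 hq hzP
    · have hi : (t - (v + 1)).toNat < (y - (v + 1)).toNat := by omega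
      have hst := hs'.step _ hi
      have hpos := hs'.pos_crossing hX.symm (by norm_num) hP hA hi
      have e1 : v + 1 + ((t - (v + 1)).toNat : ℤ) = t := by omega
      have e2 : v + 1 + (((t - (v + 1)).toNat + 1 : ℕ) : ℤ) = t + 1 := by omega
      simp only [e1, e2] at hst hpos
      exact hst.false_of_mem hX.symm hpos h0 h1 hq hzP
  -- a vertex of the pocket
  · obtain ⟨s, r, hs0, hr0, hsr, rfl⟩ := hq
    obtain rfl : s = 1 - r := by linarith
    have hT := hX.orient_pos.2.2.2.1
    have e1 : 0 ≤ GridMWT.orient 1 X (σ u) ((1 - μ) • ((1 - r) • σ y + r • σ u) + μ • X) := by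
      simp only [GridMWT.orient_line, GridMWT.orient_self_right, GridMWT.orient_self_mid, mul_zero,
        add_zero]
      exact mul_nonneg (by linarith) (mul_nonneg hs0 hT.le)
    have e2 : 0 ≤ GridMWT.orient 1 X ((1 - μ) • ((1 - r) • σ y + r • σ u) + μ • X) (σ y) := by
      simp only [GridMWT.orient_line_mid, GridMWT.orient_self_right, GridMWT.orient_self_left,
        mul_zero, add_zero, zero_add]
      exact mul_nonneg (by linarith) (mul_nonneg hr0 hT.le)
    have e3 : 0 < GridMWT.orient 1 (σ u) (σ y)
        ((1 - μ) • ((1 - r) • σ y + r • σ u) + μ • X) := by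
      simp only [GridMWT.orient_line, GridMWT.orient_self_right, GridMWT.orient_self_mid, mul_zero,
        add_zero, zero_add]
      rw [← GridMWT.orient_rot 1 X]
      exact mul_pos h0 hT
    obtain ⟨h, hh⟩ := hX.exists_isFirstVertex hP one_ne_zero hA' hzP e1 e2 e3
    obtain ⟨h', hh'⟩ := hX.symm.exists_isFirstVertex hP (by norm_num) hA' hzP
      (by rwa [GridMWT.orient_neg, ← GridMWT.orient_swap])
      (by rwa [GridMWT.orient_neg, ← GridMWT.orient_swap])
      (by rwa [GridMWT.orient_neg, ← GridMWT.orient_swap_left])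
    rcases hX.adj_or_adj hℓ (Or.inl rfl) hP hA hs hs' hh hh' with h | h
    · exact hchain.not_adj_left hσ hA hP hℓ (hchain.convex_or_not_stepOne hσ hj hgen) hX hh h
    · exact hchain.not_adj_right hσ hA hP hℓ (hchain.reflex_or_convex hσ hj hgen) hX.symm hh' h
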